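/- Let $D\subset\mathbb{R}^2$ be a bounded domain (non-empty, open, connected) with $\mathcal{C}^2$ boundary, with outward unit normal $\nu$ and arc length $ds$ on $\partial D$. Let $\lambda\in\mathbb{R}$ with $|\lambda|>1/2$; equivalently, $\lambda=\frac{\kappa+1}{2(\kappa-1)}$ for a conductivity $\kappa\in(0,\infty)\setminus\{1\}$. Let $\mathcal{K}_D^*$ be the adjoint of the Neumann–Poincaré operator, $$\mathcal{K}_D^*[\varphi](x)=\frac1{2\pi}\int_{\partial D}\frac{\langle x-y,\nu_x\rangle}{|x-y|^2}\,\varphi(y)\,ds(y),\qquad x\in\partial D .$$ Then $\lambda I-\mathcal{K}_D^*$ is invertible on $L^2(\partial D)$, so that for multi-indices $\alpha,\beta\in\mathbb{N}^2$ the generalized polarization tensors $$M_{\alpha\beta}=\int_{\partial D}y^\beta\,(\lambda I-\mathcal{K}_D^*)^{-1}\Big[\frac{\partial y^\alpha}{\partial\nu}\Big](y)\,ds(y)$$ are well defined. Write $(x_1+ix_2)^m=\sum_{|\alpha|=m}a^m_\alpha x^\alpha+i\sum_{|\alpha|=m}b^m_\alpha x^\alpha$ with real coefficients $a^m_\alpha,b^m_\alpha$,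 and for $m,n\ge1$ put $$M^{cc}_{mn}=\sum_{|\alpha|=m,|\beta|=n}a^m_\alpha a^n_\beta M_{\alpha\beta},\quad M^{cs}_{mn}=\sum_{|\alpha|=m,|\beta|=n} a^m_\alpha b^n_\beta M_{\alpha\beta},\quad M^{sc}_{mn}=\sum_{|\alpha|=m,|\beta|=n} b^m_\alpha a^n_\beta M_{\alpha\beta},\quad M^{ss}_{mn}=\sum_{|\alpha|=m,|\beta|=n} b^m_\alpha b^n_\beta M_{\alpha\beta}.$$ Define the complex contracted generalized polarization tensor (CGPT) matrices $\mathbf{N}^{(1)}=(\mathbf{N}^{(1)}_{mn})_{m,n\ge1}$ and $\mathbf{N}^{(2)}=(\mathbf{N}^{(2)}_{mn})_{m,n\ge1}$ by $$\mathbf{N}^{(1)}_{mn}=(M^{cc}_{mn}-M^{ss}_{mn})+i(M^{cs}_{mn}+M^{sc}_{mn}),\qquad \mathbf{N}^{(2)}_{mn}=(M^{cc}_{mn}+M^{ss}_{mn})+i(M^{cs}_{mn}-M^{sc}_{mn}).$$ Then $\mathbf{N}^{(1)}$ is symmetric, $(\mathbf{N}^{(1)})^t=\mathbf{N}^{(1)}$,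 and $\mathbf{N}^{(2)}$ is Hermitian, $(\mathbf{N}^{(2)})^H=\mathbf{N}^{(2)}$. Moreover, the diagonal entries $\mathbf{N}^{(2)}_{mm}$, $m\ge1$, are (real and) strictly positive if $\lambda>0$ and strictly negative if $\lambda<0$. -/

import Mathlib

open scoped ComplexOrder

noncomputable section

namespace CGPT

open MeasureTheory Complex

/-- The Euclidean plane. -/
abbrev Plane : Type := EuclideanSpace ℝ (Fin 2)

/-- `ρ` is a `C²` defining function of the open set `D` on the open neighbourhood `U` of the
boundary point `x`: inside `U` the set `D` is `{ρ < 0}`, `ρ x = 0` and `∇ρ x ≠ 0`. -/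
structure IsLocalDefiningFunction (D U : Set Plane) (ρ : Plane → ℝ) (x : Plane) : Prop where
  isOpen : IsOpen U
  mem : x ∈ U
  contDiffOn : ContDiffOn ℝ 2 ρ U
  eq_zero : ρ x = 0
  gradient_ne_zero : gradient ρ x ≠ 0
  inter_eq : D ∩ U = {y ∈ U | ρ y < 0}

/-- A bounded domain (non-empty connected open set) of the plane with `C²` boundary. -/
structure IsBoundedC2Domain (D : Set Plane) : Prop where
  isOpen : IsOpen D
  isConnected : IsConnected D
  isBounded : Bornology.IsBounded D
  boundary : ∀ x ∈ frontier D, ∃ U ρ, IsLocalDefiningFunction D U ρ x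

/-- `n` is the outward unit normal of `D` at the boundary point `x`, that is `∇ρ x / ‖∇ρ x‖` for a
local defining function `ρ`. -/
def IsOutwardUnitNormal (D : Set Plane) (x n : Plane) : Prop :=
  ∃ U ρ, IsLocalDefiningFunction D U ρ x ∧ n = ‖gradient ρ x‖⁻¹ • gradient ρ x

/-- Along a direction `v` the defining function has the sign of `⟪∇ρ x, v⟫` for small times. -/
theorem IsLocalDefiningFunction.eventually_mem {D U : Set Plane} {ρ : Plane → ℝ} {x : Plane}
    (h : IsLocalDefiningFunction D U ρ x) (v : Plane) :
    (inner ℝ (gradient ρ x) v < 0 → ∀ᶠ t : ℝ in nhdsWithin 0 (Set.Ioi 0), x + t • v ∈ D) ∧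
    (0 < inner ℝ (gradient ρ x) v →
      ∀ᶠ t : ℝ in nhdsWithin 0 (Set.Ioi 0), x + t • v ∉ D) := by
  have hd : DifferentiableAt ℝ ρ x :=
    (h.contDiffOn.contDiffAt (h.isOpen.mem_nhds h.mem)).differentiableAt (by norm_num)
  have hl : HasDerivAt (fun t : ℝ => x + t • v) v 0 := by
    simpa using ((hasDerivAt_id (0 : ℝ)).smul_const v).const_add x
  have hc : HasDerivAt (fun t : ℝ => ρ (x + t • v)) (inner ℝ (gradient ρ x) v) 0 := by
    have h1 : HasFDerivAt ρ (fderiv ℝ ρ x) (x + (0 : ℝ) • v) := by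
      simpa using hd.hasFDerivAt
    have h2 := h1.comp_hasDerivAt (0 : ℝ) hl
    have h3 : inner ℝ (gradient ρ x) v = fderiv ℝ ρ x v := by
      simp [gradient]
    rw [h3]
    exact h2
  have hU : ∀ᶠ t : ℝ in nhdsWithin 0 (Set.Ioi 0), x + t • v ∈ U := by
    refine (hl.continuousAt.eventually ?_).filter_mono nhdsWithin_le_nhds
    simpa using h.isOpen.mem_nhds h.mem
  have hs := (hasDerivAt_iff_tendsto_slope.1 hc).mono_left
    (nhdsWithin_mono (0 : ℝ) (fun t (ht : t ∈ Set.Ioi (0 : ℝ)) => ne_of_gt ht))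
  have hsl : ∀ t : ℝ, slope (fun t : ℝ => ρ (x + t • v)) 0 t = t⁻¹ * ρ (x + t • v) := by
    intro t
    simp [slope, h.eq_zero]
  refine ⟨fun hv => ?_, fun hv => ?_⟩
  · filter_upwards [hU, hs.eventually (gt_mem_nhds hv), self_mem_nhdsWithin] with t h1 h2 h3
    have h3' : (0 : ℝ) < t := h3
    rw [hsl] at h2
    have : x + t • v ∈ D ∩ U := by
      rw [h.inter_eq]
      refine ⟨h1, ?_⟩
      by_contra hn
      have := mul_nonneg (inv_pos.2 h3').le (not_lt.1 hn)
      linarith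
    exact this.1
  · filter_upwards [hU, hs.eventually (lt_mem_nhds hv), self_mem_nhdsWithin] with t h1 h2 h3 hmem
    have h3' : (0 : ℝ) < t := h3
    rw [hsl] at h2
    have h4 : x + t • v ∈ D ∩ U := ⟨hmem, h1⟩
    rw [h.inter_eq] at h4
    have := mul_neg_of_pos_of_neg (inv_pos.2 h3') h4.2
    linarith

/-- The outward unit normal does not depend on the defining function. -/
theorem IsOutwardUnitNormal.unique {D : Set Plane} {x n n' : Plane}
    (h : IsOutwardUnitNormal D x n) (h' : IsOutwardUnitNormal D x n') : n = n' := by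
  obtain ⟨U, ρ, hρ, rfl⟩ := h
  obtain ⟨U', ρ', hρ', rfl⟩ := h'
  set a := gradient ρ x with ha
  set b := gradient ρ' x with hb
  have ha0 : 0 < ‖a‖ := norm_pos_iff.2 hρ.gradient_ne_zero
  have hb0 : 0 < ‖b‖ := norm_pos_iff.2 hρ'.gradient_ne_zero
  by_contra hne
  have key : inner ℝ a b < ‖a‖ * ‖b‖ := by
    refine lt_of_le_of_ne (real_inner_le_norm a b) fun he => hne ?_
    have h1 := inner_eq_norm_mul_iff_real.1 he
    have h2 : a = (‖a‖ * ‖b‖⁻¹) • b := by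
      calc a = ‖b‖⁻¹ • (‖b‖ • a) := by rw [smul_smul, inv_mul_cancel₀ hb0.ne', one_smul]
        _ = _ := by rw [h1, smul_smul, mul_comm]
    calc ‖a‖⁻¹ • a = ‖a‖⁻¹ • ((‖a‖ * ‖b‖⁻¹) • b) := by rw [← h2]
      _ = ‖b‖⁻¹ • b := by rw [smul_smul, ← mul_assoc, inv_mul_cancel₀ ha0.ne', one_mul]
  have e1 : inner ℝ a (‖a‖ • b - ‖b‖ • a) < 0 := by
    rw [inner_sub_right, inner_smul_right, inner_smul_right, real_inner_self_eq_norm_sq]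
    nlinarith
  have e2 : 0 < inner ℝ b (‖a‖ • b - ‖b‖ • a) := by
    rw [inner_sub_right, inner_smul_right, inner_smul_right, real_inner_self_eq_norm_sq,
      real_inner_comm]
    nlinarith
  obtain ⟨t, ht1, ht2⟩ :=
    (((hρ.eventually_mem _).1 e1).and ((hρ'.eventually_mem _).2 e2)).exists
  exact ht2 ht1

open Classical in
/-- The outward unit normal field `ν` of `D` (the value `0` off the `C²` boundary is never used). -/
def normal (D : Set Plane) (x : Plane) : Plane :=
  if h : ∃ n, IsOutwardUnitNormal D x n then h.choose else 0

/-- The arc length measure `ds` on the boundary of `D`. -/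
def arcLength (D : Set Plane) : Measure Plane :=
  (Measure.hausdorffMeasure 1).restrict (frontier D)

/-- The kernel `⟨y - x, ν_y⟩ / (2π |x - y|²)` of the Neumann–Poincaré operator `K_D`. -/
def npKernel (D : Set Plane) (x y : Plane) : ℝ :=
  1 / (2 * Real.pi) * (inner ℝ (y - x) (normal D y) / ‖x - y‖ ^ 2)

/-- The adjoint `K_D^*` of the Neumann–Poincaré operator `K_D`, that is the integral operator
with the transposed kernel `⟨x - y, ν_x⟩ / (2π |x - y|²)`. -/
def npAdjoint (D : Set Plane) (φ : Plane → ℝ) (x : Plane) : ℝ :=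
  ∫ y, npKernel D y x * φ y ∂(arcLength D)

/-- `φ ∈ L²(∂D)` and `(lam I - K_D^*) φ = g` in `L²(∂D)`. -/
def SolvesNP (D : Set Plane) (lam : ℝ) (g φ : Plane → ℝ) : Prop :=
  MemLp φ 2 (arcLength D) ∧
    ∀ᵐ x ∂(arcLength D), lam * φ x - npAdjoint D φ x = g x

/-- `lam I - K_D^*` is invertible on `L²(∂D)`. -/
def ResolventExists (D : Set Plane) (lam : ℝ) : Prop :=
  ∀ g : Plane → ℝ, MemLp g 2 (arcLength D) →
    ∃ φ, SolvesNP D lam g φ ∧ ∀ ψ, SolvesNP D lam g ψ → ψ =ᵐ[arcLength D] φ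

open Classical in
/-- A representative of `(lam I - K_D^*)⁻¹ g ∈ L²(∂D)`. -/
def resolvent (D : Set Plane) (lam : ℝ) (g : Plane → ℝ) : Plane → ℝ :=
  if h : ∃ φ, SolvesNP D lam g φ then h.choose else 0

/-- The monomial `y ↦ y^α = y₁^α₁ y₂^α₂`. -/
def monomial (α : ℕ × ℕ) (y : Plane) : ℝ := y 0 ^ α.1 * y 1 ^ α.2

/-- The normal derivative `∂f/∂ν = ⟨ν, ∇f⟩` on the boundary of `D`. -/
def normalDeriv (D : Set Plane) (f : Plane → ℝ) (y : Plane) : ℝ :=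
  inner ℝ (normal D y) (gradient f y)

/-- The generalized polarization tensor
`M_{αβ}(lam, D) = ∫_{∂D} y^β (lam I - K_D^*)⁻¹[∂y^α/∂ν](y) ds(y)`. -/
def gpt (lam : ℝ) (D : Set Plane) (α β : ℕ × ℕ) : ℝ :=
  ∫ y, monomial β y * resolvent D lam (normalDeriv D (monomial α)) y ∂(arcLength D)

/-- The coefficient `a^m_α` of `Re (x₁ + i x₂)^m`. -/
def coeffRe (m : ℕ) (α : ℕ × ℕ) : ℝ := ((m.choose α.2 : ℂ) * I ^ α.2).re

/-- The coefficient `b^m_α` of `Im (x₁ + i x₂)^m`. -/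
def coeffIm (m : ℕ) (α : ℕ × ℕ) : ℝ := ((m.choose α.2 : ℂ) * I ^ α.2).im

/-- The characterization of `a^m_α` and `b^m_α`: `(x₁ + i x₂)^m = ∑ a^m_α x^α + i ∑ b^m_α x^α`. -/
theorem pow_eq_coeff (m : ℕ) (x : Plane) :
    ((x 0 : ℂ) + I * (x 1 : ℂ)) ^ m =
      ((∑ α ∈ Finset.HasAntidiagonal.antidiagonal m, coeffRe m α * monomial α x : ℝ) : ℂ) +
        I * ((∑ α ∈ Finset.HasAntidiagonal.antidiagonal m, coeffIm m α * monomial α x : ℝ) : ℂ) := by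
  rw [add_comm (x 0 : ℂ), (Commute.all _ _).add_pow', ← Finset.Nat.sum_antidiagonal_swap]
  push_cast
  rw [Finset.mul_sum, ← Finset.sum_add_distrib]
  refine Finset.sum_congr rfl fun α hα => ?_
  have hm : m.choose α.2 • (((I * (x 1 : ℂ)) ^ α.2) * (x 0 : ℂ) ^ α.1) =
      ((m.choose α.2 : ℂ) * I ^ α.2) * (monomial α x : ℂ) := by
    simp only [nsmul_eq_mul, monomial]
    push_cast
    ring
  have hz := re_add_im ((m.choose α.2 : ℂ) * I ^ α.2)
  simp only [Prod.fst_swap, Prod.snd_swap]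
  rw [hm, ← hz]
  simp only [coeffRe, coeffIm]
  rw [hz]
  linear_combination (-(monomial α x : ℂ)) * hz

/-- The combination `∑_{|α| = m} ∑_{|β| = n} p_α q_β M_{αβ}(lam, D)`. -/
def contraction (lam : ℝ) (D : Set Plane) (m n : ℕ) (p q : ℕ × ℕ → ℝ) : ℝ :=
  ∑ α ∈ Finset.HasAntidiagonal.antidiagonal m, ∑ β ∈ Finset.HasAntidiagonal.antidiagonal n, p α * q β * gpt lam D α β

/-- The contracted generalized polarization tensor `M^{cc}_{mn}`. -/
def Mcc (lam : ℝ) (D : Set Plane) (m n : ℕ) : ℝ :=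
  contraction lam D m n (coeffRe m) (coeffRe n)

/-- The contracted generalized polarization tensor `M^{cs}_{mn}`. -/
def Mcs (lam : ℝ) (D : Set Plane) (m n : ℕ) : ℝ :=
  contraction lam D m n (coeffRe m) (coeffIm n)

/-- The contracted generalized polarization tensor `M^{sc}_{mn}`. -/
def Msc (lam : ℝ) (D : Set Plane) (m n : ℕ) : ℝ :=
  contraction lam D m n (coeffIm m) (coeffRe n)

/-- The contracted generalized polarization tensor `M^{ss}_{mn}`. -/
def Mss (lam : ℝ) (D : Set Plane) (m n : ℕ) : ℝ :=
  contraction lam D m n (coeffIm m) (coeffIm n)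

/-- The complex CGPT matrix `N^{(1)}`, with rows and columns `m, n = 1, 2, …`. -/
def N1 (lam : ℝ) (D : Set Plane) : Matrix ℕ+ ℕ+ ℂ := fun m n =>
  ((Mcc lam D m n - Mss lam D m n : ℝ) : ℂ) + I * ((Mcs lam D m n + Msc lam D m n : ℝ) : ℂ)

/-- The complex CGPT matrix `N^{(2)}`, with rows and columns `m, n = 1, 2, …`. -/
def N2 (lam : ℝ) (D : Set Plane) : Matrix ℕ+ ℕ+ ℂ := fun m n =>
  ((Mcc lam D m n + Mss lam D m n : ℝ) : ℂ) + I * ((Mcs lam D m n - Msc lam D m n : ℝ) : ℂ)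

end CGPT

end

/-! The proof runs on one bilinear form. Let S be the single layer potential with kernel
log|x−y|/2π. Formally the interior normal derivative of Sψ is (K* − 1/2)ψ, so for harmonic f, g the
form `energy D φ f ψ g` should be the Dirichlet form over D of Sφ + f against Sψ + g. Hence it is
symmetric (`energy_symm`) and nonnegative on the diagonal (`energy_self_nonneg`). If (λ − K*)ψ =
∂g/∂ν, it collapses to (λ − 1/2)∫(Sφ + f)ψ (`energy_eq_of_solves`). Symmetry of the form then gives
∫ψ = 0 (take φ = 0, f = 1) and, since S is symmetric, ∫fψ = ∫gφ (`integral_mul_symm`). As Re z^m and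
Im z^m are harmonic, this is the symmetry of the contracted tensors.

For the signs, put s = ∫Sφ·φ with φ of mean zero. Then −s is the limit of the Dirichlet energies of
smoothed potentials over the whole plane. So s ≤ 0, the energy in D is at most −s (`energy_le`), and
s = 0 forces φ = 0 (`ae_eq_zero`). If λφ = K*φ, then 0 ≤ (λ − 1/2)s ≤ −s, whence s = 0: λ is not an
eigenvalue. Since K* has a bounded kernel, it is compact on L², and the Fredholm alternative gives
the resolvent. The same inequalities fix the sign of ∫fφ when (λ − K*)φ = ∂f/∂ν. For λ > 1/2 this is
positivity of the energy of Sφ + f; for λ < −1/2 it is the comparison of the energy of Sφ in D with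
that in the plane.

No trace theorem or jump relation is proved beforehand. The kernel log|x| is replaced by log(|x|² +
e²)/2, whose potentials are smooth across the boundary, so Green's identity is classical. The
smoothed Laplacian is a radial approximate identity. At a boundary point the rescaled domain becomes
a half plane, which receives half of its mass: this is the 1/2. The limit e → 0 is dominated because
|⟨x−y, ν_x⟩| ≤ C|x−y|² on the boundary and |x−y|^(−1/2) is integrable there uniformly in x. -/

noncomputable section
namespace CGPT
open MeasureTheory Set Filter Topology Metric
open scoped ENNReal NNReal

/-! ### Hausdorff measure of `C¹` curves. -/

section Curve
variable {E : Type*} [NormedAddCommGroup E] [NormedSpace ℝ E]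

/-- A `C¹` curve is Lipschitz on an interval on which its speed is bounded, so the image has
controlled length. -/
theorem hausdorffMeasure_image_le_of_deriv_le [MeasurableSpace E] [BorelSpace E] {γ : ℝ → E} (hγ : Differentiable ℝ γ) {s A : Set ℝ}
    (hs : Convex ℝ s) {C : ℝ≥0} (hC : ∀ t ∈ s, ‖deriv γ t‖₊ ≤ C) (hA : A ⊆ s) :
    Measure.hausdorffMeasure 1 (γ '' A) ≤ C * volume A := by
  have h1 : LipschitzOnWith C γ s :=
    hs.lipschitzOnWith_of_nnnorm_deriv_le (fun t _ => hγ t) hC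
  have h2 := (h1.mono hA).hausdorffMeasure_image_le (d := 1) zero_le_one
  rwa [hausdorffMeasure_real, ENNReal.rpow_one] at h2

/-- The length of a connected arc is at least the length of its chord. -/
theorem ofReal_norm_sub_le_hausdorffMeasure {E : Type*} [NormedAddCommGroup E]
    [MeasurableSpace E] [BorelSpace E] {γ : ℝ → E} (hγ : Continuous γ) {a b : ℝ}
    (hab : a ≤ b) :
    ENNReal.ofReal ‖γ b - γ a‖ ≤ Measure.hausdorffMeasure 1 (γ '' Icc a b) := by
  have hl : LipschitzWith 1 (fun x : E => dist x (γ a)) := LipschitzWith.dist_left (γ a)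
  have h1 := hl.hausdorffMeasure_image_le (d := 1) zero_le_one (γ '' Icc a b)
  rw [hausdorffMeasure_real, ENNReal.coe_one, ENNReal.one_rpow, one_mul] at h1
  refine le_trans ?_ h1
  have h2 : Icc (0 : ℝ) ‖γ b - γ a‖ ⊆ (fun x : E => dist x (γ a)) '' (γ '' Icc a b) := by
    have h3 := intermediate_value_Icc hab
      (f := fun t => dist (γ t) (γ a)) (by fun_prop)
    rw [image_image]
    simpa [dist_eq_norm] using h3
  calc ENNReal.ofReal ‖γ b - γ a‖ = volume (Icc (0 : ℝ) ‖γ b - γ a‖) := by simp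
    _ ≤ _ := measure_mono h2

theorem exists_nnnorm_deriv_le {γ : ℝ → E} (hγ : ContDiff ℝ 1 γ) (a b : ℝ) :
    ∃ C : ℝ≥0, ∀ t ∈ Icc a b, ‖deriv γ t‖₊ ≤ C := by
  obtain ⟨C, hC⟩ := (isCompact_Icc (a := a) (b := b)).exists_bound_of_continuousOn
    (hγ.continuous_deriv le_rfl).continuousOn
  exact ⟨C.toNNReal, fun t ht => by
    rw [← NNReal.coe_le_coe]; exact (hC t ht).trans (Real.le_coe_toNNReal C)⟩

/-- **Arc length formula**: in the parameter of an injective `C¹` curve the one-dimensional Hausdorff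
measure is the speed times Lebesgue measure. -/
theorem comap_hausdorffMeasure_curve [MeasurableSpace E] [BorelSpace E] {γ : ℝ → E} (hγ : ContDiff ℝ 1 γ)
    (he : MeasurableEmbedding γ) :
    (Measure.hausdorffMeasure 1 : Measure E).comap γ =
      volume.withDensity (fun s => ENNReal.ofReal ‖deriv γ s‖) := by
  set m : Measure ℝ := (Measure.hausdorffMeasure 1 : Measure E).comap γ with hm
  have hd : Differentiable ℝ γ := hγ.differentiable one_ne_zero
  have hmA : ∀ A : Set ℝ, m A = Measure.hausdorffMeasure 1 (γ '' A) := fun A =>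
    he.comap_apply _ A
  have hfin : IsLocallyFiniteMeasure m := by
    refine ⟨fun x => ⟨Icc (x - 1) (x + 1), Icc_mem_nhds (by linarith) (by linarith), ?_⟩⟩
    obtain ⟨C, hC⟩ := exists_nnnorm_deriv_le hγ (x - 1) (x + 1)
    rw [hmA]
    refine (hausdorffMeasure_image_le_of_deriv_le hd (convex_Icc _ _) hC subset_rfl).trans_lt ?_
    exact ENNReal.mul_lt_top ENNReal.coe_lt_top (by simp)
  have hac : m ≪ volume := by
    intro A hA
    have hAU : A = ⋃ n : ℕ, A ∩ Icc (-(n : ℝ)) n := by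
      rw [← inter_iUnion, eq_comm, inter_eq_left]
      intro x _
      obtain ⟨n, hn⟩ := exists_nat_ge |x|
      exact mem_iUnion.2 ⟨n, abs_le.1 hn⟩
    rw [hAU]
    refine measure_iUnion_null fun n => ?_
    obtain ⟨C, hC⟩ := exists_nnnorm_deriv_le hγ (-(n : ℝ)) n
    rw [hmA, ← nonpos_iff_eq_zero]
    refine (hausdorffMeasure_image_le_of_deriv_le hd (convex_Icc _ _) hC inter_subset_right).trans ?_
    rw [measure_mono_null inter_subset_left hA, mul_zero]
  rw [← Measure.withDensity_rnDeriv_eq m volume hac]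
  refine withDensity_congr_ae ?_
  -- The density is the limit of m(B(s, r)) / 2r, so it suffices to find this limit at each s. The
  -- chord bounds it from below, the Lipschitz constant of the curve near s from above.
  filter_upwards [Besicovitch.ae_tendsto_rnDeriv m volume] with s hs
  refine tendsto_nhds_unique hs ?_
  have hvol : ∀ r : ℝ, volume (closedBall s r) = ENNReal.ofReal (2 * r) := fun r => by simp
  have hball : ∀ r : ℝ, closedBall s r = Icc (s - r) (s + r) := fun r => Real.closedBall_eq_Icc
  refine tendsto_order.2 ⟨fun a ha => ?_, fun a ha => ?_⟩
  · have hlim : Tendsto (fun r : ℝ => ENNReal.ofReal (‖γ (s + r) - γ (s - r)‖ / (2 * r))) (𝓝[>] 0)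
        (𝓝 (ENNReal.ofReal ‖deriv γ s‖)) := by
      refine (ENNReal.continuous_ofReal.tendsto _).comp ?_
      have h1 : HasDerivAt (fun r : ℝ => γ (s + r) - γ (s - r)) (deriv γ s + deriv γ s) 0 := by
        have e1 : HasDerivAt (fun r : ℝ => γ (s + r)) (deriv γ s) 0 := by
          have : HasDerivAt γ (deriv γ s) (s + 0) := by simpa using (hd s).hasDerivAt
          simpa using this.comp_const_add s 0
        have e2 : HasDerivAt (fun r : ℝ => γ (s - r)) (-deriv γ s) 0 := by
          have : HasDerivAt γ (deriv γ s) (s - 0) := by simpa using (hd s).hasDerivAt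
          simpa using this.comp_const_sub s 0
        have e3 := e1.sub e2
        rw [sub_neg_eq_add] at e3
        exact e3
      have h2 := (hasDerivAt_iff_tendsto_slope.1 h1).mono_left
        (nhdsWithin_mono (0 : ℝ) (fun t (ht : t ∈ Ioi (0 : ℝ)) => ne_of_gt ht))
      have h3 := (h2.const_smul (1 / 2 : ℝ)).norm
      have e : (1 / 2 : ℝ) • (deriv γ s + deriv γ s) = deriv γ s := by
        rw [← two_smul ℝ, smul_smul]; norm_num
      rw [e] at h3
      refine h3.congr' ?_
      filter_upwards [self_mem_nhdsWithin] with r (hr : 0 < r)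
      rw [slope_def_module, smul_smul, norm_smul]
      simp only [sub_zero, add_zero, sub_self, norm_mul, norm_inv, Real.norm_eq_abs,
        abs_of_pos hr]
      rw [abs_of_pos (by norm_num : (0 : ℝ) < 1 / 2)]
      field_simp
    filter_upwards [hlim.eventually (lt_mem_nhds ha), self_mem_nhdsWithin] with r h1 (hr : 0 < r)
    refine h1.trans_le ?_
    rw [hvol, ENNReal.ofReal_div_of_pos (by positivity)]
    refine ENNReal.div_le_div_right ?_ _
    rw [hmA, hball]
    exact ofReal_norm_sub_le_hausdorffMeasure hγ.continuous (by linarith)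
  · obtain ⟨c, hc1, hc2⟩ := ENNReal.lt_iff_exists_nnreal_btwn.1 ha
    have hcs : ‖deriv γ s‖ < c := by
      rw [← ENNReal.ofReal_coe_nnreal, ENNReal.ofReal_lt_ofReal_iff_of_nonneg (norm_nonneg _)] at hc1
      exact hc1
    have hev : ∀ᶠ t in 𝓝 s, ‖deriv γ t‖ < c :=
      ((hγ.continuous_deriv le_rfl).norm.tendsto s).eventually (gt_mem_nhds hcs)
    obtain ⟨δ, hδ, hball'⟩ := Metric.eventually_nhds_iff_ball.1 hev
    filter_upwards [Ioo_mem_nhdsGT hδ] with r hr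
    have hsub : closedBall s r ⊆ ball s δ := closedBall_subset_ball hr.2
    have h1 := hausdorffMeasure_image_le_of_deriv_le hd (convex_closedBall s r) (C := c)
      (fun t ht => by rw [← NNReal.coe_le_coe]; exact (hball' t (hsub ht)).le) subset_rfl
    rw [← hmA] at h1
    refine lt_of_le_of_lt ?_ hc2
    refine ENNReal.div_le_of_le_mul ?_
    exact h1
end Curve
end CGPT
end

/-! ### Straightening the boundary. -/

noncomputable section
namespace CGPT
open MeasureTheory Set Filter Topology Metric
open scoped ENNReal NNReal

theorem normal_eq_of_isOutwardUnitNormal {D : Set Plane} {x n : Plane}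
    (h : IsOutwardUnitNormal D x n) : normal D x = n := by
  have hex : ∃ n, IsOutwardUnitNormal D x n := ⟨n, h⟩
  rw [normal, dif_pos hex]
  exact hex.choose_spec.unique h

theorem inner_gradient (ρ : Plane → ℝ) (x v : Plane) :
    inner ℝ (gradient ρ x) v = fderiv ℝ ρ x v := by
  simp [gradient]

theorem norm_add_smul_of_orthonormal {E : Type*} [NormedAddCommGroup E] [InnerProductSpace ℝ E]
    {u w : E} (hu : ‖u‖ = 1) (hw : ‖w‖ = 1) (huw : inner ℝ u w = 0) (c : ℝ) :
    ‖u + c • w‖ = √(1 + c ^ 2) := by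
  have h := norm_add_sq_real u (c • w)
  rw [inner_smul_right, huw, hu, norm_smul, hw, Real.norm_eq_abs, mul_one, sq_abs] at h
  rw [← Real.sqrt_sq (norm_nonneg (u + c • w)), h]
  ring_nf

namespace IsLocalDefiningFunction
variable {D U : Set Plane} {ρ : Plane → ℝ} {x y : Plane}

theorem differentiableAt (h : IsLocalDefiningFunction D U ρ x) (hy : y ∈ U) :
    DifferentiableAt ℝ ρ y :=
  (h.contDiffOn.contDiffAt (h.isOpen.mem_nhds hy)).differentiableAt (by norm_num)

theorem mem_iff (h : IsLocalDefiningFunction D U ρ x) (hy : y ∈ U) : y ∈ D ↔ ρ y < 0 := by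
  have := Set.ext_iff.1 h.inter_eq y
  simp only [mem_inter_iff, mem_ofPred_eq] at this
  tauto

/-- A frontier point of an open set lies outside it, so ρ ≥ 0 there. A value ρ > 0 would persist
nearby and keep D away from a point of its closure. -/
theorem eq_zero_of_mem_frontier (h : IsLocalDefiningFunction D U ρ x) (hD : IsOpen D) (hy : y ∈ U)
    (hf : y ∈ frontier D) : ρ y = 0 := by
  have hyD : y ∉ D := fun hh => by
    rw [hD.frontier_eq] at hf; exact hf.2 hh
  refine le_antisymm ?_ (not_lt.1 fun hlt => hyD ((h.mem_iff hy).2 hlt))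
  by_contra hpos
  have hev : ∀ᶠ z in 𝓝 y, 0 < ρ z ∧ z ∈ U :=
    ((h.differentiableAt hy).continuousAt.eventually (lt_mem_nhds (not_le.1 hpos))).and
      (h.isOpen.mem_nhds hy)
  obtain ⟨z, hz3, hz1, hz2⟩ :=
    ((mem_closure_iff_frequently.1 (frontier_subset_closure hf)).and_eventually hev).exists
  exact absurd ((h.mem_iff hz2).1 hz3) (not_lt.2 hz1.le)

theorem of_mem (h : IsLocalDefiningFunction D U ρ x) (hy : y ∈ U) (h0 : ρ y = 0)
    (hg : gradient ρ y ≠ 0) : IsLocalDefiningFunction D U ρ y :=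
  ⟨h.isOpen, hy, h.contDiffOn, h0, hg, h.inter_eq⟩

/-- The points x − t∇ρ(x) with small t > 0 lie in D and tend to x. -/
theorem mem_frontier (h : IsLocalDefiningFunction D U ρ x) (hD : IsOpen D) : x ∈ frontier D := by
  rw [hD.frontier_eq]
  refine ⟨?_, fun hx => by have := (h.mem_iff h.mem).1 hx; rw [h.eq_zero] at this; exact this.false⟩
  have hneg : inner ℝ (gradient ρ x) (-gradient ρ x) < 0 := by
    rw [inner_neg_right, neg_lt_zero, real_inner_self_pos]
    exact h.gradient_ne_zero
  have hev := (h.eventually_mem _).1 hneg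
  have hlim : Tendsto (fun t : ℝ => x + t • (-gradient ρ x)) (𝓝[>] 0) (𝓝 x) := by
    have : Tendsto (fun t : ℝ => x + t • (-gradient ρ x)) (𝓝 0) (𝓝 (x + (0 : ℝ) • (-gradient ρ x))) :=
      Continuous.tendsto (by fun_prop) 0
    rw [zero_smul, add_zero] at this
    exact this.mono_left nhdsWithin_le_nhds
  exact mem_closure_of_tendsto hlim hev

theorem normal_eq (h : IsLocalDefiningFunction D U ρ x) :
    normal D x = ‖gradient ρ x‖⁻¹ • gradient ρ x :=
  normal_eq_of_isOutwardUnitNormal ⟨U, ρ, h, rfl⟩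

theorem continuousOn_gradient (h : IsLocalDefiningFunction D U ρ x) :
    ContinuousOn (gradient ρ) U := by
  have h1 : ContinuousOn (fderiv ℝ ρ) U :=
    h.contDiffOn.continuousOn_fderiv_of_isOpen h.isOpen (by norm_num)
  exact (InnerProductSpace.toDual ℝ Plane).symm.continuous.comp_continuousOn h1

end IsLocalDefiningFunction

/-- A chart of the plane around the boundary point `x`, in which the boundary is straightened: with
`τ, n` an orthonormal frame and `h` a `C¹` function, the map `(s, t) ↦ x + s τ + (t + h s) n` takes
`t < 0` to `D` and `t = 0` to the boundary. -/
structure BoundaryChart (D : Set Plane) (x : Plane) where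
  tangent : Plane
  conormal : Plane
  height : ℝ → ℝ
  size : ℝ
  norm_tangent : ‖tangent‖ = 1
  norm_conormal : ‖conormal‖ = 1
  inner_eq_zero : inner ℝ tangent conormal = 0
  height_zero : height 0 = 0
  contDiff_height : ContDiff ℝ 1 height
  size_pos : 0 < size
  mem_iff : ∀ s t : ℝ, |s| < size → |t| < size →
    (x + s • tangent + (t + height s) • conormal ∈ D ↔ t < 0)
  mem_frontier_iff : ∀ s t : ℝ, |s| < size → |t| < size →
    (x + s • tangent + (t + height s) • conormal ∈ frontier D ↔ t = 0)
  normal_eq : ∀ s : ℝ, |s| < size → normal D (x + s • tangent + (0 + height s) • conormal) =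
    (√(1 + deriv height s ^ 2))⁻¹ • (conormal - deriv height s • tangent)

theorem abs_lt_of_prod_ball {r s t : ℝ} (hs : |s| < r) (ht : |t| < r) :
    ((s, t) : ℝ × ℝ) ∈ ball (0 : ℝ × ℝ) r := by
  rw [mem_ball_zero_iff, Prod.norm_def]
  exact max_lt hs ht

/-- Every boundary point of a `C²` domain has a chart. -/
theorem IsLocalDefiningFunction.exists_boundaryChart {D U : Set Plane} {ρ : Plane → ℝ} {x : Plane}
    (h : IsLocalDefiningFunction D U ρ x) (hD : IsOpen D) : Nonempty (BoundaryChart D x) := by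
  set g := gradient ρ x with hg
  have hg0 : 0 < ‖g‖ := norm_pos_iff.2 h.gradient_ne_zero
  set n : Plane := ‖g‖⁻¹ • g with hn
  have hn1 : ‖n‖ = 1 := by
    rw [hn, norm_smul, norm_inv, norm_norm, inv_mul_cancel₀ hg0.ne']
  have hnsq : n 0 ^ 2 + n 1 ^ 2 = 1 := by
    have := EuclideanSpace.real_norm_sq_eq n
    rw [hn1, Fin.sum_univ_two] at this
    linarith
  set τ : Plane := !₂[-n 1, n 0] with hτ
  have hτ1 : ‖τ‖ = 1 := by
    have := EuclideanSpace.real_norm_sq_eq τ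
    rw [Fin.sum_univ_two] at this
    simp only [hτ, Matrix.cons_val_zero, Matrix.cons_val_one] at this
    rw [← hτ] at this
    have h2 : ‖τ‖ ^ 2 = 1 := by rw [this]; linarith
    exact (pow_eq_one_iff_of_nonneg (norm_nonneg _) two_ne_zero).1 h2
  have hτn : inner ℝ τ n = 0 := by
    simp only [hτ, PiLp.inner_apply, Fin.sum_univ_two, Matrix.cons_val_zero,
      Matrix.cons_val_one, RCLike.inner_apply, conj_trivial]
    ring
  have hexp : ∀ v : Plane, v = inner ℝ v τ • τ + inner ℝ v n • n := by
    intro v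
    ext i
    simp only [hτ, PiLp.inner_apply, Fin.sum_univ_two, Matrix.cons_val_zero,
      Matrix.cons_val_one, RCLike.inner_apply, conj_trivial, PiLp.add_apply, PiLp.smul_apply,
      smul_eq_mul]
    fin_cases i
    · simp only [Fin.zero_eta, Matrix.cons_val_zero]
      linear_combination (-(v 0)) * hnsq
    · simp only [Fin.mk_one, Matrix.cons_val_one, Matrix.cons_val_fin_one]
      linear_combination (-(v 1)) * hnsq
  set P : ℝ × ℝ → Plane := fun p => x + p.1 • τ + p.2 • n with hP
  have hPc : ContDiff ℝ 2 P := by rw [hP]; fun_prop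
  have hP0 : P 0 = x := by simp [hP]
  set f : ℝ × ℝ → ℝ := fun p => ρ (P p) with hf
  have hf0 : f 0 = 0 := by simp only [hf, hP0]; exact h.eq_zero
  have hfc : ContDiffAt ℝ 2 f 0 := by
    have : ContDiffAt ℝ 2 ρ (P 0) := by
      rw [hP0]; exact h.contDiffOn.contDiffAt (h.isOpen.mem_nhds h.mem)
    exact this.comp (0 : ℝ × ℝ) hPc.contDiffAt
  -- derivative of `f` in the second variable
  have hderiv2 : ∀ s t : ℝ, P (s, t) ∈ U →
      HasDerivAt (fun t => f (s, t)) (inner ℝ (gradient ρ (P (s, t))) n) t := by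
    intro s t hU
    rw [inner_gradient]
    have h1 : HasDerivAt (fun t : ℝ => P (s, t)) n t := by
      have := ((hasDerivAt_id t).smul_const n).const_add (x + s • τ)
      simpa [hP] using this
    exact (h.differentiableAt hU).hasFDerivAt.comp_hasDerivAt t h1
  -- The partial derivative in the normal direction is ‖∇ρ(x)‖ ≠ 0, so the implicit function theorem
  -- solves f(s, t) = 0 for t.
  have hinv : (fderiv ℝ f 0 ∘L .inr ℝ ℝ ℝ).IsInvertible := by
    have h1 : (fderiv ℝ f 0 ∘L .inr ℝ ℝ ℝ) (1 : ℝ) = ‖g‖ := by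
      have h2 := hderiv2 0 0 (by rw [show ((0 : ℝ), (0 : ℝ)) = 0 from rfl, hP0]; exact h.mem)
      rw [show ((0 : ℝ), (0 : ℝ)) = 0 from rfl, hP0] at h2
      have h3 : HasDerivAt (fun t : ℝ => ((0 : ℝ), t)) ((0 : ℝ), (1 : ℝ)) 0 :=
        (hasDerivAt_const (0 : ℝ) (0 : ℝ)).prodMk (hasDerivAt_id (0 : ℝ))
      have h4 : HasDerivAt (fun t : ℝ => f (0, t)) (fderiv ℝ f 0 (0, 1)) 0 :=
        (hfc.differentiableAt (by norm_num)).hasFDerivAt.comp_hasDerivAt (0 : ℝ) h3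
      have h5 := h4.unique h2
      rw [ContinuousLinearMap.comp_apply, ContinuousLinearMap.inr_apply, h5, hn, ← hg,
        inner_smul_right, real_inner_self_eq_norm_sq]
      field_simp
    refine ⟨ContinuousLinearEquiv.unitsEquivAut ℝ (Units.mk0 ‖g‖ hg0.ne'), ?_⟩
    ext
    simp [h1]
  have hn2 : (2 : WithTop ℕ∞) ≠ 0 := by norm_num
  set φ : ℝ → ℝ := hfc.implicitFunction hn2 hinv with hφ
  have hφ0 : φ 0 = 0 := hfc.implicitFunction_apply_self hn2 hinv
  have hφc : ContDiffAt ℝ 2 φ 0 := hfc.contDiffAt_implicitFunction hn2 hinv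
  have hφe : ∀ᶠ s in 𝓝 (0 : ℝ), f (s, φ s) = 0 := by
    have := hfc.eventually_apply_implicitFunction hn2 hinv
    rw [hf0] at this
    exact this
  -- the box
  have hbox : ∀ᶠ p in 𝓝 (0 : ℝ × ℝ), P p ∈ U ∧ 0 < inner ℝ (gradient ρ (P p)) n := by
    have h1 : ∀ᶠ y in 𝓝 x, y ∈ U ∧ 0 < inner ℝ (gradient ρ y) n := by
      refine (h.isOpen.eventually_mem h.mem).and ?_
      have h2 : ContinuousAt (fun y => inner ℝ (gradient ρ y) n) x :=
        ((h.continuousOn_gradient.continuousAt (h.isOpen.mem_nhds h.mem))).inner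
          continuousAt_const
      refine h2.eventually (lt_mem_nhds ?_)
      change 0 < inner ℝ g n
      rw [hn, inner_smul_right, real_inner_self_eq_norm_sq]
      positivity
    have h3 : Tendsto P (𝓝 0) (𝓝 x) := by
      have := hPc.continuous.tendsto 0
      rwa [hP0] at this
    exact h3.eventually h1
  obtain ⟨b, hb, hbb⟩ := Metric.eventually_nhds_iff_ball.1 hbox
  have hsm : ∀ᶠ s in 𝓝 (0 : ℝ), f (s, φ s) = 0 ∧ |φ s| < b / 2 ∧ ContDiffAt ℝ 2 φ s := by
    refine hφe.and (Filter.Eventually.and ?_ (hφc.eventually (by norm_num)))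
    refine hφc.continuousAt.abs.eventually (gt_mem_nhds ?_)
    change |φ 0| < b / 2
    rw [hφ0, abs_zero]; positivity
  obtain ⟨c, hc, hcc⟩ := Metric.eventually_nhds_iff_ball.1 hsm
  -- The implicit function is controlled only near 0, while a chart asks for a height that is `C¹`
  -- on the whole line. Hence the cutoff, equal to 1 for |s| < c/3.
  let χ : ContDiffBump (0 : ℝ) := ⟨c / 3, c / 2, by positivity, by linarith⟩
  set ht : ℝ → ℝ := fun s => χ s * φ s with hht
  have hχ1 : ∀ s, |s| < c / 3 → ht s = φ s := by
    intro s hs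
    have : χ s = 1 := χ.one_of_mem_closedBall (by
      rw [mem_closedBall_zero_iff]; exact hs.le)
    rw [hht]; simp [this]
  have hhc : ContDiff ℝ 1 ht := by
    rw [contDiff_iff_contDiffAt]
    intro s
    by_cases hs : |s| < c
    · exact χ.contDiffAt.mul ((hcc s (by rwa [mem_ball_zero_iff])).2.2.of_le (by norm_num))
    · have h1 : ∀ᶠ u in 𝓝 s, ht u = 0 := by
        have : ∀ᶠ u : ℝ in 𝓝 s, c / 2 < |u| :=
          continuous_abs.continuousAt.eventually (lt_mem_nhds (by linarith [not_lt.1 hs]))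
        filter_upwards [this] with u hu
        have : χ u = 0 := χ.zero_of_le_dist (by
          rw [Real.dist_eq, sub_zero]; exact hu.le)
        rw [hht]; simp [this]
      exact contDiffAt_const.congr_of_eventuallyEq h1
  -- The bound c/3 keeps s where the cutoff is 1. The bound b/2 keeps t + h(s) in (−b, b), because
  -- |h(s)| < b/2.
  set a := min (c / 3) (b / 2) with ha
  have ha0 : 0 < a := by positivity
  have hac : a ≤ c / 3 := min_le_left _ _
  have hab : a ≤ b / 2 := min_le_right _ _
  have hs1 : ∀ s, |s| < a → f (s, ht s) = 0 ∧ |ht s| < b / 2 := by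
    intro s hs
    have h1 := hcc s (by rw [mem_ball_zero_iff, Real.norm_eq_abs]; linarith)
    rw [hχ1 s (by linarith)]
    exact ⟨h1.1, h1.2.1⟩
  -- Strict growth along the normal direction makes h(s) the only zero on its line, so ρ has the
  -- sign of t.
  have hmono : ∀ s, |s| < a → StrictMonoOn (fun t => f (s, t)) (Ioo (-b) b) := by
    intro s hs
    have hin : ∀ t ∈ Ioo (-b) b, P (s, t) ∈ U ∧ 0 < inner ℝ (gradient ρ (P (s, t))) n :=
      fun t ht' => hbb _ (abs_lt_of_prod_ball (by linarith) (abs_lt.2 ht'))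
    refine strictMonoOn_of_deriv_pos (convex_Ioo _ _)
      (fun t ht' => (hderiv2 s t (hin t ht').1).continuousAt.continuousWithinAt) fun t ht' => ?_
    rw [interior_Ioo] at ht'
    rw [(hderiv2 s t (hin t ht').1).deriv]
    exact (hin t ht').2
  have hmemIoo : ∀ s t, |s| < a → |t| < a → t + ht s ∈ Ioo (-b) b := by
    intro s t hs ht'
    have h1 := (hs1 s hs).2
    rw [abs_lt] at h1 ht'
    constructor <;> linarith
  have hmem0 : ∀ s, |s| < a → ht s ∈ Ioo (-b) b := by
    intro s hs
    simpa using hmemIoo s 0 hs (by simpa using ha0)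
  have hPin : ∀ s t, |s| < a → t ∈ Ioo (-b) b →
      P (s, t) ∈ U ∧ 0 < inner ℝ (gradient ρ (P (s, t))) n := fun s t hs ht' =>
    hbb _ (abs_lt_of_prod_ball (by linarith) (abs_lt.2 ht'))
  have hloc : ∀ s, |s| < a → IsLocalDefiningFunction D U ρ (P (s, ht s)) := by
    intro s hs
    obtain ⟨h1, h2⟩ := hPin s _ hs (hmem0 s hs)
    refine h.of_mem h1 (hs1 s hs).1 fun h3 => ?_
    rw [h3, inner_zero_left] at h2
    exact h2.false
  refine ⟨⟨τ, n, ht, a, hτ1, hn1, hτn, ?_, hhc, ha0, ?_, ?_, ?_⟩⟩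
  · rw [hχ1 0 (by rw [abs_zero]; positivity), hφ0]
  · intro s t hs ht'
    have h1 := hmemIoo s t hs ht'
    have h2 := (hmono s hs).lt_iff_lt h1 (hmem0 s hs)
    simp only [(hs1 s hs).1] at h2
    rw [h.mem_iff (hPin s _ hs h1).1]
    change f (s, t + ht s) < 0 ↔ _
    rw [h2]
    constructor <;> intro h3 <;> linarith
  · intro s t hs ht'
    have h1 := hmemIoo s t hs ht'
    constructor
    · intro h2
      have h3 : f (s, t + ht s) = 0 := h.eq_zero_of_mem_frontier hD (hPin s _ hs h1).1 h2
      have h4 := (hmono s hs).injOn h1 (hmem0 s hs) (h3.trans (hs1 s hs).1.symm)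
      linarith
    · rintro rfl
      rw [zero_add]
      exact (hloc s hs).mem_frontier hD
  · intro s hs
    rw [zero_add]
    change normal D (P (s, ht s)) = _
    rw [(hloc s hs).normal_eq]
    obtain ⟨hU, hpos⟩ := hPin s _ hs (hmem0 s hs)
    set G := gradient ρ (P (s, ht s)) with hG
    set α := inner ℝ G n with hα
    -- Differentiating ρ = 0 along the graph gives ⟨∇ρ, τ + h'n⟩ = 0.
    have hGτ : inner ℝ G τ = -deriv ht s * α := by
      have h1 : HasDerivAt ht (deriv ht s) s := (hhc.differentiable one_ne_zero s).hasDerivAt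
      have h2 : HasDerivAt (fun u : ℝ => P (u, ht u)) (τ + deriv ht s • n) s := by
        have e1 := ((hasDerivAt_id s).smul_const τ).const_add x
        have e2 := e1.add (h1.smul_const n)
        simpa [hP] using! e2
      have h3 : HasDerivAt (fun u : ℝ => f (u, ht u)) (fderiv ℝ ρ (P (s, ht s)) (τ + deriv ht s • n)) s :=
        (h.differentiableAt hU).hasFDerivAt.comp_hasDerivAt s h2
      have h4 : HasDerivAt (fun u : ℝ => f (u, ht u)) 0 s := by
        refine (hasDerivAt_const s (0 : ℝ)).congr_of_eventuallyEq ?_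
        have : ∀ᶠ u : ℝ in 𝓝 s, |u| < a := continuous_abs.continuousAt.eventually (gt_mem_nhds hs)
        filter_upwards [this] with u hu using (hs1 u hu).1
      have h5 := h3.unique h4
      rw [← inner_gradient, inner_add_right, inner_smul_right] at h5
      linarith
    have hGe : G = α • (n - deriv ht s • τ) := by
      rw [hexp G, hGτ, smul_sub, smul_smul, ← hα]
      module
    have hnorm : ‖n - deriv ht s • τ‖ = √(1 + deriv ht s ^ 2) := by
      have h1 := norm_add_smul_of_orthonormal hn1 hτ1 ((real_inner_comm _ _).trans hτn) (-deriv ht s)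
      rwa [neg_smul, ← sub_eq_add_neg, neg_sq] at h1
    rw [hGe, norm_smul, hnorm, Real.norm_eq_abs, abs_of_pos hpos, smul_smul, mul_inv]
    congr 1
    field_simp

end CGPT
end

/-! ### Area and arc length in a chart. -/

noncomputable section
namespace CGPT
open MeasureTheory Set Filter Topology Metric
open scoped ENNReal NNReal

namespace BoundaryChart
variable {D : Set Plane} {x : Plane} (c : BoundaryChart D x)

/-- The chart map `(s, t) ↦ x + s τ + (t + h s) n`. -/
def map (p : ℝ × ℝ) : Plane := x + p.1 • c.tangent + (p.2 + c.height p.1) • c.conormal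

/-- The coordinates of a point of the plane. -/
def coord (y : Plane) : ℝ × ℝ :=
  (inner ℝ c.tangent (y - x), inner ℝ c.conormal (y - x) - c.height (inner ℝ c.tangent (y - x)))

/-- The orthonormal basis `τ, n`. -/
theorem orthonormal : Orthonormal ℝ ![c.tangent, c.conormal] := by
  rw [orthonormal_iff_ite]
  intro i j
  fin_cases i <;> fin_cases j <;>
    simp [c.norm_tangent, c.norm_conormal, c.inner_eq_zero,
      real_inner_comm c.tangent c.conormal]

def basis : OrthonormalBasis (Fin 2) ℝ Plane :=
  (basisOfOrthonormalOfCardEqFinrank c.orthonormal (by simp)).toOrthonormalBasis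
    (by rw [coe_basisOfOrthonormalOfCardEqFinrank]; exact c.orthonormal)

theorem coe_basis : (c.basis : Fin 2 → Plane) = ![c.tangent, c.conormal] := by
  simp [basis]

theorem eq_inner_add_inner (v : Plane) :
    v = inner ℝ c.tangent v • c.tangent + inner ℝ c.conormal v • c.conormal := by
  have := c.basis.sum_repr' v
  rw [Fin.sum_univ_two, c.coe_basis] at this
  simpa using this.symm

theorem inner_tangent (s t : ℝ) :
    inner ℝ c.tangent (s • c.tangent + t • c.conormal) = s := by
  rw [inner_add_right, inner_smul_right, inner_smul_right, real_inner_self_eq_norm_sq,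
    c.norm_tangent, c.inner_eq_zero]
  simp

theorem inner_conormal (s t : ℝ) :
    inner ℝ c.conormal (s • c.tangent + t • c.conormal) = t := by
  rw [inner_add_right, inner_smul_right, inner_smul_right, real_inner_self_eq_norm_sq,
    c.norm_conormal, real_inner_comm, c.inner_eq_zero]
  simp

theorem map_sub (p : ℝ × ℝ) :
    c.map p - x = p.1 • c.tangent + (p.2 + c.height p.1) • c.conormal := by
  rw [map]; abel

theorem coord_map (p : ℝ × ℝ) : c.coord (c.map p) = p := by
  rw [coord, c.map_sub, c.inner_tangent, c.inner_conormal]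
  simp

theorem map_coord (y : Plane) : c.map (c.coord y) = y := by
  have := c.eq_inner_add_inner (y - x)
  simp only [map, coord, sub_add_cancel]
  rw [add_assoc, ← this]
  abel

theorem contDiff_map : ContDiff ℝ 1 c.map := by
  have := c.contDiff_height
  unfold map
  fun_prop

theorem continuous_coord : Continuous c.coord := by
  have := c.contDiff_height.continuous
  unfold coord
  fun_prop

/-- The chart map as a homeomorphism. -/
def homeomorph : ℝ × ℝ ≃ₜ Plane where
  toFun := c.map
  invFun := c.coord
  left_inv := c.coord_map
  right_inv := c.map_coord
  continuous_toFun := c.contDiff_map.continuous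
  continuous_invFun := c.continuous_coord

/-- A shear (s, t) ↦ (s, t + h(s)) followed by an affine isometry: no Jacobian appears. -/
theorem measurePreserving_map : MeasurePreserving c.map := by
  have h1 : MeasurePreserving (fun p : ℝ × ℝ => (p.1, p.2 + c.height p.1)) := by
    refine MeasurePreserving.skew_product (MeasurePreserving.id (volume : Measure ℝ))
      (g := fun s t => t + c.height s) ?_ ?_
    · have := c.contDiff_height.continuous.measurable
      exact Measurable.add measurable_snd (this.comp measurable_fst)
    · exact Filter.Eventually.of_forall fun s => map_add_right_eq_self volume _
  have h2 : MeasurePreserving (fun p : ℝ × ℝ => x + (p.1 • c.tangent + p.2 • c.conormal)) := by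
    have e1 := (volume_preserving_finTwoArrow ℝ).symm
    have e2 := PiLp.volume_preserving_toLp (Fin 2)
    have e3 := c.basis.measurePreserving_repr_symm
    have e4 := measurePreserving_add_left (volume : Measure Plane) x
    have heq : (fun p : ℝ × ℝ => x + (p.1 • c.tangent + p.2 • c.conormal)) =
        (fun y => x + y) ∘ c.basis.repr.symm ∘ WithLp.toLp 2 ∘
          (MeasurableEquiv.finTwoArrow (α := ℝ)).symm := by
      ext1 p
      simp only [Function.comp_apply]
      rw [← c.basis.sum_repr_symm, Fin.sum_univ_two, c.coe_basis]
      simp [MeasurableEquiv.finTwoArrow]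
    rw [heq]
    exact e4.comp (e3.comp (e2.comp e1))
  have := h2.comp h1
  convert this using 1
  ext1 p
  simp only [map, Function.comp_apply, add_assoc]

/-- The neighbourhood of `x` covered by the chart. -/
def nhd : Set Plane := c.map '' ball 0 c.size

theorem isOpen_nhd : IsOpen c.nhd := c.homeomorph.isOpenMap _ isOpen_ball

theorem mem_nhd : x ∈ c.nhd :=
  ⟨0, mem_ball_self c.size_pos, by simp [map, c.height_zero]⟩

theorem map_mem_nhd {p : ℝ × ℝ} : c.map p ∈ c.nhd ↔ p ∈ ball 0 c.size :=
  c.homeomorph.injective.mem_set_image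

theorem mem_ball_iff {p : ℝ × ℝ} : p ∈ ball (0 : ℝ × ℝ) c.size ↔ |p.1| < c.size ∧ |p.2| < c.size := by
  rw [mem_ball_zero_iff, Prod.norm_def, max_lt_iff, Real.norm_eq_abs, Real.norm_eq_abs]

theorem map_mem_iff {p : ℝ × ℝ} (hp : p ∈ ball 0 c.size) : c.map p ∈ D ↔ p.2 < 0 :=
  c.mem_iff _ _ (c.mem_ball_iff.1 hp).1 (c.mem_ball_iff.1 hp).2

theorem map_mem_frontier_iff {p : ℝ × ℝ} (hp : p ∈ ball 0 c.size) :
    c.map p ∈ frontier D ↔ p.2 = 0 :=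
  c.mem_frontier_iff _ _ (c.mem_ball_iff.1 hp).1 (c.mem_ball_iff.1 hp).2

/-- The boundary curve of the chart. -/
def curve (s : ℝ) : Plane := c.map (s, 0)

theorem contDiff_curve : ContDiff ℝ 1 c.curve :=
  c.contDiff_map.comp (contDiff_id.prodMk contDiff_const)

theorem hasDerivAt_curve (s : ℝ) :
    HasDerivAt c.curve (c.tangent + deriv c.height s • c.conormal) s := by
  have h1 : HasDerivAt c.height (deriv c.height s) s :=
    (c.contDiff_height.differentiable one_ne_zero s).hasDerivAt
  have e1 := ((hasDerivAt_id s).smul_const c.tangent).const_add x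
  have e2 := e1.add ((h1.const_add 0).smul_const c.conormal)
  rw [one_smul] at e2
  exact e2

theorem norm_deriv_curve (s : ℝ) : ‖deriv c.curve s‖ = √(1 + deriv c.height s ^ 2) := by
  rw [(c.hasDerivAt_curve s).deriv]
  exact norm_add_smul_of_orthonormal c.norm_tangent c.norm_conormal c.inner_eq_zero _

theorem continuous_speed : Continuous fun s => √(1 + deriv c.height s ^ 2) := by
  have := c.contDiff_height.continuous_deriv le_rfl
  fun_prop

theorem measurableEmbedding_curve : MeasurableEmbedding c.curve := by
  have h : IsClosedEmbedding fun s : ℝ => ((s, 0) : ℝ × ℝ) :=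
    Function.LeftInverse.isClosedEmbedding (f := Prod.fst) (fun _ => rfl) continuous_fst
      (by fun_prop)
  exact (c.homeomorph.isClosedEmbedding.comp h).measurableEmbedding

theorem frontier_inter_nhd : frontier D ∩ c.nhd = c.curve '' ball 0 c.size := by
  ext y
  constructor
  · rintro ⟨hy, p, hp, rfl⟩
    have := (c.map_mem_frontier_iff hp).1 hy
    refine ⟨p.1, ?_, ?_⟩
    · rw [mem_ball_zero_iff]; exact (c.mem_ball_iff.1 hp).1
    · rw [curve, ← this]
  · rintro ⟨s, hs, rfl⟩
    have hb : ((s, 0) : ℝ × ℝ) ∈ ball (0 : ℝ × ℝ) c.size :=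
      c.mem_ball_iff.2 ⟨by simpa using hs, by simpa using c.size_pos⟩
    exact ⟨(c.map_mem_frontier_iff hb).2 rfl, c.map_mem_nhd.2 hb⟩

/-- Arc length on the boundary in a chart. -/
theorem arcLength_restrict_nhd : (arcLength D).restrict c.nhd =
    ((volume.withDensity fun s => ENNReal.ofReal √(1 + deriv c.height s ^ 2)).restrict
      (ball 0 c.size)).map c.curve := by
  have he := c.measurableEmbedding_curve
  rw [arcLength, Measure.restrict_restrict c.isOpen_nhd.measurableSet, inter_comm,
    c.frontier_inter_nhd]
  simp_rw [← c.norm_deriv_curve]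
  rw [← comap_hausdorffMeasure_curve c.contDiff_curve he]
  have h1 : ball (0 : ℝ) c.size = c.curve ⁻¹' (c.curve '' ball 0 c.size) :=
    (preimage_image_eq _ he.injective).symm
  conv_rhs => rw [h1]
  rw [← he.restrict_map, he.map_comap, Measure.restrict_restrict
    (he.measurableSet_image.2 measurableSet_ball), inter_eq_left.2 (image_subset_range _ _)]

/-- F may be nonmeasurable: the curve is a measurable embedding and the density is finite. -/
theorem lintegral_nhd (F : Plane → ℝ≥0∞) : ∫⁻ y in c.nhd, F y ∂(arcLength D) =
    ∫⁻ s in ball 0 c.size, ENNReal.ofReal √(1 + deriv c.height s ^ 2) * F (c.curve s) := by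
  have hm : Measurable fun s => ENNReal.ofReal √(1 + deriv c.height s ^ 2) :=
    c.continuous_speed.measurable.ennreal_ofReal
  rw [c.arcLength_restrict_nhd, c.measurableEmbedding_curve.lintegral_map,
    restrict_withDensity measurableSet_ball,
    lintegral_withDensity_eq_lintegral_mul_non_measurable _ hm
      (Filter.Eventually.of_forall fun _ => ENNReal.ofReal_lt_top)]
  rfl

theorem integral_nhd (F : Plane → ℝ) : ∫ y in c.nhd, F y ∂(arcLength D) =
    ∫ s in ball 0 c.size, √(1 + deriv c.height s ^ 2) * F (c.curve s) := by
  have hm : Measurable fun s => ENNReal.ofReal √(1 + deriv c.height s ^ 2) :=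
    c.continuous_speed.measurable.ennreal_ofReal
  rw [c.arcLength_restrict_nhd, c.measurableEmbedding_curve.integral_map,
    restrict_withDensity measurableSet_ball,
    integral_withDensity_eq_integral_toReal_smul hm
      (Filter.Eventually.of_forall fun _ => ENNReal.ofReal_lt_top)]
  refine integral_congr_ae (Filter.Eventually.of_forall fun s => ?_)
  simp only [smul_eq_mul]
  rw [ENNReal.toReal_ofReal (Real.sqrt_nonneg _)]

end BoundaryChart
end CGPT
end

/-! ### The divergence theorem in a half plane and in a chart. -/

noncomputable section
namespace CGPT
open MeasureTheory Set Filter Topology Metric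
open scoped ENNReal NNReal

/-- In the half plane `t < 0`, the integral of the `t`-derivative of a compactly supported function
against a weight in `s` only sees the boundary `t = 0`. -/
theorem integral_halfPlane_fderiv_snd {f : ℝ × ℝ → ℝ} (hf : ContDiff ℝ 1 f)
    (hc : HasCompactSupport f) {w : ℝ → ℝ} (hw : Continuous w) :
    ∫ p in {p : ℝ × ℝ | p.2 < 0}, w p.1 * fderiv ℝ f p (0, 1) = ∫ s, w s * f (s, 0) := by
  have hset : {p : ℝ × ℝ | p.2 < 0} = univ ×ˢ Iio (0 : ℝ) := by ext; simp
  have hcont : Continuous fun p : ℝ × ℝ => w p.1 * fderiv ℝ f p (0, 1) := by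
    have := hf.continuous_fderiv one_ne_zero
    fun_prop
  have hcs : HasCompactSupport fun p : ℝ × ℝ => w p.1 * fderiv ℝ f p (0, 1) :=
    (hc.fderiv_apply ℝ (0, 1)).mul_left
  have hint := hcont.integrable_of_hasCompactSupport hcs (μ := volume)
  rw [hset, Measure.volume_eq_prod, setIntegral_prod _ hint.integrableOn, Measure.restrict_univ]
  refine integral_congr_ae (Filter.Eventually.of_forall fun s => ?_)
  simp only
  rw [integral_const_mul, ← integral_Iic_eq_integral_Iio]
  congr 1
  have hd : ∀ t : ℝ, fderiv ℝ f (s, t) (0, 1) = deriv (fun t => f (s, t)) t := by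
    intro t
    have h3 : HasDerivAt (fun t : ℝ => (s, t)) ((0 : ℝ), (1 : ℝ)) t :=
      (hasDerivAt_const t s).prodMk (hasDerivAt_id t)
    exact (((hf.differentiable one_ne_zero (s, t)).hasFDerivAt.comp_hasDerivAt t h3).deriv).symm
  simp_rw [hd]
  have he : IsClosedEmbedding fun t : ℝ => (s, t) :=
    Function.LeftInverse.isClosedEmbedding (f := Prod.snd) (fun _ => rfl) continuous_snd
      (by fun_prop)
  exact HasCompactSupport.integral_Iic_deriv_eq (hf.comp (contDiff_const.prodMk contDiff_id))
    (hc.comp_isClosedEmbedding he) 0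

/-- In the half plane `t < 0`, the `s`-derivative of a compactly supported function has integral
zero. -/
theorem integral_halfPlane_fderiv_fst {f : ℝ × ℝ → ℝ} (hf : ContDiff ℝ 1 f)
    (hc : HasCompactSupport f) :
    ∫ p in {p : ℝ × ℝ | p.2 < 0}, fderiv ℝ f p (1, 0) = 0 := by
  have hset : {p : ℝ × ℝ | p.2 < 0} = univ ×ˢ Iio (0 : ℝ) := by ext; simp
  have hcont : Continuous fun p : ℝ × ℝ => fderiv ℝ f p (1, 0) := by
    have := hf.continuous_fderiv one_ne_zero
    fun_prop
  have hcs : HasCompactSupport fun p : ℝ × ℝ => fderiv ℝ f p (1, 0) := hc.fderiv_apply ℝ (1, 0)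
  have hint := hcont.integrable_of_hasCompactSupport hcs (μ := volume)
  have hint' : Integrable (fun p : ℝ × ℝ => fderiv ℝ f p (1, 0))
      ((volume.restrict univ).prod (volume.restrict (Iio 0))) := by
    rw [Measure.prod_restrict, ← hset, ← Measure.volume_eq_prod]
    exact hint.integrableOn
  rw [hset, Measure.volume_eq_prod, ← Measure.prod_restrict, integral_prod_symm _ hint',
    Measure.restrict_univ]
  refine (integral_congr_ae (Filter.Eventually.of_forall fun t => ?_)).trans
    (integral_zero ℝ ℝ)
  have hd : ∀ s : ℝ, HasDerivAt (fun s => f (s, t)) (fderiv ℝ f (s, t) (1, 0)) s := by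
    intro s
    have h3 : HasDerivAt (fun s : ℝ => (s, t)) ((1 : ℝ), (0 : ℝ)) s :=
      (hasDerivAt_id s).prodMk (hasDerivAt_const s t)
    exact (hf.differentiable one_ne_zero (s, t)).hasFDerivAt.comp_hasDerivAt s h3
  have he : IsClosedEmbedding fun s : ℝ => (s, t) :=
    Function.LeftInverse.isClosedEmbedding (f := Prod.fst) (fun _ => rfl) continuous_fst
      (by fun_prop)
  refine integral_eq_zero_of_hasDerivAt_of_integrable hd ?_ ?_
  · exact (hcont.comp he.continuous).integrable_of_hasCompactSupport (hcs.comp_isClosedEmbedding he)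
  · exact (hf.continuous.comp he.continuous).integrable_of_hasCompactSupport
      (hc.comp_isClosedEmbedding he)

namespace BoundaryChart
variable {D : Set Plane} {x : Plane} (c : BoundaryChart D x)

theorem hasFDerivAt_map (p : ℝ × ℝ) :
    fderiv ℝ c.map p (1, 0) = c.tangent + deriv c.height p.1 • c.conormal ∧
      fderiv ℝ c.map p (0, 1) = c.conormal := by
  have hd := (c.contDiff_map.differentiable one_ne_zero p).hasFDerivAt
  have hh : HasDerivAt c.height (deriv c.height p.1) p.1 :=
    (c.contDiff_height.differentiable one_ne_zero p.1).hasDerivAt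
  constructor
  · have h1 : HasDerivAt (fun s : ℝ => (s, p.2)) ((1 : ℝ), (0 : ℝ)) p.1 :=
      (hasDerivAt_id p.1).prodMk (hasDerivAt_const p.1 p.2)
    have h2 := HasFDerivAt.comp_hasDerivAt p.1 (f := fun s : ℝ => (s, p.2)) hd h1
    refine h2.unique ?_
    have e1 := ((hasDerivAt_id p.1).smul_const c.tangent).const_add x
    have e2 := e1.add ((hh.const_add p.2).smul_const c.conormal)
    rw [one_smul] at e2
    exact e2
  · have h1 : HasDerivAt (fun t : ℝ => (p.1, t)) ((0 : ℝ), (1 : ℝ)) p.2 :=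
      (hasDerivAt_const p.2 p.1).prodMk (hasDerivAt_id p.2)
    have h2 := HasFDerivAt.comp_hasDerivAt p.2 (f := fun t : ℝ => (p.1, t)) hd h1
    refine h2.unique ?_
    have e1 := (((hasDerivAt_id p.2).add_const (c.height p.1)).smul_const c.conormal).const_add
      (x + p.1 • c.tangent)
    rw [one_smul] at e1
    exact e1

/-- The divergence theorem in a chart. -/
theorem integral_fderiv_eq (hD : MeasurableSet D) {f : Plane → ℝ} (hf : ContDiff ℝ 1 f)
    (hc : HasCompactSupport f) (hs' : tsupport f ⊆ c.nhd) (v : Plane) :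
    ∫ y in D, fderiv ℝ f y v = ∫ y, f y * inner ℝ (normal D y) v ∂(arcLength D) := by
  set a := inner ℝ c.tangent v with ha
  set b := inner ℝ c.conormal v with hb
  have hv := c.eq_inner_add_inner v
  rw [← ha, ← hb] at hv
  have hhc : Continuous (deriv c.height) := c.contDiff_height.continuous_deriv le_rfl
  set F : ℝ × ℝ → ℝ := fun p => f (c.map p) with hF
  have hFc : ContDiff ℝ 1 F := hf.comp c.contDiff_map
  have hFs : HasCompactSupport F := hc.comp_homeomorph c.homeomorph
  have hfd : ∀ p w, fderiv ℝ F p w = fderiv ℝ f (c.map p) (fderiv ℝ c.map p w) := by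
    intro p w
    rw [hF, show (fun p => f (c.map p)) = f ∘ c.map from rfl,
      fderiv_comp p (hf.differentiable one_ne_zero _) (c.contDiff_map.differentiable one_ne_zero p)]
    rfl
  -- In chart coordinates the constant field v = aτ + bn is a ∂_s + (b − a h'(s)) ∂_t. Only the
  -- t-component leaves a boundary term, and its coefficient depends on s alone, so h need not be
  -- twice differentiable.
  have hdir : ∀ p, fderiv ℝ f (c.map p) v =
      a * fderiv ℝ F p (1, 0) + (b - a * deriv c.height p.1) * fderiv ℝ F p (0, 1) := by
    intro p
    rw [hfd, hfd, (c.hasFDerivAt_map p).1, (c.hasFDerivAt_map p).2]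
    conv_lhs => rw [hv]
    simp only [map_add, map_smul, smul_eq_mul]
    ring
  have hint1 : Integrable fun p : ℝ × ℝ => a * fderiv ℝ F p (1, 0) := by
    refine Continuous.integrable_of_hasCompactSupport ?_ (hFs.fderiv_apply ℝ (1, 0)).mul_left
    have := hFc.continuous_fderiv one_ne_zero
    fun_prop
  have hint2 : Integrable fun p : ℝ × ℝ =>
      (b - a * deriv c.height p.1) * fderiv ℝ F p (0, 1) := by
    refine Continuous.integrable_of_hasCompactSupport ?_ (hFs.fderiv_apply ℝ (0, 1)).mul_left
    have := hFc.continuous_fderiv one_ne_zero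
    fun_prop
  have hlhs : ∫ y in D, fderiv ℝ f y v = ∫ s, (b - a * deriv c.height s) * F (s, 0) := by
    have hset : MeasurableSet {p : ℝ × ℝ | p.2 < 0} := measurableSet_lt measurable_snd measurable_const
    rw [← integral_indicator hD, ← c.measurePreserving_map.integral_comp
      c.homeomorph.measurableEmbedding]
    have heq : (fun p => D.indicator (fun y => fderiv ℝ f y v) (c.map p)) =
        {p : ℝ × ℝ | p.2 < 0}.indicator (fun p => a * fderiv ℝ F p (1, 0) +
          (b - a * deriv c.height p.1) * fderiv ℝ F p (0, 1)) := by
      ext p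
      by_cases hp : p ∈ ball (0 : ℝ × ℝ) c.size
      · by_cases h2 : p.2 < 0
        · rw [indicator_of_mem ((c.map_mem_iff hp).2 h2), indicator_of_mem (by exact h2), hdir]
        · rw [indicator_of_notMem (fun h => h2 ((c.map_mem_iff hp).1 h)),
            indicator_of_notMem (by exact h2)]
      -- Outside the box the chart says nothing about D, but there f vanishes together with its
      -- derivative.
      · have h0 : fderiv ℝ f (c.map p) = 0 := by
          by_contra h0
          exact hp (c.map_mem_nhd.1 (hs' (support_fderiv_subset ℝ h0)))
        have h1 := hdir p
        rw [h0] at h1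
        simp only [indicator, h0, ← h1]
        simp
    rw [heq, integral_indicator hset, integral_add hint1.integrableOn hint2.integrableOn,
      integral_const_mul, integral_halfPlane_fderiv_fst hFc hFs, mul_zero, zero_add]
    exact integral_halfPlane_fderiv_snd hFc hFs (w := fun s => b - a * deriv c.height s)
      (by fun_prop)
  rw [hlhs]
  have hz : ∀ y, y ∉ c.nhd → f y * inner ℝ (normal D y) v = 0 := by
    intro y hy
    rw [image_eq_zero_of_notMem_tsupport (fun h => hy (hs' h)), zero_mul]
  rw [← setIntegral_eq_integral_of_forall_compl_eq_zero hz, c.integral_nhd,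
    ← setIntegral_eq_integral_of_forall_compl_eq_zero (s := ball 0 c.size)]
  · refine setIntegral_congr_fun measurableSet_ball fun s hs => ?_
    have hsa : |s| < c.size := by simpa using hs
    -- The speed of the curve cancels the normalization of the normal, leaving b − a h'(s).
    have hn : normal D (c.curve s) = _ := c.normal_eq s hsa
    rw [hn, inner_smul_left, inner_sub_left, inner_smul_left, ← ha, ← hb]
    have hpos : 0 < √(1 + deriv c.height s ^ 2) := by positivity
    simp only [hF, curve, conj_trivial]
    field_simp
  · intro s hs
    have : f (c.map (s, 0)) = 0 := by
      refine image_eq_zero_of_notMem_tsupport fun h => hs ?_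
      have := (c.mem_ball_iff.1 (c.map_mem_nhd.1 (hs' h))).1
      simpa using this
    simp [hF, this]

end BoundaryChart
end CGPT
end

/-! ### Tangency of chords and integrable singularities on the boundary. -/

noncomputable section
namespace CGPT
open MeasureTheory Set Filter Topology Metric
open scoped ENNReal NNReal

namespace IsBoundedC2Domain
variable {D : Set Plane}

theorem nonempty_boundaryChart (hD : IsBoundedC2Domain D) {x : Plane} (hx : x ∈ frontier D) :
    Nonempty (BoundaryChart D x) := by
  obtain ⟨U, ρ, h⟩ := hD.boundary x hx
  exact h.exists_boundaryChart hD.isOpen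

theorem isCompact_closure (hD : IsBoundedC2Domain D) : IsCompact (closure D) :=
  hD.isBounded.isCompact_closure

theorem isCompact_frontier (hD : IsBoundedC2Domain D) : IsCompact (frontier D) :=
  hD.isCompact_closure.of_isClosed_subset isClosed_frontier frontier_subset_closure

/-- A single ρ serves all boundary points near x; continuity of the normal and locally uniform
constants rest on this. -/
theorem exists_localDefiningFunction_near (hD : IsBoundedC2Domain D) {x : Plane}
    (hx : x ∈ frontier D) : ∃ U ρ, IsLocalDefiningFunction D U ρ x ∧
      ∀ᶠ y in 𝓝 x, y ∈ frontier D → IsLocalDefiningFunction D U ρ y := by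
  obtain ⟨U, ρ, h⟩ := hD.boundary x hx
  refine ⟨U, ρ, h, ?_⟩
  have hU := h.isOpen.mem_nhds h.mem
  have h1 : ∀ᶠ y in 𝓝 x, gradient ρ y ≠ 0 :=
    (h.continuousOn_gradient.continuousAt hU).eventually_ne h.gradient_ne_zero
  filter_upwards [h1, hU] with y h2 h3 h4
  exact h.of_mem h3 (h.eq_zero_of_mem_frontier hD.isOpen h3 h4) h2

theorem norm_normal (hD : IsBoundedC2Domain D) {x : Plane} (hx : x ∈ frontier D) :
    ‖normal D x‖ = 1 := by
  obtain ⟨U, ρ, h⟩ := hD.boundary x hx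
  rw [h.normal_eq, norm_smul, norm_inv, norm_norm,
    inv_mul_cancel₀ (norm_ne_zero_iff.2 h.gradient_ne_zero)]

theorem continuousOn_normal (hD : IsBoundedC2Domain D) : ContinuousOn (normal D) (frontier D) := by
  intro x hx
  obtain ⟨U, ρ, h, hev⟩ := hD.exists_localDefiningFunction_near hx
  have hg : ContinuousAt (gradient ρ) x :=
    h.continuousOn_gradient.continuousAt (h.isOpen.mem_nhds h.mem)
  have h1 : ContinuousAt (fun y => ‖gradient ρ y‖⁻¹ • gradient ρ y) x :=
    (hg.norm.inv₀ (norm_ne_zero_iff.2 h.gradient_ne_zero)).smul hg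
  refine h1.continuousWithinAt.congr_of_eventuallyEq ?_ h.normal_eq
  filter_upwards [nhdsWithin_le_nhds hev, self_mem_nhdsWithin] with y h2 h3
  exact (h2 h3).normal_eq

/-- On a `C²` boundary, chords are tangent to second order. -/
theorem exists_abs_inner_normal_le (hD : IsBoundedC2Domain D) : ∃ C : ℝ, 0 ≤ C ∧
    ∀ z ∈ frontier D, ∀ w ∈ frontier D, |inner ℝ (w - z) (normal D w)| ≤ C * ‖w - z‖ ^ 2 := by
  have key : ∃ C : ℝ, 0 ≤ C ∧ ∀ p ∈ frontier D ×ˢ frontier D,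
      p.1 ∈ frontier D → p.2 ∈ frontier D →
        |inner ℝ (p.2 - p.1) (normal D p.2)| ≤ C * ‖p.2 - p.1‖ ^ 2 := by
    refine (hD.isCompact_frontier.prod hD.isCompact_frontier).induction_on
      (p := fun s => ∃ C : ℝ, 0 ≤ C ∧ ∀ p ∈ s, p.1 ∈ frontier D → p.2 ∈ frontier D →
        |inner ℝ (p.2 - p.1) (normal D p.2)| ≤ C * ‖p.2 - p.1‖ ^ 2) ?_ ?_ ?_ ?_
    · exact ⟨0, le_rfl, fun p hp => absurd hp (notMem_empty p)⟩
    · rintro s t hst ⟨C, h0, hC⟩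
      exact ⟨C, h0, fun p hp => hC p (hst hp)⟩
    · rintro s t ⟨C, h0, hC⟩ ⟨C', h0', hC'⟩
      refine ⟨C + C', by positivity, fun p hp h1 h2 => ?_⟩
      have hsq := sq_nonneg ‖p.2 - p.1‖
      rcases hp with hp | hp
      · have := hC p hp h1 h2
        nlinarith
      · have := hC' p hp h1 h2
        nlinarith
    · rintro ⟨z₀, w₀⟩ ⟨hz₀, hw₀⟩
      by_cases hne : z₀ = w₀
      · subst hne
        obtain ⟨U, ρ, h, hev⟩ := hD.exists_localDefiningFunction_near hz₀
        have hU := h.isOpen.mem_nhds h.mem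
        -- Near the diagonal: since ρ is `C²`, its derivative is Lipschitz, and ρ vanishes at both
        -- ends of the chord. Taylor's formula then bounds the derivative of ρ at w along z − w by
        -- K‖w − z‖².
        have hc1 : ContDiffAt ℝ 1 (fderiv ℝ ρ) z₀ :=
          (h.contDiffOn.contDiffAt hU).fderiv_right (m := 1) (by norm_num)
        obtain ⟨K, t, ht, hK⟩ := hc1.exists_lipschitzOnWith
        have hg : ContinuousAt (fun y => ‖gradient ρ y‖) z₀ :=
          (h.continuousOn_gradient.continuousAt hU).norm
        have hg0 : 0 < ‖gradient ρ z₀‖ := norm_pos_iff.2 h.gradient_ne_zero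
        have hall : ∀ᶠ y in 𝓝 z₀, (y ∈ frontier D → IsLocalDefiningFunction D U ρ y) ∧ y ∈ t ∧
            y ∈ U ∧ ‖gradient ρ z₀‖ / 2 < ‖gradient ρ y‖ :=
          hev.and ((eventually_mem_set.2 ht).and ((eventually_mem_set.2 hU).and
            (hg.eventually (lt_mem_nhds (half_lt_self hg0)))))
        obtain ⟨r, hr, hb⟩ := Metric.eventually_nhds_iff_ball.1 hall
        refine ⟨ball z₀ r ×ˢ ball z₀ r, mem_nhdsWithin_of_mem_nhds
          (prod_mem_nhds (ball_mem_nhds _ hr) (ball_mem_nhds _ hr)),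
          K * (‖gradient ρ z₀‖ / 2)⁻¹, by positivity, ?_⟩
        rintro ⟨z, w⟩ ⟨hz, hw⟩ hzf hwf
        simp only at hz hw hzf hwf ⊢
        obtain ⟨hzl, -, -, -⟩ := hb z hz
        obtain ⟨hwl, hwt, -, hwg⟩ := hb w hw
        have hseg : segment ℝ w z ⊆ ball z₀ r := (convex_ball z₀ r).segment_subset hw hz
        have htay := (convex_segment w z).norm_image_sub_le_of_norm_fderiv_le' (𝕜 := ℝ) (f := ρ)
          (φ := fderiv ℝ ρ w) (C := K * ‖w - z‖)
          (fun y hy => h.differentiableAt (hb y (hseg hy)).2.2.1)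
          (fun y hy => by
            have h1 := hK.norm_sub_le (hb y (hseg hy)).2.1 hwt
            refine h1.trans ?_
            gcongr
            have := norm_sub_le_of_mem_segment hy
            rwa [norm_sub_rev z w] at this)
          (left_mem_segment ℝ w z) (right_mem_segment ℝ w z)
        rw [(hzl hzf).eq_zero, (hwl hwf).eq_zero, sub_zero, zero_sub, norm_neg, Real.norm_eq_abs,
          norm_sub_rev z w] at htay
        rw [(hwl hwf).normal_eq, inner_smul_right, real_inner_comm, inner_gradient, abs_mul,
          abs_inv, abs_norm, ← neg_sub z w, map_neg, abs_neg, neg_sub]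
        have hpos : 0 < ‖gradient ρ w‖ := lt_trans (half_pos hg0) hwg
        calc ‖gradient ρ w‖⁻¹ * |fderiv ℝ ρ w (z - w)|
            ≤ (‖gradient ρ z₀‖ / 2)⁻¹ * (K * ‖w - z‖ * ‖w - z‖) := by
              gcongr
          _ = _ := by ring
      -- Off the diagonal ‖w − z‖ stays above δ = ‖w₀ − z₀‖/2, so ‖w − z‖ ≤ δ⁻¹‖w − z‖².
      · have hd : 0 < ‖w₀ - z₀‖ := norm_pos_iff.2 (sub_ne_zero.2 (Ne.symm hne))
        have hev : ∀ᶠ p : Plane × Plane in 𝓝 (z₀, w₀), ‖w₀ - z₀‖ / 2 < ‖p.2 - p.1‖ := by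
          have : ContinuousAt (fun p : Plane × Plane => ‖p.2 - p.1‖) (z₀, w₀) := by fun_prop
          exact this.eventually (lt_mem_nhds (half_lt_self hd))
        refine ⟨_, mem_nhdsWithin_of_mem_nhds hev, (‖w₀ - z₀‖ / 2)⁻¹, by positivity, ?_⟩
        intro p hp h1 h2
        replace hp : ‖w₀ - z₀‖ / 2 < ‖p.2 - p.1‖ := hp
        have h3 := abs_real_inner_le_norm (p.2 - p.1) (normal D p.2)
        rw [hD.norm_normal h2, mul_one] at h3
        refine h3.trans ?_
        rw [inv_mul_eq_div, le_div_iff₀ (by positivity)]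
        nlinarith [norm_nonneg (p.2 - p.1)]
  obtain ⟨C, h0, hC⟩ := key
  exact ⟨C, h0, fun z hz w hw => hC (z, w) ⟨hz, hw⟩ hz hw⟩

end IsBoundedC2Domain

theorem lintegral_inv_sqrt_abs_lt_top :
    ∫⁻ u in Ioo (-1 : ℝ) 1, ENNReal.ofReal (√|u|)⁻¹ < ∞ := by
  have h1 : ∫⁻ u in Ioo (0 : ℝ) 1, ENNReal.ofReal (√|u|)⁻¹ < ∞ := by
    have h2 : IntegrableOn (fun u : ℝ => u ^ (-(1 / 2) : ℝ)) (Ioo 0 1) := by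
      rw [intervalIntegral.integrableOn_Ioo_rpow_iff one_pos]
      norm_num
    refine lt_of_le_of_lt ?_ h2.2
    refine setLIntegral_mono' measurableSet_Ioo fun u hu => ?_
    rw [Real.enorm_eq_ofReal (Real.rpow_nonneg hu.1.le _), abs_of_pos hu.1, Real.rpow_neg hu.1.le,
      ← Real.sqrt_eq_rpow]
  have h3 : ∫⁻ u in Ioo (-1 : ℝ) 0, ENNReal.ofReal (√|u|)⁻¹ < ∞ := by
    have h4 := (Measure.measurePreserving_neg (volume : Measure ℝ)).setLIntegral_comp_preimage_emb
      (MeasurableEquiv.neg ℝ).measurableEmbedding (fun u => ENNReal.ofReal (√|u|)⁻¹) (Ioo 0 1)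
    simp only [abs_neg] at h4
    have h5 : (Neg.neg : ℝ → ℝ) ⁻¹' Ioo 0 1 = Ioo (-1) 0 := by simp
    rw [h5] at h4
    rwa [h4]
  have h6 : Ioo (-1 : ℝ) 1 ⊆ Ioo (-1) 0 ∪ ({0} ∪ Ioo 0 1) := by
    intro u hu
    rcases lt_trichotomy u 0 with h | h | h
    · exact Or.inl ⟨hu.1, h⟩
    · exact Or.inr (Or.inl h)
    · exact Or.inr (Or.inr ⟨h, hu.2⟩)
  refine (lintegral_mono_set h6).trans_lt ((lintegral_union_le _ _ _).trans_lt ?_)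
  refine ENNReal.add_lt_top.2 ⟨h3, (lintegral_union_le _ _ _).trans_lt ?_⟩
  refine ENNReal.add_lt_top.2 ⟨?_, h1⟩
  simp

/-- The inverse square root is integrable on bounded intervals, uniformly in its pole. -/
theorem exists_lintegral_inv_sqrt_abs_sub_le (a : ℝ) : ∃ A : ℝ≥0∞, A < ∞ ∧
    ∀ u₀ : ℝ, ∫⁻ u in ball (0 : ℝ) a, ENNReal.ofReal (1 + (√|u - u₀|)⁻¹) ≤ A := by
  refine ⟨2 * volume (ball (0 : ℝ) a) + ∫⁻ u in Ioo (-1 : ℝ) 1, ENNReal.ofReal (√|u|)⁻¹,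
    ENNReal.add_lt_top.2 ⟨ENNReal.mul_lt_top (by simp) measure_ball_lt_top,
      lintegral_inv_sqrt_abs_lt_top⟩, fun u₀ => ?_⟩
  have hpt : ∀ u : ℝ, ENNReal.ofReal (1 + (√|u - u₀|)⁻¹) ≤
      2 + (Ioo (-1 : ℝ) 1).indicator (fun u => ENNReal.ofReal (√|u|)⁻¹) (u - u₀) := by
    intro u
    by_cases hu : u - u₀ ∈ Ioo (-1 : ℝ) 1
    · rw [indicator_of_mem hu, ENNReal.ofReal_add zero_le_one (by positivity), ENNReal.ofReal_one]
      gcongr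
      exact one_le_two
    · rw [indicator_of_notMem hu, add_zero]
      have h1 : 1 ≤ |u - u₀| := by
        rw [mem_Ioo, ← abs_lt] at hu
        exact not_lt.1 hu
      have h2 : (√|u - u₀|)⁻¹ ≤ 1 := inv_le_one_of_one_le₀ (Real.one_le_sqrt.2 h1)
      calc ENNReal.ofReal (1 + (√|u - u₀|)⁻¹) ≤ ENNReal.ofReal 2 :=
            ENNReal.ofReal_le_ofReal (by linarith)
        _ = 2 := by simp
  calc ∫⁻ u in ball (0 : ℝ) a, ENNReal.ofReal (1 + (√|u - u₀|)⁻¹)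
      ≤ ∫⁻ u in ball (0 : ℝ) a, (2 + (Ioo (-1 : ℝ) 1).indicator
          (fun u => ENNReal.ofReal (√|u|)⁻¹) (u - u₀)) := lintegral_mono hpt
    _ = 2 * volume (ball (0 : ℝ) a) + ∫⁻ u in ball (0 : ℝ) a, (Ioo (-1 : ℝ) 1).indicator
          (fun u => ENNReal.ofReal (√|u|)⁻¹) (u - u₀) := by
        rw [lintegral_add_left measurable_const, setLIntegral_const]
    _ ≤ 2 * volume (ball (0 : ℝ) a) + ∫⁻ u, (Ioo (-1 : ℝ) 1).indicator
          (fun u => ENNReal.ofReal (√|u|)⁻¹) (u - u₀) := by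
        gcongr
        exact Measure.restrict_le_self
    _ = _ := by
        rw [lintegral_sub_right_eq_self (fun u => (Ioo (-1 : ℝ) 1).indicator
          (fun u => ENNReal.ofReal (√|u|)⁻¹) u) u₀, lintegral_indicator measurableSet_Ioo]

namespace IsBoundedC2Domain
variable {D : Set Plane}

/-- Uniformity over all x in the plane matters, because the potentials are also evaluated at points
z + e•v off the boundary. Projecting onto the tangent of a chart only shortens distances, which
reduces the claim to one dimension. The exponent 1/2 is a convenient majorant of the logarithm. -/
theorem exists_lintegral_inv_sqrt_le (hD : IsBoundedC2Domain D) : ∃ A : ℝ≥0∞, A < ∞ ∧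
    ∀ x : Plane, ∫⁻ y, ENNReal.ofReal (1 + (√‖x - y‖)⁻¹) ∂(arcLength D) ≤ A := by
  have hres : arcLength D = (arcLength D).restrict (frontier D) := by
    rw [arcLength, Measure.restrict_restrict isClosed_frontier.measurableSet, inter_self]
  rw [hres]
  refine hD.isCompact_frontier.induction_on (p := fun s => ∃ A : ℝ≥0∞, A < ∞ ∧
    ∀ x : Plane, ∫⁻ y in s, ENNReal.ofReal (1 + (√‖x - y‖)⁻¹) ∂(arcLength D) ≤ A) ?_ ?_ ?_ ?_
  · exact ⟨0, by simp, by simp⟩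
  · rintro s t hst ⟨A, hA, h⟩
    exact ⟨A, hA, fun x => (lintegral_mono_set hst).trans (h x)⟩
  · rintro s t ⟨A, hA, h⟩ ⟨B, hB, h'⟩
    exact ⟨A + B, ENNReal.add_lt_top.2 ⟨hA, hB⟩, fun x =>
      (lintegral_union_le _ _ _).trans (add_le_add (h x) (h' x))⟩
  · intro x₀ hx₀
    obtain ⟨c⟩ := hD.nonempty_boundaryChart hx₀
    refine ⟨c.nhd, mem_nhdsWithin_of_mem_nhds (c.isOpen_nhd.mem_nhds c.mem_nhd), ?_⟩
    obtain ⟨A, hA, h⟩ := exists_lintegral_inv_sqrt_abs_sub_le c.size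
    obtain ⟨W, hW⟩ := (isCompact_closedBall (0 : ℝ) c.size).exists_bound_of_continuousOn
      c.continuous_speed.continuousOn
    refine ⟨ENNReal.ofReal W * A, ENNReal.mul_lt_top ENNReal.ofReal_lt_top hA, fun x => ?_⟩
    rw [c.lintegral_nhd]
    refine le_trans ?_ (mul_le_mul_right (h (inner ℝ c.tangent (x - x₀))) _)
    rw [← lintegral_const_mul' _ _ ENNReal.ofReal_ne_top]
    refine lintegral_mono_ae ?_
    -- At the pole the inverse of 0 is 0 by convention and the comparison could fail; the pole is a
    -- null set.
    have hne : ∀ᵐ s : ℝ, s ≠ inner ℝ c.tangent (x - x₀) := by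
      simp [ae_iff, measure_singleton]
    filter_upwards [ae_restrict_mem measurableSet_ball, ae_restrict_of_ae hne] with s hs hsne
    refine mul_le_mul' (ENNReal.ofReal_le_ofReal ((le_abs_self _).trans
      (hW s (ball_subset_closedBall hs)))) (ENNReal.ofReal_le_ofReal ?_)
    have hpos : 0 < |s - inner ℝ c.tangent (x - x₀)| := abs_pos.2 (sub_ne_zero.2 hsne)
    have hle : |s - inner ℝ c.tangent (x - x₀)| ≤ ‖x - c.curve s‖ := by
      have e : s - inner ℝ c.tangent (x - x₀) = inner ℝ c.tangent (c.curve s - x) := by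
        have : c.curve s - x = (c.map (s, 0) - x₀) - (x - x₀) := by rw [BoundaryChart.curve]; abel
        rw [this, inner_sub_right c.tangent (c.map (s, 0) - x₀), c.map_sub, c.inner_tangent]
      rw [e, norm_sub_rev]
      have := abs_real_inner_le_norm c.tangent (c.curve s - x)
      rwa [c.norm_tangent, one_mul] at this
    gcongr

theorem isFiniteMeasure_arcLength (hD : IsBoundedC2Domain D) : IsFiniteMeasure (arcLength D) := by
  obtain ⟨A, hA, h⟩ := hD.exists_lintegral_inv_sqrt_le
  refine ⟨lt_of_le_of_lt ?_ hA⟩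
  refine le_trans ?_ (h 0)
  rw [← lintegral_one]
  refine lintegral_mono fun y => ?_
  rw [← ENNReal.ofReal_one]
  exact ENNReal.ofReal_le_ofReal (by simp)

end IsBoundedC2Domain
end CGPT
end

/-! ### The divergence theorem on D and Green's identities. -/

noncomputable section
namespace CGPT
open MeasureTheory Set Filter Topology Metric
open scoped ENNReal NNReal Manifold ContDiff

theorem ae_mem_frontier (D : Set Plane) : ∀ᵐ y ∂(arcLength D), y ∈ frontier D :=
  ae_restrict_mem isClosed_frontier.measurableSet

/-- The divergence of a planar vector field. -/
def div (G : Plane → Plane) (y : Plane) : ℝ :=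
  ∑ i, (fderiv ℝ G y (EuclideanSpace.single i 1)) i

theorem integral_fderiv_eq_zero {f : Plane → ℝ} (hf : ContDiff ℝ 1 f) (hc : HasCompactSupport f)
    (v : Plane) : ∫ y, fderiv ℝ f y v = 0 := by
  have h := integral_mul_fderiv_eq_neg_fderiv_mul_of_integrable (μ := (volume : Measure Plane))
    (f := fun _ => (1 : ℝ)) (g := f) (v := v) ?_ ?_ ?_ (fun _ _ => differentiableAt_const _)
    (fun y _ => hf.differentiable one_ne_zero y)
  · simpa using h
  · simp
  · simp only [one_mul]
    refine Continuous.integrable_of_hasCompactSupport ?_ (hc.fderiv_apply ℝ v)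
    have := hf.continuous_fderiv one_ne_zero
    fun_prop
  · simp only [one_mul]
    exact hf.continuous.integrable_of_hasCompactSupport hc

namespace IsBoundedC2Domain
variable {D : Set Plane}

theorem aestronglyMeasurable_normal (hD : IsBoundedC2Domain D) :
    AEStronglyMeasurable (normal D) (arcLength D) :=
  hD.continuousOn_normal.aestronglyMeasurable isClosed_frontier.measurableSet

theorem ae_abs_inner_normal_le (hD : IsBoundedC2Domain D) (v : Plane) :
    ∀ᵐ y ∂(arcLength D), |inner ℝ (normal D y) v| ≤ ‖v‖ := by
  filter_upwards [ae_mem_frontier D] with y hy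
  have := abs_real_inner_le_norm (normal D y) v
  rwa [hD.norm_normal hy, one_mul] at this

/-- Continuous functions are integrable on the boundary. -/
theorem integrable_of_continuous (hD : IsBoundedC2Domain D) {E : Type*} [NormedAddCommGroup E]
    {f : Plane → E} (hf : Continuous f) : Integrable f (arcLength D) := by
  have := hD.isFiniteMeasure_arcLength
  obtain ⟨C, hC⟩ := hD.isCompact_frontier.exists_bound_of_continuousOn hf.continuousOn
  refine Integrable.of_bound hf.aestronglyMeasurable C ?_
  filter_upwards [ae_mem_frontier D] with y hy using hC y hy

theorem integrable_mul_inner_normal (hD : IsBoundedC2Domain D) {f : Plane → ℝ}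
    (hf : Continuous f) (v : Plane) :
    Integrable (fun y => f y * inner ℝ (normal D y) v) (arcLength D) :=
  (hD.integrable_of_continuous hf).mul_bdd (c := ‖v‖)
    (hD.aestronglyMeasurable_normal.inner aestronglyMeasurable_const)
    (hD.ae_abs_inner_normal_le v)

/-- **Divergence theorem** on a bounded `C²` domain. -/
theorem integral_fderiv_eq (hD : IsBoundedC2Domain D) {f : Plane → ℝ} (hf : ContDiff ℝ 1 f)
    (v : Plane) :
    ∫ y in D, fderiv ℝ f y v = ∫ y, f y * inner ℝ (normal D y) v ∂(arcLength D) := by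
  have hch : ∀ x : frontier D, Nonempty (BoundaryChart D (x : Plane)) := fun x =>
    hD.nonempty_boundaryChart x.2
  let ch : ∀ x : frontier D, BoundaryChart D (x : Plane) := fun x => (hch x).some
  -- The index `none` stands for the interior D. The unit balls keep every piece bounded, so the
  -- localized functions have compact support.
  let U : Option (frontier D) → Set Plane := fun i => i.elim D fun x => (ch x).nhd ∩ ball x 1
  have hUo : ∀ i, IsOpen (U i) := by
    rintro (_ | x)
    · exact hD.isOpen
    · exact (ch x).isOpen_nhd.inter isOpen_ball
  have hUb : ∀ i, Bornology.IsBounded (U i) := by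
    rintro (_ | x)
    · exact hD.isBounded
    · exact isBounded_ball.subset inter_subset_right
  have hcov : closure D ⊆ ⋃ i, U i := by
    intro y hy
    by_cases hyD : y ∈ D
    · exact mem_iUnion.2 ⟨none, hyD⟩
    · have hyf : y ∈ frontier D := by
        rw [hD.isOpen.frontier_eq]; exact ⟨hy, hyD⟩
      exact mem_iUnion.2 ⟨some ⟨y, hyf⟩, (ch ⟨y, hyf⟩).mem_nhd, mem_ball_self one_pos⟩
  obtain ⟨ρ, hρ⟩ := SmoothPartitionOfUnity.exists_isSubordinate 𝓘(ℝ, Plane)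
    (isClosed_closure (s := D)) U hUo hcov
  have hρc : ∀ i, ContDiff ℝ 1 (ρ i) := fun i =>
    ((ρ i).contMDiff.contDiff).of_le (by exact_mod_cast le_top)
  have hfin := ρ.locallyFinite.finite_nonempty_inter_compact hD.isCompact_closure
  set T := hfin.toFinset with hT
  have hsum : ∀ y ∈ closure D, ∑ i ∈ T, ρ i y = 1 := by
    intro y hy
    refine ρ.sum_finsupport' y hy fun i hi => ?_
    rw [SmoothPartitionOfUnity.mem_finsupport] at hi
    rw [hT, Finite.mem_toFinset]
    exact ⟨y, hi, hy⟩
  set g : Option (frontier D) → Plane → ℝ := fun i y => ρ i y * f y with hg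
  have hgc : ∀ i, ContDiff ℝ 1 (g i) := fun i => (hρc i).mul hf
  have hgt : ∀ i, tsupport (g i) ⊆ U i := fun i =>
    (tsupport_mul_subset_left (f := ρ i) (g := f)).trans (hρ i)
  have hgs : ∀ i, HasCompactSupport (g i) := fun i =>
    HasCompactSupport.of_support_subset_isCompact (hUb i).isCompact_closure
      (((subset_tsupport _).trans (hgt i)).trans subset_closure)
  have hloc : ∀ i, ∫ y in D, fderiv ℝ (g i) y v =
      ∫ y, g i y * inner ℝ (normal D y) v ∂(arcLength D) := by
    rintro (_ | x)
    -- The interior piece is supported in D: the boundary side is zero, and the other side is the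
    -- integral of a derivative over the whole plane.
    · have h1 : ∫ y, g none y * inner ℝ (normal D y) v ∂(arcLength D) = 0 := by
        refine (integral_congr_ae ?_).trans (integral_zero Plane ℝ)
        filter_upwards [ae_mem_frontier D] with y hy
        rw [hD.isOpen.frontier_eq] at hy
        rw [image_eq_zero_of_notMem_tsupport (fun h => hy.2 (hgt none h)), zero_mul]
      rw [h1, setIntegral_eq_integral_of_forall_compl_eq_zero]
      · exact integral_fderiv_eq_zero (hgc none) (hgs none) v
      · intro y hy
        have : fderiv ℝ (g none) y = 0 := by
          by_contra h0
          exact hy (hgt none (support_fderiv_subset ℝ h0))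
        rw [this]; rfl
    · exact (ch x).integral_fderiv_eq hD.isOpen.measurableSet (hgc _) (hgs _)
        ((hgt (some x)).trans inter_subset_left) v
  have hfg : ∀ y ∈ closure D, f y = ∑ i ∈ T, g i y := by
    intro y hy
    simp only [hg]
    rw [← Finset.sum_mul, hsum y hy, one_mul]
  have hdg : ∀ y ∈ D, fderiv ℝ f y v = ∑ i ∈ T, fderiv ℝ (g i) y v := by
    intro y hy
    have h1 : f =ᶠ[𝓝 y] fun y => ∑ i ∈ T, g i y := by
      filter_upwards [hD.isOpen.mem_nhds hy] with z hz using hfg z (subset_closure hz)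
    rw [h1.fderiv_eq, fderiv_fun_sum (fun i _ => (hgc i).differentiable one_ne_zero y)]
    simp
  rw [setIntegral_congr_fun hD.isOpen.measurableSet hdg, integral_finsetSum]
  · simp_rw [hloc]
    rw [← integral_finsetSum]
    · refine integral_congr_ae ?_
      filter_upwards [ae_mem_frontier D] with y hy
      rw [← Finset.sum_mul, ← hfg y (frontier_subset_closure hy)]
    · exact fun i _ => hD.integrable_mul_inner_normal (hgc i).continuous v
  · intro i _
    refine (Continuous.integrable_of_hasCompactSupport ?_ ((hgs i).fderiv_apply ℝ v)).integrableOn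
    have := (hgc i).continuous_fderiv one_ne_zero
    fun_prop

end IsBoundedC2Domain

theorem sum_fderiv_mul_apply {u : Plane → ℝ} {G : Plane → Plane} (hu : ContDiff ℝ 1 u)
    (hG : ContDiff ℝ 1 G) (y : Plane) :
    ∑ i, fderiv ℝ (fun y => u y * G y i) y (EuclideanSpace.single i 1) =
      fderiv ℝ u y (G y) + u y * div G y := by
  have hGi : ∀ i, HasFDerivAt (fun y => G y i)
      ((EuclideanSpace.proj i : Plane →L[ℝ] ℝ) ∘L fderiv ℝ G y) y := fun i =>
    (EuclideanSpace.proj i : Plane →L[ℝ] ℝ).hasFDerivAt.comp y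
      (hG.differentiable one_ne_zero y).hasFDerivAt
  have h1 : ∀ i, fderiv ℝ (fun y => u y * G y i) y (EuclideanSpace.single i 1) =
      u y * (fderiv ℝ G y (EuclideanSpace.single i 1)) i +
        G y i * fderiv ℝ u y (EuclideanSpace.single i 1) := by
    intro i
    have := ((hu.differentiable one_ne_zero y).hasFDerivAt.mul (hGi i)).fderiv
    rw [show (fun y => u y * G y i) = u * fun y => G y i from rfl, this]
    simp
  have h2 : fderiv ℝ u y (G y) = ∑ i, G y i * fderiv ℝ u y (EuclideanSpace.single i 1) := by
    have : G y = ∑ i, G y i • EuclideanSpace.single i (1 : ℝ) := by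
      ext j
      fin_cases j <;> simp
    conv_lhs => rw [this]
    simp
  rw [h2, div, Finset.mul_sum, ← Finset.sum_add_distrib]
  exact Finset.sum_congr rfl fun i _ => by rw [h1 i]; ring

/-- **Green's identity** on a bounded `C²` domain. -/
theorem IsBoundedC2Domain.green {D : Set Plane} (hD : IsBoundedC2Domain D) {u : Plane → ℝ}
    {G : Plane → Plane} (hu : ContDiff ℝ 1 u) (hG : ContDiff ℝ 1 G) :
    ∫ y in D, (fderiv ℝ u y (G y) + u y * div G y) =
      ∫ y, u y * inner ℝ (normal D y) (G y) ∂(arcLength D) := by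
  have hGi : ∀ i, ContDiff ℝ 1 fun y => G y i := fun i =>
    (EuclideanSpace.proj i : Plane →L[ℝ] ℝ).contDiff.comp hG
  have hc : ∀ i, ContDiff ℝ 1 fun y => u y * G y i := fun i => hu.mul (hGi i)
  simp_rw [← sum_fderiv_mul_apply hu hG]
  rw [integral_finsetSum]
  · simp_rw [fun i => hD.integral_fderiv_eq (hc i) (EuclideanSpace.single i 1)]
    rw [← integral_finsetSum]
    · refine integral_congr_ae (Filter.Eventually.of_forall fun y => ?_)
      have e : ∀ i, inner ℝ (normal D y) (EuclideanSpace.single i 1) = normal D y i := fun i => by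
        rw [EuclideanSpace.inner_single_right]; simp
      simp only [e]
      simp only [PiLp.inner_apply, RCLike.inner_apply, conj_trivial, Finset.mul_sum]
      exact Finset.sum_congr rfl fun i _ => by ring
    · exact fun i _ => hD.integrable_mul_inner_normal (hc i).continuous _
  · intro i _
    have h1 : Continuous fun y => fderiv ℝ (fun y => u y * G y i) y (EuclideanSpace.single i 1) := by
      have := (hc i).continuous_fderiv one_ne_zero
      fun_prop
    exact (h1.continuousOn.integrableOn_compact hD.isCompact_closure).mono_set subset_closure

/-- **Green's identity** on the whole plane, for decaying data. -/
theorem integral_plane_green {u : Plane → ℝ} {G : Plane → Plane} (hu : ContDiff ℝ 1 u)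
    (hG : ContDiff ℝ 1 G) (h0 : Integrable fun y => ‖u y‖ * ‖G y‖)
    (h1 : Integrable fun y => ‖fderiv ℝ u y‖ * ‖G y‖)
    (h2 : Integrable fun y => ‖u y‖ * ‖fderiv ℝ G y‖) :
    ∫ y, fderiv ℝ u y (G y) = -∫ y, u y * div G y := by
  have hGi : ∀ i, ContDiff ℝ 1 fun y => G y i := fun i =>
    (EuclideanSpace.proj i : Plane →L[ℝ] ℝ).contDiff.comp hG
  have hGd : ∀ i y, fderiv ℝ (fun y => G y i) y =
      (EuclideanSpace.proj i : Plane →L[ℝ] ℝ) ∘L fderiv ℝ G y := fun i y =>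
    ((EuclideanSpace.proj i : Plane →L[ℝ] ℝ).hasFDerivAt.comp y
      (hG.differentiable one_ne_zero y).hasFDerivAt).fderiv
  have hcu := hu.continuous_fderiv one_ne_zero
  have hcG := hG.continuous_fderiv one_ne_zero
  have hnorm : ∀ i, ‖(EuclideanSpace.single i 1 : Plane)‖ = 1 := fun i => by simp
  have I1 : ∀ i, Integrable fun y => fderiv ℝ u y (EuclideanSpace.single i 1) * G y i := by
    intro i
    refine h1.mono' ?_ (Filter.Eventually.of_forall fun y => ?_)
    · have := (hGi i).continuous
      exact Continuous.aestronglyMeasurable (by fun_prop)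
    · rw [norm_mul]
      gcongr
      · have := (fderiv ℝ u y).le_opNorm (EuclideanSpace.single i 1)
        rwa [hnorm, mul_one] at this
      · exact PiLp.norm_apply_le (G y) i
  have I2 : ∀ i, Integrable fun y => u y * (fderiv ℝ G y (EuclideanSpace.single i 1)) i := by
    intro i
    refine h2.mono' ?_ (Filter.Eventually.of_forall fun y => ?_)
    · have := hu.continuous
      exact Continuous.aestronglyMeasurable (by fun_prop)
    · rw [norm_mul]
      gcongr
      refine (PiLp.norm_apply_le _ i).trans ?_
      have := (fderiv ℝ G y).le_opNorm (EuclideanSpace.single i 1)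
      rwa [hnorm, mul_one] at this
  have I0 : ∀ i, Integrable fun y => u y * G y i := by
    intro i
    refine h0.mono' ?_ (Filter.Eventually.of_forall fun y => ?_)
    · exact (hu.continuous.mul (hGi i).continuous).aestronglyMeasurable
    · rw [norm_mul]
      gcongr
      exact PiLp.norm_apply_le (G y) i
  have key : ∀ i, ∫ y, u y * (fderiv ℝ G y (EuclideanSpace.single i 1)) i =
      -∫ y, fderiv ℝ u y (EuclideanSpace.single i 1) * G y i := by
    intro i
    have := integral_mul_fderiv_eq_neg_fderiv_mul_of_integrable (μ := (volume : Measure Plane))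
      (f := u) (g := fun y => G y i) (v := EuclideanSpace.single i 1) (I1 i)
      (by simp_rw [hGd]; exact I2 i) (I0 i) (fun y _ => hu.differentiable one_ne_zero y)
      (fun y _ => (hGi i).differentiable one_ne_zero y)
    simp_rw [hGd] at this
    exact this
  have h3 : ∀ y, fderiv ℝ u y (G y) = ∑ i, fderiv ℝ u y (EuclideanSpace.single i 1) * G y i := by
    intro y
    have : G y = ∑ i, G y i • EuclideanSpace.single i (1 : ℝ) := by
      ext j
      fin_cases j <;> simp
    conv_lhs => rw [this]
    simp [mul_comm]
  simp_rw [h3, div, Finset.mul_sum]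
  rw [integral_finsetSum _ (fun i _ => I1 i), integral_finsetSum _ (fun i _ => I2 i)]
  simp_rw [key]
  simp

end CGPT
end

/-! ### The smoothed logarithmic kernel. -/

noncomputable section
namespace CGPT
open MeasureTheory Set Filter Topology Metric
open scoped ENNReal NNReal ContDiff Real

/-- The smoothed fundamental solution `log (|x|² + e²) / 4π` of the Laplacian. -/
def gam (e : ℝ) (x : Plane) : ℝ := (4 * π)⁻¹ * Real.log (‖x‖ ^ 2 + e ^ 2)

/-- The gradient of `gam e`. -/
def ker (e : ℝ) (x : Plane) : Plane := ((2 * π)⁻¹ * (‖x‖ ^ 2 + e ^ 2)⁻¹) • x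

/-- The Laplacian of `gam e`, an approximation of the identity. -/
def del (e : ℝ) (x : Plane) : ℝ := π⁻¹ * (e ^ 2 * ((‖x‖ ^ 2 + e ^ 2) ^ 2)⁻¹)


theorem contDiff_gam {e : ℝ} (he : 0 < e) : ContDiff ℝ 2 (gam e) := by
  unfold gam
  refine contDiff_const.mul (ContDiff.log ?_ fun x => by positivity)
  exact (contDiff_norm_sq ℝ).add contDiff_const

theorem contDiff_inv_norm_sq {e : ℝ} (he : 0 < e) : ContDiff ℝ 2 fun x : Plane => (‖x‖ ^ 2 + e ^ 2)⁻¹ :=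
  ((contDiff_norm_sq ℝ).add contDiff_const).inv fun x => by positivity

theorem contDiff_ker {e : ℝ} (he : 0 < e) : ContDiff ℝ 2 (ker e) :=
  (contDiff_const.mul (contDiff_inv_norm_sq he)).smul contDiff_id

theorem continuous_del {e : ℝ} (he : 0 < e) : Continuous (del e) := by
  unfold del
  refine continuous_const.mul (continuous_const.mul (Continuous.inv₀ (by fun_prop) fun x => ?_))
  positivity

theorem del_nonneg {e : ℝ} (x : Plane) : 0 ≤ del e x := by
  unfold del; positivity

theorem hasFDerivAt_norm_sq_add {e : ℝ} (x : Plane) :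
    HasFDerivAt (fun x : Plane => ‖x‖ ^ 2 + e ^ 2) (2 • innerSL ℝ x) x :=
  (hasStrictFDerivAt_norm_sq x).hasFDerivAt.add_const _

theorem fderiv_gam {e : ℝ} (he : 0 < e) (x v : Plane) : fderiv ℝ (gam e) x v = inner ℝ (ker e x) v := by
  have h1 := ((hasFDerivAt_norm_sq_add (e := e) x).log (by positivity)).const_mul (4 * π)⁻¹
  have h2 : fderiv ℝ (gam e) x = _ := h1.fderiv
  rw [h2, ker, inner_smul_left]
  simp only [smul_apply, innerSL_apply_apply, smul_eq_mul, nsmul_eq_mul,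
    conj_trivial]
  push_cast
  field_simp
  ring

theorem fderiv_ker {e : ℝ} (he : 0 < e) (x v : Plane) : fderiv ℝ (ker e) x v =
    ((2 * π)⁻¹ * (‖x‖ ^ 2 + e ^ 2)⁻¹) • v -
      (π⁻¹ * ((‖x‖ ^ 2 + e ^ 2) ^ 2)⁻¹ * inner ℝ x v) • x := by
  have h0 : ‖x‖ ^ 2 + e ^ 2 ≠ 0 := by positivity
  have h1 : HasFDerivAt (fun x : Plane => (‖x‖ ^ 2 + e ^ 2)⁻¹)
      ((-((‖x‖ ^ 2 + e ^ 2) ^ 2)⁻¹) • (2 • innerSL ℝ x)) x :=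
    (hasDerivAt_inv h0).comp_hasFDerivAt x (hasFDerivAt_norm_sq_add (e := e) x)
  have h2 := (h1.const_mul (2 * π)⁻¹).smul (hasFDerivAt_id x)
  have h3 : fderiv ℝ (ker e) x = _ := h2.fderiv
  rw [h3]
  simp only [add_apply, smul_apply,
    ContinuousLinearMap.smulRight_apply, innerSL_apply_apply, ContinuousLinearMap.id_apply, id,
    smul_eq_mul, nsmul_eq_mul]
  rw [sub_eq_add_neg, ← neg_smul]
  congr 2
  push_cast
  field_simp

theorem norm_fderiv_ker_le {e : ℝ} (he : 0 < e) (x : Plane) : ‖fderiv ℝ (ker e) x‖ ≤ (‖x‖ ^ 2 + e ^ 2)⁻¹ := by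
  refine ContinuousLinearMap.opNorm_le_bound _ (by positivity) fun v => ?_
  have hq : 0 < ‖x‖ ^ 2 + e ^ 2 := by positivity
  have hpi := Real.pi_gt_three
  rw [fderiv_ker he]
  refine (norm_sub_le _ _).trans ?_
  rw [norm_smul, norm_smul, Real.norm_eq_abs, Real.norm_eq_abs,
    abs_of_nonneg (by positivity : (0 : ℝ) ≤ (2 * π)⁻¹ * (‖x‖ ^ 2 + e ^ 2)⁻¹), abs_mul,
    abs_of_nonneg (by positivity : (0 : ℝ) ≤ π⁻¹ * ((‖x‖ ^ 2 + e ^ 2) ^ 2)⁻¹)]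
  have h1 : π⁻¹ * ((‖x‖ ^ 2 + e ^ 2) ^ 2)⁻¹ * |inner ℝ x v| * ‖x‖ ≤
      π⁻¹ * (‖x‖ ^ 2 + e ^ 2)⁻¹ * ‖v‖ := by
    calc π⁻¹ * ((‖x‖ ^ 2 + e ^ 2) ^ 2)⁻¹ * |inner ℝ x v| * ‖x‖
        ≤ π⁻¹ * ((‖x‖ ^ 2 + e ^ 2) ^ 2)⁻¹ * (‖x‖ * ‖v‖) * ‖x‖ := by
          gcongr; exact abs_real_inner_le_norm x v
      _ = π⁻¹ * ‖v‖ * (‖x‖ ^ 2 * ((‖x‖ ^ 2 + e ^ 2) ^ 2)⁻¹) := by ring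
      _ ≤ π⁻¹ * ‖v‖ * (‖x‖ ^ 2 + e ^ 2)⁻¹ := by
          gcongr
          rw [← div_eq_mul_inv, div_le_iff₀ (by positivity), sq (‖x‖ ^ 2 + e ^ 2),
            inv_mul_cancel_left₀ hq.ne']
          nlinarith
      _ = _ := by ring
  have h2 : (2 * π)⁻¹ + π⁻¹ ≤ 1 := by
    rw [mul_inv, show (2 : ℝ)⁻¹ * π⁻¹ + π⁻¹ = 3 / 2 / π by ring, div_le_one (by positivity)]
    linarith
  calc (2 * π)⁻¹ * (‖x‖ ^ 2 + e ^ 2)⁻¹ * ‖v‖ + π⁻¹ * ((‖x‖ ^ 2 + e ^ 2) ^ 2)⁻¹ * |inner ℝ x v| * ‖x‖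
      ≤ (2 * π)⁻¹ * (‖x‖ ^ 2 + e ^ 2)⁻¹ * ‖v‖ + π⁻¹ * (‖x‖ ^ 2 + e ^ 2)⁻¹ * ‖v‖ := by gcongr
    _ = ((2 * π)⁻¹ + π⁻¹) * ((‖x‖ ^ 2 + e ^ 2)⁻¹ * ‖v‖) := by ring
    _ ≤ 1 * ((‖x‖ ^ 2 + e ^ 2)⁻¹ * ‖v‖) := by gcongr
    _ = _ := one_mul _

theorem div_ker {e : ℝ} (he : 0 < e) (x : Plane) : div (ker e) x = del e x := by
  have h0 : ‖x‖ ^ 2 + e ^ 2 ≠ 0 := by positivity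
  have hn := EuclideanSpace.real_norm_sq_eq x
  rw [Fin.sum_univ_two] at hn
  rw [div, Fin.sum_univ_two, fderiv_ker he, fderiv_ker he, del, EuclideanSpace.inner_single_right,
    EuclideanSpace.inner_single_right]
  simp only [PiLp.sub_apply, PiLp.smul_apply, smul_eq_mul, conj_trivial, one_mul,
    PiLp.single_apply, if_true]
  field_simp
  rw [hn]
  ring

theorem norm_ker_le {e : ℝ} (he : 0 < e) (x : Plane) : ‖ker e x‖ ≤ e⁻¹ := by
  have hq : 0 < ‖x‖ ^ 2 + e ^ 2 := by positivity
  have hpi := Real.pi_gt_three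
  rw [ker, norm_smul, Real.norm_eq_abs,
    abs_of_nonneg (by positivity : (0 : ℝ) ≤ (2 * π)⁻¹ * (‖x‖ ^ 2 + e ^ 2)⁻¹)]
  have h1 : (2 * π)⁻¹ ≤ 1 := inv_le_one_of_one_le₀ (by linarith)
  calc (2 * π)⁻¹ * (‖x‖ ^ 2 + e ^ 2)⁻¹ * ‖x‖ ≤ 1 * (‖x‖ ^ 2 + e ^ 2)⁻¹ * ‖x‖ := by gcongr
    _ = ‖x‖ / (‖x‖ ^ 2 + e ^ 2) := by rw [one_mul, div_eq_inv_mul]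
    _ ≤ e⁻¹ := by
      rw [div_le_iff₀ hq, inv_mul_eq_div, le_div_iff₀ he]
      nlinarith [sq_nonneg (‖x‖ - e), norm_nonneg x]

theorem abs_norm_sq_sub_le {e : ℝ} (a b : Plane) :
    |(‖a‖ ^ 2 + e ^ 2) - (‖b‖ ^ 2 + e ^ 2)| ≤ ‖a - b‖ * (‖a‖ + ‖b‖) := by
  rw [show (‖a‖ ^ 2 + e ^ 2) - (‖b‖ ^ 2 + e ^ 2) = (‖a‖ - ‖b‖) * (‖a‖ + ‖b‖) by ring, abs_mul,
    abs_of_nonneg (by positivity : 0 ≤ ‖a‖ + ‖b‖)]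
  gcongr
  exact abs_norm_sub_norm_le a b

/-- With `abs_gam_sub_gam_le`, this measures the effect of moving the pole. The gained power of ‖x‖
becomes decay at infinity for densities of mean zero. -/
theorem norm_ker_sub_ker_le {e : ℝ} (he : 0 < e) (a b : Plane) : ‖ker e a - ker e b‖ ≤
    ‖a - b‖ * ((‖a‖ ^ 2 + e ^ 2)⁻¹ + (‖b‖ ^ 2 + e ^ 2)⁻¹) := by
  have hd := abs_norm_sq_sub_le (e := e) a b
  have hA : 0 < ‖a‖ ^ 2 + e ^ 2 := by positivity
  have hB : 0 < ‖b‖ ^ 2 + e ^ 2 := by positivity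
  have hAa : ‖a‖ ^ 2 ≤ ‖a‖ ^ 2 + e ^ 2 := by nlinarith
  have hBb : ‖b‖ ^ 2 ≤ ‖b‖ ^ 2 + e ^ 2 := by nlinarith
  set A := ‖a‖ ^ 2 + e ^ 2
  set B := ‖b‖ ^ 2 + e ^ 2
  have hpi := Real.pi_gt_three
  have h1 : ker e a - ker e b = (2 * π)⁻¹ • (A⁻¹ • (a - b) + (A⁻¹ - B⁻¹) • b) := by
    simp only [ker, A, B]
    module
  have h2 : |A⁻¹ - B⁻¹| ≤ ‖a - b‖ * (‖a‖ + ‖b‖) * (A⁻¹ * B⁻¹) := by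
    have : A⁻¹ - B⁻¹ = (B - A) * (A⁻¹ * B⁻¹) := by field_simp
    rw [this, abs_mul, abs_of_pos (by positivity : 0 < A⁻¹ * B⁻¹), abs_sub_comm]
    gcongr
  have h3 : (‖a‖ + ‖b‖) * (A⁻¹ * B⁻¹) * ‖b‖ ≤ 3 / 2 * A⁻¹ + 1 / 2 * B⁻¹ := by
    have : (3 / 2 * A⁻¹ + 1 / 2 * B⁻¹) = (3 / 2 * B + 1 / 2 * A) * (A⁻¹ * B⁻¹) := by
      field_simp
    rw [this, mul_right_comm]
    gcongr
    nlinarith [sq_nonneg (‖a‖ - ‖b‖)]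
  have h4 : ‖A⁻¹ • (a - b) + (A⁻¹ - B⁻¹) • b‖ ≤ ‖a - b‖ * (5 / 2 * A⁻¹ + 1 / 2 * B⁻¹) := by
    refine (norm_add_le _ _).trans ?_
    rw [norm_smul, norm_smul, Real.norm_eq_abs, Real.norm_eq_abs, abs_of_pos (by positivity : 0 < A⁻¹)]
    calc A⁻¹ * ‖a - b‖ + |A⁻¹ - B⁻¹| * ‖b‖
        ≤ A⁻¹ * ‖a - b‖ + ‖a - b‖ * (‖a‖ + ‖b‖) * (A⁻¹ * B⁻¹) * ‖b‖ := by gcongr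
      _ = ‖a - b‖ * (A⁻¹ + (‖a‖ + ‖b‖) * (A⁻¹ * B⁻¹) * ‖b‖) := by ring
      _ ≤ ‖a - b‖ * (A⁻¹ + (3 / 2 * A⁻¹ + 1 / 2 * B⁻¹)) := by gcongr
      _ = _ := by ring
  have h5 : (2 * π)⁻¹ ≤ 1 / 3 := by
    rw [inv_le_comm₀ (by positivity) (by positivity)]; linarith
  rw [h1, norm_smul, Real.norm_eq_abs, abs_of_pos (by positivity)]
  calc (2 * π)⁻¹ * ‖A⁻¹ • (a - b) + (A⁻¹ - B⁻¹) • b‖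
      ≤ 1 / 3 * (‖a - b‖ * (5 / 2 * A⁻¹ + 1 / 2 * B⁻¹)) := by gcongr
    _ = ‖a - b‖ * (5 / 6 * A⁻¹ + 1 / 6 * B⁻¹) := by ring
    _ ≤ ‖a - b‖ * (1 * A⁻¹ + 1 * B⁻¹) := by gcongr <;> norm_num
    _ = _ := by ring

theorem abs_gam_sub_gam_le {e : ℝ} (he : 0 < e) (a b : Plane) : |gam e a - gam e b| ≤
    ‖a - b‖ * (‖a‖ + ‖b‖) * ((‖a‖ ^ 2 + e ^ 2)⁻¹ + (‖b‖ ^ 2 + e ^ 2)⁻¹) := by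
  have hd := abs_norm_sq_sub_le (e := e) a b
  have hA : 0 < ‖a‖ ^ 2 + e ^ 2 := by positivity
  have hB : 0 < ‖b‖ ^ 2 + e ^ 2 := by positivity
  rw [gam, gam]
  set A := ‖a‖ ^ 2 + e ^ 2
  set B := ‖b‖ ^ 2 + e ^ 2
  have hpi := Real.pi_gt_three
  have hlog : ∀ s t : ℝ, 0 < s → 0 < t → Real.log s - Real.log t ≤ |s - t| * (s⁻¹ + t⁻¹) := by
    intro s t hs ht
    rw [← Real.log_div hs.ne' ht.ne']
    have h1 := Real.log_le_sub_one_of_pos (div_pos hs ht)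
    have h2 : s / t - 1 = (s - t) * t⁻¹ := by field_simp
    rw [h2] at h1
    refine h1.trans ?_
    gcongr
    · exact le_abs_self _
    · have := inv_pos.2 hs
      linarith
  have h1 : |Real.log A - Real.log B| ≤ |A - B| * (A⁻¹ + B⁻¹) := by
    rw [abs_le]
    constructor
    · have := hlog B A hB hA
      rw [abs_sub_comm, add_comm] at this
      linarith
    · exact hlog A B hA hB
  rw [← mul_sub, abs_mul, abs_of_pos (by positivity : 0 < (4 * π)⁻¹)]
  have h2 : (4 * π)⁻¹ ≤ 1 := inv_le_one_of_one_le₀ (by linarith)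
  calc (4 * π)⁻¹ * |Real.log A - Real.log B| ≤ 1 * (|A - B| * (A⁻¹ + B⁻¹)) := by gcongr
    _ ≤ 1 * (‖a - b‖ * (‖a‖ + ‖b‖) * (A⁻¹ + B⁻¹)) := by gcongr
    _ = _ := one_mul _

/-- Uniform decay of the kernels with poles in a bounded set. -/
theorem inv_norm_sub_sq_le {e : ℝ} (he : 0 < e) {R : ℝ} (hR : 0 ≤ R) {x y : Plane} (hy : ‖y‖ ≤ R) :
    (‖x - y‖ ^ 2 + e ^ 2)⁻¹ ≤ ((1 + R) / e + 1) ^ 2 * ((1 + ‖x‖) ^ 2)⁻¹ := by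
  rw [← div_eq_mul_inv, le_div_iff₀ (by positivity), inv_mul_le_iff₀ (by positivity)]
  have hx : ‖x‖ ≤ ‖x - y‖ + R := by
    have := norm_add_le (x - y) y
    rw [sub_add_cancel] at this
    linarith
  have h1 : ‖x - y‖ ≤ √(‖x - y‖ ^ 2 + e ^ 2) := Real.le_sqrt_of_sq_le (by nlinarith)
  have h2 : e ≤ √(‖x - y‖ ^ 2 + e ^ 2) := Real.le_sqrt_of_sq_le (by nlinarith [sq_nonneg ‖x - y‖])
  have h3 : 1 + ‖x‖ ≤ √(‖x - y‖ ^ 2 + e ^ 2) * ((1 + R) / e + 1) := by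
    have : 1 + R ≤ √(‖x - y‖ ^ 2 + e ^ 2) * ((1 + R) / e) := by
      calc 1 + R = e * ((1 + R) / e) := by field_simp
        _ ≤ _ := by gcongr
    nlinarith
  calc (1 + ‖x‖) ^ 2 ≤ (√(‖x - y‖ ^ 2 + e ^ 2) * ((1 + R) / e + 1)) ^ 2 := by gcongr
    _ = _ := by rw [mul_pow, Real.sq_sqrt (by positivity)]

/-- The factor e² is the Jacobian of a planar dilation: `del e` is the mass-preserving rescaling of
`del 1`. -/
theorem del_smul {e : ℝ} (he : 0 < e) (v : Plane) : e ^ 2 * del e (e • v) = del 1 v := by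
  rw [del, del, norm_smul, Real.norm_eq_abs, abs_of_pos he]
  have h1 : (e * ‖v‖) ^ 2 + e ^ 2 = e ^ 2 * (‖v‖ ^ 2 + 1 ^ 2) := by ring
  rw [h1]
  have : ‖v‖ ^ 2 + 1 ^ 2 ≠ 0 := by positivity
  field_simp

/-- In polar coordinates the radial integrand has the primitive −1/(2π(r² + 1)), and the angular
factor is twice the area of the unit disc. -/
theorem integral_del_one : ∫ v, del 1 v = 1 := by
  have h1 : ∀ v : Plane, del 1 v = (fun r : ℝ => π⁻¹ * (1 ^ 2 * ((r ^ 2 + 1 ^ 2) ^ 2)⁻¹)) ‖v‖ :=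
    fun v => rfl
  simp_rw [h1]
  rw [integral_fun_norm_addHaar volume (fun r : ℝ => π⁻¹ * (1 ^ 2 * ((r ^ 2 + 1 ^ 2) ^ 2)⁻¹))]
  have hvol : (volume : Measure Plane).real (ball 0 1) = π := by
    rw [Measure.real, EuclideanSpace.volume_ball_fin_two]
    simp [Real.pi_pos.le]
  rw [hvol, finrank_euclideanSpace_fin]
  have hd : ∀ r ∈ Ici (0 : ℝ), HasDerivAt (fun r : ℝ => -((2 * π)⁻¹ * (r ^ 2 + 1)⁻¹))
      (r ^ (2 - 1) • (π⁻¹ * (1 ^ 2 * ((r ^ 2 + 1 ^ 2) ^ 2)⁻¹))) r := by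
    intro r _
    have h0 : r ^ 2 + 1 ≠ 0 := by positivity
    have h1 : HasDerivAt (fun r : ℝ => r ^ 2 + 1) (2 * r) r := by
      simpa using (hasDerivAt_pow 2 r).add_const 1
    have h2 := ((h1.inv h0).const_mul (2 * π)⁻¹).neg
    refine h2.congr_deriv ?_
    simp only [smul_eq_mul]
    norm_num
    field_simp
  have hlim : Tendsto (fun r : ℝ => -((2 * π)⁻¹ * (r ^ 2 + 1)⁻¹)) atTop (𝓝 0) := by
    have h1 : Tendsto (fun r : ℝ => r ^ 2 + 1) atTop atTop :=
      tendsto_atTop_add_const_right _ _ (tendsto_pow_atTop two_ne_zero)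
    simpa using (h1.inv_tendsto_atTop.const_mul (2 * π)⁻¹).neg
  have hint := integral_Ioi_of_hasDerivAt_of_nonneg' hd (fun r hr => by
    have : (0 : ℝ) < r := hr
    simp only [smul_eq_mul]
    positivity) hlim
  rw [hint]
  simp

/-- A nonintegrable function has Bochner integral 0, so the value 1 already proves integrability. -/
theorem integrable_del_one : Integrable (del 1) := by
  by_contra h
  have := integral_del_one
  rw [integral_undef h] at this
  exact zero_ne_one this

/-- Half of the mass of the approximate identity lies in a half plane. -/
theorem setIntegral_del_one_halfPlane {n : Plane} (hn : n ≠ 0) :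
    ∫ v in {v | inner ℝ n v < 0}, del 1 v = 1 / 2 := by
  have hm1 : MeasurableSet {v : Plane | inner ℝ n v < 0} :=
    measurableSet_lt (by fun_prop) measurable_const
  have hm2 : MeasurableSet {v : Plane | 0 < inner ℝ n v} :=
    measurableSet_lt measurable_const (by fun_prop)
  -- The map v ↦ −v exchanges the two open half planes and preserves `del 1`. The line between them
  -- is null, so each carries half of the mass.
  have hsymm : ∫ v in {v | inner ℝ n v < 0}, del 1 v = ∫ v in {v | 0 < inner ℝ n v}, del 1 v := by
    rw [← integral_indicator hm1, ← integral_indicator hm2, ← integral_neg_eq_self]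
    refine integral_congr_ae (Filter.Eventually.of_forall fun v => ?_)
    simp only [indicator, mem_ofPred_eq, inner_neg_right, neg_lt_zero, del, norm_neg]
  have hnull : volume {v : Plane | inner ℝ n v = 0} = 0 := by
    have h1 : {v : Plane | inner ℝ n v = 0} = ((innerSL ℝ n).ker : Set Plane) := by
      ext v; simp
    rw [h1]
    refine Measure.addHaar_submodule _ _ fun h => hn ?_
    have : n ∈ (innerSL ℝ n).ker := by rw [h]; trivial
    simpa using this
  have hsum : ∫ v, del 1 v = (∫ v in {v | inner ℝ n v < 0}, del 1 v) +
      ∫ v in {v | 0 < inner ℝ n v}, del 1 v := by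
    rw [← integral_add_compl hm1 integrable_del_one]
    congr 1
    refine setIntegral_congr_set ?_
    have : ∀ᵐ v : Plane, inner ℝ n v ≠ 0 := by
      rw [ae_iff]; simpa using hnull
    filter_upwards [this] with v hv
    have : (v ∈ {v | inner ℝ n v < 0}ᶜ) = (v ∈ {v : Plane | 0 < inner ℝ n v}) := by
      simp only [mem_compl_iff, mem_ofPred_eq, not_lt, eq_iff_iff]
      exact ⟨fun h => lt_of_le_of_ne h (Ne.symm hv), le_of_lt⟩
    exact this
  rw [integral_del_one, ← hsymm] at hsum
  linarith

/-- `log` is Hölder continuous of exponent `1/2`, with a constant blowing up at the origin. -/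
theorem abs_log_sub_log_le {a b : ℝ} (ha : 0 < a) (hb : 0 < b) :
    |Real.log a - Real.log b| ≤ 2 * √|a - b| * ((√a)⁻¹ + (√b)⁻¹) := by
  have hlog : ∀ s t : ℝ, 0 < s → 0 < t → t ≤ s →
      |Real.log s - Real.log t| ≤ 2 * √|s - t| * ((√s)⁻¹ + (√t)⁻¹) := by
    intro s t hs ht hts
    have h0 : Real.log t ≤ Real.log s := Real.log_le_log ht hts
    rw [abs_of_nonneg (by linarith), abs_of_nonneg (by linarith : 0 ≤ s - t),
      ← Real.log_div hs.ne' ht.ne']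
    have h1 : √(s / t) ≤ 1 + √((s - t) / t) := by
      rw [Real.sqrt_le_left (by positivity)]
      have h2 : 0 ≤ (s - t) / t := div_nonneg (by linarith) ht.le
      have h3 := Real.sq_sqrt h2
      have h4 : s / t = 1 + (s - t) / t := by field_simp; ring
      nlinarith [Real.sqrt_nonneg ((s - t) / t)]
    have h2 : Real.log (s / t) = 2 * Real.log √(s / t) := by
      rw [Real.log_sqrt (by positivity)]; ring
    have h3 := Real.log_le_sub_one_of_pos (Real.sqrt_pos.2 (div_pos hs ht))
    have h4 : √((s - t) / t) = √(s - t) * (√t)⁻¹ := by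
      rw [Real.sqrt_div (by linarith), div_eq_mul_inv]
    have h5 : 0 ≤ √(s - t) * (√s)⁻¹ := by positivity
    rw [h2]
    nlinarith
  rcases le_total b a with h | h
  · exact hlog a b ha hb h
  · rw [abs_sub_comm, abs_sub_comm a b, add_comm]
    exact hlog b a hb ha h

theorem gam_eq_log_sqrt {e : ℝ} (x : Plane) :
    gam e x = (2 * π)⁻¹ * Real.log √(‖x‖ ^ 2 + e ^ 2) := by
  rw [gam, Real.log_sqrt (by positivity)]
  ring

/-- A bound free of e. With a = √(‖x‖² + e²), the inequality log t ≤ t − 1 at t = a controls the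
logarithm from above, and at t = a^(−1/2) from below. -/
theorem abs_gam_le {e : ℝ} (he : 0 < e) (he1 : e ≤ 1) {x : Plane} (hx : x ≠ 0) :
    |gam e x| ≤ ‖x‖ + 1 + (√‖x‖)⁻¹ := by
  rw [gam_eq_log_sqrt]
  have hx0 : 0 < ‖x‖ := norm_pos_iff.2 hx
  set a := √(‖x‖ ^ 2 + e ^ 2) with ha
  have ha1 : ‖x‖ ≤ a := Real.le_sqrt_of_sq_le (by nlinarith)
  have ha2 : a ≤ ‖x‖ + 1 := by
    rw [ha, Real.sqrt_le_left (by positivity)]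
    nlinarith
  have ha0 : 0 < a := hx0.trans_le ha1
  have hpi := Real.pi_gt_three
  have h1 : Real.log a ≤ a := (Real.log_le_sub_one_of_pos ha0).trans (by linarith)
  have h2 : -Real.log a ≤ 2 * (√a)⁻¹ := by
    have h3 : -Real.log a = 2 * Real.log (√a)⁻¹ := by
      rw [Real.log_inv, Real.log_sqrt ha0.le]; ring
    have h4 := Real.log_le_sub_one_of_pos (inv_pos.2 (Real.sqrt_pos.2 ha0))
    linarith
  have h3 : (√a)⁻¹ ≤ (√‖x‖)⁻¹ := by gcongr
  have h4 : |Real.log a| ≤ 2 * (‖x‖ + 1 + (√‖x‖)⁻¹) := by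
    have h5 : 0 < (√‖x‖)⁻¹ := by positivity
    rw [abs_le]
    constructor <;> linarith
  rw [abs_mul, abs_of_pos (by positivity : 0 < (2 * π)⁻¹)]
  have h5 : (2 * π)⁻¹ ≤ 1 / 2 := by
    rw [inv_le_comm₀ (by positivity) (by positivity)]; linarith
  calc (2 * π)⁻¹ * |Real.log a| ≤ 1 / 2 * (2 * (‖x‖ + 1 + (√‖x‖)⁻¹)) := by gcongr
    _ = _ := by ring

/-- The two points are allowed to differ because blow-ups use x = z + e•v. The factor √(‖x − z‖ + e)
then tends to 0, while the other one is integrable in y uniformly in x and z. -/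
theorem abs_gam_sub_log_le {e : ℝ} (he : 0 < e) {x z y : Plane} (hxy : x ≠ y) (hzy : z ≠ y) :
    |gam e (x - y) - (2 * π)⁻¹ * Real.log ‖z - y‖| ≤
      √(‖x - z‖ + e) * ((√‖x - y‖)⁻¹ + (√‖z - y‖)⁻¹) := by
  rw [gam_eq_log_sqrt]
  have hx0 : 0 < ‖x - y‖ := norm_pos_iff.2 (sub_ne_zero.2 hxy)
  have hz0 : 0 < ‖z - y‖ := norm_pos_iff.2 (sub_ne_zero.2 hzy)
  set a := √(‖x - y‖ ^ 2 + e ^ 2) with ha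
  have ha1 : ‖x - y‖ ≤ a := Real.le_sqrt_of_sq_le (by nlinarith)
  have ha2 : a ≤ ‖x - y‖ + e := by
    rw [ha, Real.sqrt_le_left (by positivity)]
    nlinarith
  have ha0 : 0 < a := hx0.trans_le ha1
  have hpi := Real.pi_gt_three
  have h1 := abs_log_sub_log_le ha0 hz0
  have h2 : |a - ‖z - y‖| ≤ ‖x - z‖ + e := by
    have h3 : |‖x - y‖ - ‖z - y‖| ≤ ‖x - z‖ := by
      have := abs_norm_sub_norm_le (x - y) (z - y)
      rwa [sub_sub_sub_cancel_right] at this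
    rw [abs_le] at h3 ⊢
    constructor <;> linarith
  have h5 : (2 * π)⁻¹ ≤ 1 / 2 := by
    rw [inv_le_comm₀ (by positivity) (by positivity)]; linarith
  rw [← mul_sub, abs_mul, abs_of_pos (by positivity : 0 < (2 * π)⁻¹)]
  calc (2 * π)⁻¹ * |Real.log a - Real.log ‖z - y‖|
      ≤ 1 / 2 * (2 * √|a - ‖z - y‖| * ((√a)⁻¹ + (√‖z - y‖)⁻¹)) := by gcongr
    _ = √|a - ‖z - y‖| * ((√a)⁻¹ + (√‖z - y‖)⁻¹) := by ring
    _ ≤ _ := by gcongr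

end CGPT
end

/-! ### Smoothed potentials of bounded densities. -/

noncomputable section
namespace CGPT
open MeasureTheory Set Filter Topology Metric
open scoped ENNReal NNReal ContDiff Real

/-- `φ` is a bounded measurable function on the boundary of `D`. -/
structure IsBoundedDensity (D : Set Plane) (φ : Plane → ℝ) : Prop where
  aestronglyMeasurable : AEStronglyMeasurable φ (arcLength D)
  exists_bound : ∃ M : ℝ, 0 ≤ M ∧ ∀ᵐ y ∂(arcLength D), |φ y| ≤ M

/-- The smoothed single layer potential. -/
def smoothU (e : ℝ) (D : Set Plane) (φ : Plane → ℝ) (x : Plane) : ℝ :=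
  ∫ y, φ y • gam e (x - y) ∂(arcLength D)

/-- The gradient of the smoothed single layer potential. -/
def smoothX (e : ℝ) (D : Set Plane) (φ : Plane → ℝ) (x : Plane) : Plane :=
  ∫ y, φ y • ker e (x - y) ∂(arcLength D)

/-- The Laplacian of the smoothed single layer potential. -/
def smoothDel (e : ℝ) (D : Set Plane) (φ : Plane → ℝ) (x : Plane) : ℝ :=
  ∫ y, φ y * del e (x - y) ∂(arcLength D)

/-- The single layer potential. -/
def singleLayer (D : Set Plane) (φ : Plane → ℝ) (x : Plane) : ℝ :=
  ∫ y, φ y * ((2 * π)⁻¹ * Real.log ‖x - y‖) ∂(arcLength D)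

theorem ae_ne_arcLength (D : Set Plane) (x : Plane) : ∀ᵐ y ∂(arcLength D), x ≠ y := by
  have h := Measure.nullSingletonClass_hausdorff Plane one_pos
  have h1 : ∀ᵐ y ∂(Measure.hausdorffMeasure 1 : Measure Plane), y ≠ x := by
    rw [ae_iff]
    simp
  filter_upwards [ae_restrict_of_ae h1] with y hy using hy.symm

namespace IsBoundedC2Domain
variable {D : Set Plane}

theorem exists_norm_le (hD : IsBoundedC2Domain D) :
    ∃ R : ℝ, 0 ≤ R ∧ ∀ z ∈ frontier D, ‖z‖ ≤ R := by
  obtain ⟨R, hR⟩ := hD.isCompact_frontier.isBounded.exists_norm_le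
  exact ⟨max R 0, le_max_right _ _, fun z hz => (hR z hz).trans (le_max_left _ _)⟩

theorem exists_integral_inv_sqrt_le (hD : IsBoundedC2Domain D) : ∃ A : ℝ, 0 ≤ A ∧
    ∀ x : Plane, Integrable (fun y => (√‖x - y‖)⁻¹) (arcLength D) ∧
      ∫ y, (√‖x - y‖)⁻¹ ∂(arcLength D) ≤ A := by
  obtain ⟨A, hA, h⟩ := hD.exists_lintegral_inv_sqrt_le
  refine ⟨A.toReal, ENNReal.toReal_nonneg, fun x => ?_⟩
  have hm : AEStronglyMeasurable (fun y => (√‖x - y‖)⁻¹) (arcLength D) := by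
    have : Measurable fun y : Plane => (√‖x - y‖)⁻¹ :=
      (Real.continuous_sqrt.comp (continuous_const.sub continuous_id).norm).measurable.inv
    exact this.aestronglyMeasurable
  have hle : ∫⁻ y, ENNReal.ofReal (√‖x - y‖)⁻¹ ∂(arcLength D) ≤ A := by
    refine (lintegral_mono fun y => ENNReal.ofReal_le_ofReal ?_).trans (h x)
    linarith
  constructor
  · refine ⟨hm, ?_⟩
    rw [hasFiniteIntegral_iff_ofReal (Filter.Eventually.of_forall fun y => by positivity)]
    exact hle.trans_lt hA
  · rw [integral_eq_lintegral_of_nonneg_ae (Filter.Eventually.of_forall fun y => by positivity) hm]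
    exact ENNReal.toReal_mono hA.ne hle

end IsBoundedC2Domain

namespace IsBoundedDensity
variable {D : Set Plane} {φ : Plane → ℝ}

theorem integrable_smul (hφ : IsBoundedDensity D φ) {E : Type*} [NormedAddCommGroup E]
    [NormedSpace ℝ E] {g : Plane → E} (hg : Integrable g (arcLength D)) :
    Integrable (fun y => φ y • g y) (arcLength D) := by
  obtain ⟨M, -, hM⟩ := hφ.exists_bound
  exact hg.bdd_smul M hφ.aestronglyMeasurable hM

theorem integrable (hφ : IsBoundedDensity D φ) (hD : IsBoundedC2Domain D) :
    Integrable φ (arcLength D) := by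
  simpa using hφ.integrable_smul (hD.integrable_of_continuous (continuous_const (y := (1 : ℝ))))

theorem norm_integral_smul_le {M : ℝ}
    (hM : ∀ᵐ y ∂(arcLength D), |φ y| ≤ M) {E : Type*}
    [NormedAddCommGroup E] [NormedSpace ℝ E] {g : Plane → E} {b : Plane → ℝ}
    (hb : Integrable b (arcLength D)) (hgb : ∀ᵐ y ∂(arcLength D), ‖g y‖ ≤ b y) :
    ‖∫ y, φ y • g y ∂(arcLength D)‖ ≤ M * ∫ y, b y ∂(arcLength D) := by
  rw [← integral_const_mul]
  refine norm_integral_le_of_norm_le (hb.const_mul M) ?_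
  filter_upwards [hM, hgb] with y h1 h2
  rw [norm_smul]
  have := (abs_nonneg (φ y)).trans h1
  exact mul_le_mul h1 h2 (norm_nonneg _) this

theorem hasFDerivAt_potential (hφ : IsBoundedDensity D φ) (hD : IsBoundedC2Domain D) {E : Type*}
    [NormedAddCommGroup E] [NormedSpace ℝ E] [CompleteSpace E] [FiniteDimensional ℝ E]
    {F : Plane → E} (hF : ContDiff ℝ 1 F) {C : ℝ} (hC : ∀ x, ‖fderiv ℝ F x‖ ≤ C) (x : Plane) :
    HasFDerivAt (fun x => ∫ y, φ y • F (x - y) ∂(arcLength D))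
      (∫ y, φ y • fderiv ℝ F (x - y) ∂(arcLength D)) x := by
  have := hD.isFiniteMeasure_arcLength
  obtain ⟨M, hM0, hM⟩ := hφ.exists_bound
  have hcF := hF.continuous
  have hcF' := hF.continuous_fderiv one_ne_zero
  refine hasFDerivAt_integral_of_dominated_of_fderiv_le (𝕜 := ℝ) (bound := fun _ => M * C)
    (F := fun x y => φ y • F (x - y)) (F' := fun x y => φ y • fderiv ℝ F (x - y))
    (s := univ) univ_mem ?_ ?_ ?_ ?_ ?_ ?_
  · refine Filter.Eventually.of_forall fun z => (hφ.integrable_smul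
      (hD.integrable_of_continuous ?_)).aestronglyMeasurable
    fun_prop
  · exact hφ.integrable_smul (hD.integrable_of_continuous (by fun_prop))
  · exact (hφ.integrable_smul (hD.integrable_of_continuous (by fun_prop))).aestronglyMeasurable
  · filter_upwards [hM] with y hy z _
    rw [norm_smul]
    exact mul_le_mul hy (hC _) (norm_nonneg _) hM0
  · exact integrable_const _
  · refine Filter.Eventually.of_forall fun y z _ => ?_
    have h1 : HasFDerivAt F (fderiv ℝ F (z - y)) (z - y) :=
      (hF.differentiable one_ne_zero _).hasFDerivAt
    have h2 : HasFDerivAt (fun z => z - y) (ContinuousLinearMap.id ℝ Plane) z :=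
      (hasFDerivAt_id z).sub_const y
    exact (h1.comp z h2).const_smul (φ y)

theorem continuous_potential (hφ : IsBoundedDensity D φ) (hD : IsBoundedC2Domain D) {E : Type*}
    [NormedAddCommGroup E] [NormedSpace ℝ E]
    {F : Plane → E} (hF : Continuous F) {C : ℝ} (hC : ∀ x, ‖F x‖ ≤ C) :
    Continuous fun x => ∫ y, φ y • F (x - y) ∂(arcLength D) := by
  have := hD.isFiniteMeasure_arcLength
  obtain ⟨M, hM0, hM⟩ := hφ.exists_bound
  refine continuous_of_dominated (bound := fun _ => M * C) ?_ ?_ (integrable_const _) ?_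
  · exact fun x => (hφ.integrable_smul
      (hD.integrable_of_continuous (by fun_prop))).aestronglyMeasurable
  · intro x
    filter_upwards [hM] with y hy
    rw [norm_smul]
    exact mul_le_mul hy (hC _) (norm_nonneg _) hM0
  · refine Filter.Eventually.of_forall fun y => ?_
    fun_prop

theorem contDiff_potential (hφ : IsBoundedDensity D φ) (hD : IsBoundedC2Domain D) {E : Type*}
    [NormedAddCommGroup E] [NormedSpace ℝ E] [CompleteSpace E] [FiniteDimensional ℝ E]
    {F : Plane → E} (hF : ContDiff ℝ 1 F) {C : ℝ} (hC : ∀ x, ‖fderiv ℝ F x‖ ≤ C) :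
    ContDiff ℝ 1 fun x => ∫ y, φ y • F (x - y) ∂(arcLength D) := by
  rw [contDiff_one_iff_fderiv]
  refine ⟨fun x => (hφ.hasFDerivAt_potential hD hF hC x).differentiableAt, ?_⟩
  have : fderiv ℝ (fun x => ∫ y, φ y • F (x - y) ∂(arcLength D)) =
      fun x => ∫ y, φ y • fderiv ℝ F (x - y) ∂(arcLength D) := by
    ext1 x
    exact (hφ.hasFDerivAt_potential hD hF hC x).fderiv
  rw [this]
  exact hφ.continuous_potential hD (hF.continuous_fderiv one_ne_zero) hC

end IsBoundedDensity

theorem norm_fderiv_gam_le {e : ℝ} (he : 0 < e) (x : Plane) : ‖fderiv ℝ (gam e) x‖ ≤ e⁻¹ := by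
  refine ContinuousLinearMap.opNorm_le_bound _ (by positivity) fun v => ?_
  rw [fderiv_gam he]
  refine (norm_inner_le_norm _ _).trans ?_
  gcongr
  exact norm_ker_le he x

theorem norm_fderiv_ker_le' {e : ℝ} (he : 0 < e) (x : Plane) :
    ‖fderiv ℝ (ker e) x‖ ≤ (e ^ 2)⁻¹ := by
  refine (norm_fderiv_ker_le he x).trans ?_
  gcongr
  nlinarith [sq_nonneg ‖x‖]

theorem continuous_ker {e : ℝ} (he : 0 < e) : Continuous (ker e) := (contDiff_ker he).continuous

namespace IsBoundedDensity
variable {D : Set Plane} {φ : Plane → ℝ}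

theorem contDiff_smoothU (hφ : IsBoundedDensity D φ) (hD : IsBoundedC2Domain D) {e : ℝ}
    (he : 0 < e) : ContDiff ℝ 1 (smoothU e D φ) :=
  hφ.contDiff_potential hD ((contDiff_gam he).of_le (by norm_num)) (norm_fderiv_gam_le he)

theorem contDiff_smoothX (hφ : IsBoundedDensity D φ) (hD : IsBoundedC2Domain D) {e : ℝ}
    (he : 0 < e) : ContDiff ℝ 1 (smoothX e D φ) :=
  hφ.contDiff_potential hD ((contDiff_ker he).of_le (by norm_num)) (norm_fderiv_ker_le' he)

theorem integrable_ker (hφ : IsBoundedDensity D φ) (hD : IsBoundedC2Domain D) {e : ℝ}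
    (he : 0 < e) (x : Plane) : Integrable (fun y => φ y • ker e (x - y)) (arcLength D) := by
  have := continuous_ker he
  exact hφ.integrable_smul (hD.integrable_of_continuous (by fun_prop))

theorem fderiv_smoothU (hφ : IsBoundedDensity D φ) (hD : IsBoundedC2Domain D) {e : ℝ}
    (he : 0 < e) (x v : Plane) :
    fderiv ℝ (smoothU e D φ) x v = inner ℝ (smoothX e D φ x) v := by
  have hc : ContDiff ℝ 1 (gam e) := (contDiff_gam he).of_le (by norm_num)
  have hc' := hc.continuous_fderiv one_ne_zero
  have h1 : fderiv ℝ (smoothU e D φ) x = _ :=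
    (hφ.hasFDerivAt_potential hD hc (norm_fderiv_gam_le he) x).fderiv
  rw [h1, ContinuousLinearMap.integral_apply
    (hφ.integrable_smul (hD.integrable_of_continuous (by fun_prop))), smoothX, real_inner_comm,
    ← integral_inner (hφ.integrable_ker hD he x)]
  refine integral_congr_ae (Filter.Eventually.of_forall fun y => ?_)
  simp only [smul_apply, smul_eq_mul]
  rw [fderiv_gam he, inner_smul_right, real_inner_comm]

theorem div_smoothX (hφ : IsBoundedDensity D φ) (hD : IsBoundedC2Domain D) {e : ℝ}
    (he : 0 < e) (x : Plane) : div (smoothX e D φ) x = smoothDel e D φ x := by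
  have hc : ContDiff ℝ 1 (ker e) := (contDiff_ker he).of_le (by norm_num)
  have hc' := hc.continuous_fderiv one_ne_zero
  have h1 : fderiv ℝ (smoothX e D φ) x = _ :=
    (hφ.hasFDerivAt_potential hD hc (norm_fderiv_ker_le' he) x).fderiv
  have hint : Integrable (fun y => φ y • fderiv ℝ (ker e) (x - y)) (arcLength D) :=
    hφ.integrable_smul (hD.integrable_of_continuous (by fun_prop))
  have hi : ∀ i : Fin 2, (fderiv ℝ (smoothX e D φ) x (EuclideanSpace.single i 1)) i =
      ∫ y, φ y * (fderiv ℝ (ker e) (x - y) (EuclideanSpace.single i 1)) i ∂(arcLength D) := by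
    intro i
    rw [h1, ContinuousLinearMap.integral_apply hint]
    have := (EuclideanSpace.proj i : Plane →L[ℝ] ℝ).integral_comp_comm
      (hint.apply_continuousLinearMap (EuclideanSpace.single i 1))
    exact this.symm
  rw [div]
  simp_rw [hi]
  rw [← integral_finsetSum]
  · rw [smoothDel]
    refine integral_congr_ae (Filter.Eventually.of_forall fun y => ?_)
    simp only
    rw [← Finset.mul_sum, ← div_ker he, div]
  · intro i _
    exact hφ.integrable_smul (hD.integrable_of_continuous (by fun_prop))

/-- The constant does not depend on e, so this serves as a dominating function in the limits e → 0.
-/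
theorem exists_abs_smoothU_le (hφ : IsBoundedDensity D φ) (hD : IsBoundedC2Domain D) :
    ∃ C : ℝ, 0 ≤ C ∧ ∀ e ∈ Ioc (0 : ℝ) 1, ∀ x, |smoothU e D φ x| ≤ C * (1 + ‖x‖) := by
  have := hD.isFiniteMeasure_arcLength
  obtain ⟨M, hM0, hM⟩ := hφ.exists_bound
  obtain ⟨R, hR0, hR⟩ := hD.exists_norm_le
  obtain ⟨A, hA0, hA⟩ := hD.exists_integral_inv_sqrt_le
  set s := (arcLength D).real univ
  have hs : 0 ≤ s := measureReal_nonneg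
  refine ⟨M * ((R + 1) * s + A), by positivity, fun e he x => ?_⟩
  have hb : Integrable (fun y => (‖x‖ + R + 1) + (√‖x - y‖)⁻¹) (arcLength D) :=
    (integrable_const _).add (hA x).1
  have h1 := norm_integral_smul_le hM (g := fun y => gam e (x - y)) hb ?_
  · rw [integral_add (integrable_const _) (hA x).1, integral_const, smul_eq_mul] at h1
    refine h1.trans ?_
    rw [mul_assoc]
    have h2 := (hA x).2
    have h3 := norm_nonneg x
    gcongr
    nlinarith [mul_nonneg (mul_nonneg hs h3) hR0, mul_nonneg hA0 h3]
  · filter_upwards [ae_mem_frontier D, ae_ne_arcLength D x] with y hy hne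
    refine (abs_gam_le he.1 he.2 (sub_ne_zero.2 hne)).trans ?_
    have := norm_sub_le x y
    have := hR y hy
    gcongr
    linarith

theorem integrable_log (hφ : IsBoundedDensity D φ) (hD : IsBoundedC2Domain D) (x : Plane) :
    Integrable (fun y => φ y * ((2 * π)⁻¹ * Real.log ‖x - y‖)) (arcLength D) := by
  have := hD.isFiniteMeasure_arcLength
  obtain ⟨A, hA0, hA⟩ := hD.exists_integral_inv_sqrt_le
  have hc := (contDiff_gam one_pos).continuous
  refine hφ.integrable_smul ?_
  have h1 : Integrable (fun y => |gam 1 (x - y)| + √(‖x - x‖ + 1) *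
      ((√‖x - y‖)⁻¹ + (√‖x - y‖)⁻¹)) (arcLength D) :=
    (hD.integrable_of_continuous (by fun_prop)).add (((hA x).1.add (hA x).1).const_mul _)
  refine h1.mono' ?_ ?_
  · have : Measurable fun y : Plane => (2 * π)⁻¹ * Real.log ‖x - y‖ := by fun_prop
    exact this.aestronglyMeasurable
  · filter_upwards [ae_ne_arcLength D x] with y hy
    have h2 := abs_gam_sub_log_le one_pos hy hy
    rw [abs_sub_comm] at h2
    have h3 := abs_add_le (gam 1 (x - y)) ((2 * π)⁻¹ * Real.log ‖x - y‖ - gam 1 (x - y))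
    rw [add_sub_cancel] at h3
    rw [Real.norm_eq_abs]
    linarith

/-- The smoothed single layer potentials converge locally uniformly. -/
theorem tendsto_smoothU (hφ : IsBoundedDensity D φ) (hD : IsBoundedC2Domain D) (z v : Plane) :
    Tendsto (fun e : ℝ => smoothU e D φ (z + e • v)) (𝓝[>] 0) (𝓝 (singleLayer D φ z)) := by
  obtain ⟨M, hM0, hM⟩ := hφ.exists_bound
  obtain ⟨A, hA0, hA⟩ := hD.exists_integral_inv_sqrt_le
  rw [tendsto_iff_norm_sub_tendsto_zero]
  have hlim : Tendsto (fun e : ℝ => M * (√(‖e • v‖ + e) * (A + A))) (𝓝[>] 0) (𝓝 0) := by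
    have h1 : Continuous fun e : ℝ => M * (√(‖e • v‖ + e) * (A + A)) := by fun_prop
    have h2 := h1.tendsto 0
    simp only [zero_smul, norm_zero, add_zero, Real.sqrt_zero, zero_mul, mul_zero] at h2
    exact h2.mono_left nhdsWithin_le_nhds
  refine squeeze_zero' (Filter.Eventually.of_forall fun _ => norm_nonneg _) ?_ hlim
  filter_upwards [self_mem_nhdsWithin] with e (he : 0 < e)
  have hc := (contDiff_gam he).continuous
  have hint : Integrable (fun y => √(‖z + e • v - z‖ + e) *
      ((√‖z + e • v - y‖)⁻¹ + (√‖z - y‖)⁻¹)) (arcLength D) :=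
    ((hA _).1.add (hA z).1).const_mul _
  have h1 := norm_integral_smul_le hM
    (g := fun y => gam e (z + e • v - y) - (2 * π)⁻¹ * Real.log ‖z - y‖) hint ?_
  · rw [integral_const_mul, integral_add (hA _).1 (hA z).1, add_sub_cancel_left] at h1
    have h2 : smoothU e D φ (z + e • v) - singleLayer D φ z =
        ∫ y, φ y • (gam e (z + e • v - y) - (2 * π)⁻¹ * Real.log ‖z - y‖) ∂(arcLength D) := by
      rw [smoothU, singleLayer, ← integral_sub (hφ.integrable_smul
        (hD.integrable_of_continuous (by fun_prop))) (hφ.integrable_log hD z)]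
      refine integral_congr_ae (Filter.Eventually.of_forall fun y => ?_)
      simp only [smul_eq_mul]
      ring
    rw [h2]
    refine h1.trans ?_
    gcongr
    · exact (hA _).2
    · exact (hA _).2
  · filter_upwards [ae_ne_arcLength D z, ae_ne_arcLength D (z + e • v)] with y h1 h2
    exact abs_gam_sub_log_le he h2 h1

theorem tendsto_smoothU' (hφ : IsBoundedDensity D φ) (hD : IsBoundedC2Domain D) (z : Plane) :
    Tendsto (fun e : ℝ => smoothU e D φ z) (𝓝[>] 0) (𝓝 (singleLayer D φ z)) := by
  simpa using hφ.tendsto_smoothU hD z 0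

/-- Measurability and the bound are inherited from the continuous smoothed potentials, of which this
is a pointwise limit. -/
theorem isBoundedDensity_singleLayer (hφ : IsBoundedDensity D φ) (hD : IsBoundedC2Domain D) :
    IsBoundedDensity D (singleLayer D φ) := by
  constructor
  · have hs : Tendsto (fun n : ℕ => 1 / ((n : ℝ) + 1)) atTop (𝓝[>] 0) :=
      tendsto_nhdsWithin_iff.2 ⟨tendsto_one_div_add_atTop_nhds_zero_nat,
        Filter.Eventually.of_forall fun n => by
          rw [mem_Ioi]; positivity⟩
    refine aestronglyMeasurable_of_tendsto_ae atTop
      (f := fun n : ℕ => smoothU (1 / ((n : ℝ) + 1)) D φ) (fun n => ?_)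
      (Filter.Eventually.of_forall fun z => (hφ.tendsto_smoothU' hD z).comp hs)
    exact (hφ.contDiff_smoothU hD (by positivity)).continuous.aestronglyMeasurable
  · obtain ⟨C, hC0, hC⟩ := hφ.exists_abs_smoothU_le hD
    obtain ⟨R, hR0, hR⟩ := hD.exists_norm_le
    refine ⟨C * (1 + R), by positivity, ?_⟩
    filter_upwards [ae_mem_frontier D] with z hz
    refine le_of_tendsto (hφ.tendsto_smoothU' hD z).abs ?_
    filter_upwards [Ioc_mem_nhdsGT one_pos] with e he
    refine (hC e he z).trans ?_
    have := hR z hz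
    gcongr

end IsBoundedDensity
end CGPT
end

/-! ### Concentration of the smoothed Laplacian and the Neumann–Poincaré kernel. -/

noncomputable section
namespace CGPT
open MeasureTheory Set Filter Topology Metric
open scoped ENNReal NNReal ContDiff Real

/-- Against a function of linear growth the fourth-power decay leaves (1 + ‖x‖)⁻³, which is
integrable in the plane. -/
theorem del_sub_le {e : ℝ} (he : 0 < e) {R : ℝ} (hR : 0 ≤ R) {x y : Plane} (hy : ‖y‖ ≤ R) :
    del e (x - y) ≤ π⁻¹ * (e ^ 2 * ((1 + R) / e + 1) ^ 4) * ((1 + ‖x‖) ^ 4)⁻¹ := by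
  have h := inv_norm_sub_sq_le he hR (x := x) hy
  have h2 : ((‖x - y‖ ^ 2 + e ^ 2)⁻¹) ^ 2 ≤ (((1 + R) / e + 1) ^ 2 * ((1 + ‖x‖) ^ 2)⁻¹) ^ 2 := by
    gcongr
  rw [del, ← inv_pow]
  calc π⁻¹ * (e ^ 2 * (‖x - y‖ ^ 2 + e ^ 2)⁻¹ ^ 2)
      ≤ π⁻¹ * (e ^ 2 * (((1 + R) / e + 1) ^ 2 * ((1 + ‖x‖) ^ 2)⁻¹) ^ 2) := by gcongr
    _ = _ := by
      rw [mul_pow, ← pow_mul, inv_pow, ← pow_mul]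
      ring

theorem integrable_inv_one_add_norm_pow :
    Integrable (fun x : Plane => ((1 + ‖x‖) ^ 3)⁻¹) := by
  have h := integrable_one_add_norm (E := Plane) (μ := volume) (r := 3) (by simp; norm_num)
  refine h.congr (Filter.Eventually.of_forall fun x => ?_)
  have h0 : 0 ≤ 1 + ‖x‖ := by positivity
  simp only
  rw [Real.rpow_neg h0]
  norm_cast

theorem one_add_norm_mul_inv_pow_four (x : Plane) :
    (1 + ‖x‖) * ((1 + ‖x‖) ^ 4)⁻¹ = ((1 + ‖x‖) ^ 3)⁻¹ := by
  have h0 : 1 + ‖x‖ ≠ 0 := by positivity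
  field_simp

theorem integrable_one_add_norm_mul_del : Integrable fun v : Plane => (1 + ‖v‖) * del 1 v := by
  have hc := continuous_del one_pos
  refine (integrable_inv_one_add_norm_pow.const_mul (π⁻¹ * (1 ^ 2 * ((1 + 0) / 1 + 1) ^ 4))).mono'
    (by fun_prop : Continuous fun v : Plane => (1 + ‖v‖) * del 1 v).aestronglyMeasurable
    (Filter.Eventually.of_forall fun v => ?_)
  rw [Real.norm_of_nonneg (mul_nonneg (by positivity) (del_nonneg v)),
    ← one_add_norm_mul_inv_pow_four, mul_left_comm]
  gcongr
  simpa using del_sub_le one_pos le_rfl (x := v) (y := 0) (by simp)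

/-- The substitution x = y + e•v trades the concentrating kernel for the fixed weight `del 1` and a
rescaled function. -/
theorem integral_mul_del_sub {e : ℝ} (he : 0 < e) (g : Plane → ℝ) (y : Plane) :
    ∫ x, g x * del e (x - y) = ∫ v, g (y + e • v) * del 1 v := by
  have h1 := integral_add_left_eq_self (μ := (volume : Measure Plane))
    (fun x => g x * del e (x - y)) y
  have h2 := Measure.integral_comp_smul (volume : Measure Plane)
    (fun x => g (y + x) * del e (y + x - y)) e
  rw [h1] at h2
  have h3 : |(e ^ Module.finrank ℝ Plane)⁻¹| = (e ^ 2)⁻¹ := by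
    rw [finrank_euclideanSpace_fin, abs_of_pos (by positivity)]
  rw [h3, smul_eq_mul] at h2
  have h4 : ∫ v, g (y + e • v) * del 1 v =
      e ^ 2 * ∫ v, g (y + e • v) * del e (y + e • v - y) := by
    rw [← integral_const_mul]
    congr 1
    ext v
    rw [← del_smul he, add_sub_cancel_left]
    ring
  rw [h4, h2]
  field_simp

/-- Integrals against the smoothed Laplacian of a single layer potential concentrate on the
boundary; `c` is the mass that the limiting blow-up of `A` receives at the boundary points. -/
theorem tendsto_integral_mul_smoothDel {D : Set Plane} (hD : IsBoundedC2Domain D) {A : Set Plane}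
    (hA : MeasurableSet A) {H : Plane → Set Plane} (hHm : ∀ z ∈ frontier D, MeasurableSet (H z))
    (hH : ∀ z ∈ frontier D, ∀ᵐ v, ∀ᶠ e in 𝓝[>] (0 : ℝ), (z + e • v ∈ A ↔ v ∈ H z)) {c : ℝ}
    (hc : ∀ z ∈ frontier D, ∫ v in H z, del 1 v = c) {w : ℝ → Plane → ℝ}
    (hw : ∀ e, 0 < e → Continuous (w e)) {C : ℝ} (hC : 0 ≤ C)
    (hwb : ∀ e ∈ Ioc (0 : ℝ) 1, ∀ x ∈ A, |w e x| ≤ C * (1 + ‖x‖)) {w0 : Plane → ℝ}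
    (hw0 : ∀ z ∈ frontier D, ∀ v, Tendsto (fun e => w e (z + e • v)) (𝓝[>] 0) (𝓝 (w0 z)))
    {ψ : Plane → ℝ} (hψ : IsBoundedDensity D ψ) :
    Tendsto (fun e => ∫ x in A, w e x * smoothDel e D ψ x) (𝓝[>] 0)
      (𝓝 (c * ∫ z, w0 z * ψ z ∂(arcLength D))) := by
  have := hD.isFiniteMeasure_arcLength
  obtain ⟨M, hM0, hM⟩ := hψ.exists_bound
  obtain ⟨R, hR0, hR⟩ := hD.exists_norm_le
  set J : ℝ → Plane → ℝ := fun e y => ∫ v, A.indicator (w e) (y + e • v) * del 1 v with hJ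
  have hind : ∀ e ∈ Ioc (0 : ℝ) 1, ∀ x, |A.indicator (w e) x| ≤ C * (1 + ‖x‖) := by
    intro e he x
    by_cases hx : x ∈ A
    · rw [indicator_of_mem hx]; exact hwb e he x hx
    · rw [indicator_of_notMem hx, abs_zero]; positivity
  have hindm : ∀ e, 0 < e → Measurable (A.indicator (w e)) := fun e he =>
    (hw e he).measurable.indicator hA
  -- Fubini brings the boundary integral outside. What remains, `J e y`, is the integral of w over
  -- the blow-up of A at y with weight `del 1`.
  have hfub : ∀ e ∈ Ioc (0 : ℝ) 1, ∫ x in A, w e x * smoothDel e D ψ x =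
      ∫ y, ψ y * J e y ∂(arcLength D) := by
    intro e he
    have hdc := continuous_del he.1
    rw [← integral_indicator hA]
    have h1 : ∀ x, A.indicator (fun x => w e x * smoothDel e D ψ x) x =
        ∫ y, ψ y * (A.indicator (w e) x * del e (x - y)) ∂(arcLength D) := by
      intro x
      by_cases hx : x ∈ A
      · simp only [indicator_of_mem hx]
        rw [smoothDel, ← integral_const_mul]
        refine integral_congr_ae (Filter.Eventually.of_forall fun y => ?_)
        simp only
        ring
      · simp [indicator_of_notMem hx]
    simp_rw [h1]
    rw [integral_integral_swap]
    · refine integral_congr_ae (Filter.Eventually.of_forall fun y => ?_)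
      simp only
      rw [integral_const_mul, integral_mul_del_sub he.1]
    · set K := π⁻¹ * (e ^ 2 * ((1 + R) / e + 1) ^ 4)
      have hb : Integrable (fun p : Plane × Plane => (M * (C * K)) * ((1 + ‖p.1‖) ^ 3)⁻¹)
          (volume.prod (arcLength D)) :=
        (integrable_inv_one_add_norm_pow.comp_fst (arcLength D)).const_mul _
      refine hb.mono' ?_ ?_
      · refine hψ.aestronglyMeasurable.comp_snd.mul (AEStronglyMeasurable.mul ?_ ?_)
        · exact ((hindm e he.1).comp measurable_fst).aestronglyMeasurable
        · exact (by fun_prop : Continuous fun p : Plane × Plane =>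
            del e (p.1 - p.2)).aestronglyMeasurable
      · have h2 : ∀ᵐ p ∂((volume : Measure Plane).prod (arcLength D)),
            |ψ p.2| ≤ M ∧ p.2 ∈ frontier D :=
          Measure.quasiMeasurePreserving_snd.ae (hM.and (ae_mem_frontier D))
        filter_upwards [h2] with p ⟨hp1, hp2⟩
        simp only [Function.uncurry]
        rw [norm_mul, norm_mul, Real.norm_eq_abs, Real.norm_eq_abs,
          Real.norm_of_nonneg (del_nonneg _)]
        calc |ψ p.2| * (|A.indicator (w e) p.1| * del e (p.1 - p.2))
            ≤ M * ((C * (1 + ‖p.1‖)) * (K * ((1 + ‖p.1‖) ^ 4)⁻¹)) := by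
              have := del_nonneg (e := e) (p.1 - p.2)
              gcongr
              · exact hind e he _
              · exact del_sub_le he.1 hR0 (hR _ hp2)
          _ = _ := by rw [← one_add_norm_mul_inv_pow_four]; ring
  have hbint : Integrable fun v : Plane => (C * (1 + R)) * ((1 + ‖v‖) * del 1 v) :=
    integrable_one_add_norm_mul_del.const_mul _
  have hdom : ∀ e ∈ Ioc (0 : ℝ) 1, ∀ y ∈ frontier D, ∀ v,
      ‖A.indicator (w e) (y + e • v) * del 1 v‖ ≤ (C * (1 + R)) * ((1 + ‖v‖) * del 1 v) := by
    intro e he y hy v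
    rw [norm_mul, Real.norm_eq_abs, Real.norm_of_nonneg (del_nonneg _), ← mul_assoc]
    refine mul_le_mul_of_nonneg_right ?_ (del_nonneg _)
    refine (hind e he _).trans ?_
    rw [mul_assoc]
    refine mul_le_mul_of_nonneg_left ?_ hC
    have h1 := norm_add_le y (e • v)
    rw [norm_smul, Real.norm_of_nonneg he.1.le] at h1
    have h2 := mul_le_mul_of_nonneg_right he.2 (norm_nonneg v)
    have h3 := hR y hy
    nlinarith [mul_nonneg hR0 (norm_nonneg v)]
  have hmeas : ∀ e, 0 < e → ∀ y, AEStronglyMeasurable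
      (fun v : Plane => A.indicator (w e) (y + e • v) * del 1 v) volume := by
    intro e he y
    have hdc := continuous_del one_pos
    refine AEStronglyMeasurable.mul ?_ hdc.aestronglyMeasurable
    exact ((hindm e he).comp (by fun_prop : Measurable fun v : Plane => y + e • v)
      ).aestronglyMeasurable
  -- In rescaled coordinates the indicator of A tends to that of `H y` and w tends to the constant
  -- `w0 y`.
  have hJlim : ∀ y ∈ frontier D, Tendsto (fun e => J e y) (𝓝[>] 0) (𝓝 (c * w0 y)) := by
    intro y hy
    have h1 : c * w0 y = ∫ v, (H y).indicator (fun _ => w0 y) v * del 1 v := by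
      rw [← hc y hy, ← integral_indicator (hHm y hy), ← integral_mul_const]
      congr 1
      ext v
      by_cases hv : v ∈ H y
      · simp [hv, mul_comm]
      · simp [hv]
    rw [h1]
    refine tendsto_integral_filter_of_dominated_convergence _ ?_ ?_ hbint ?_
    · filter_upwards [self_mem_nhdsWithin] with e he using hmeas e he y
    · filter_upwards [Ioc_mem_nhdsGT one_pos] with e he
      exact Filter.Eventually.of_forall fun v => hdom e he y hy v
    · filter_upwards [hH y hy] with v hv
      refine Tendsto.mul_const _ ?_
      by_cases hvH : v ∈ H y
      · rw [indicator_of_mem hvH]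
        refine (hw0 y hy v).congr' ?_
        filter_upwards [hv] with e he
        rw [indicator_of_mem (he.2 hvH)]
      · rw [indicator_of_notMem hvH]
        refine tendsto_const_nhds.congr' ?_
        filter_upwards [hv] with e he
        rw [indicator_of_notMem fun h => hvH (he.1 h)]
  have hJm : ∀ e, 0 < e → Measurable (J e) := by
    intro e he
    have hdc := continuous_del one_pos
    have : StronglyMeasurable fun p : Plane × Plane =>
        A.indicator (w e) (p.1 + e • p.2) * del 1 p.2 := by
      refine StronglyMeasurable.mul ?_ (hdc.comp continuous_snd).stronglyMeasurable
      exact ((hindm e he).comp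
        (by fun_prop : Measurable fun p : Plane × Plane => p.1 + e • p.2)).stronglyMeasurable
    exact this.integral_prod_right.measurable
  have hlim : Tendsto (fun e => ∫ y, ψ y * J e y ∂(arcLength D)) (𝓝[>] 0)
      (𝓝 (∫ y, ψ y * (c * w0 y) ∂(arcLength D))) := by
    refine tendsto_integral_filter_of_dominated_convergence
      (fun _ => M * ∫ v : Plane, (C * (1 + R)) * ((1 + ‖v‖) * del 1 v)) ?_ ?_
      (integrable_const _) ?_
    · filter_upwards [self_mem_nhdsWithin] with e he
      exact hψ.aestronglyMeasurable.mul (hJm e he).aestronglyMeasurable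
    · filter_upwards [Ioc_mem_nhdsGT one_pos] with e he
      filter_upwards [hM, ae_mem_frontier D] with y hy hyD
      rw [norm_mul]
      refine mul_le_mul hy ?_ (norm_nonneg _) hM0
      exact norm_integral_le_of_norm_le hbint (Filter.Eventually.of_forall (hdom e he y hyD))
    · filter_upwards [ae_mem_frontier D] with y hy
      exact (hJlim y hy).const_mul _
  have heq : c * ∫ z, w0 z * ψ z ∂(arcLength D) = ∫ y, ψ y * (c * w0 y) ∂(arcLength D) := by
    rw [← integral_const_mul]
    congr 1
    ext y
    ring
  rw [heq]
  refine hlim.congr' ?_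
  filter_upwards [Ioc_mem_nhdsGT one_pos] with e he
  rw [hfub e he]

theorem tendsto_integral_plane_mul_smoothDel {D : Set Plane} (hD : IsBoundedC2Domain D)
    {w : ℝ → Plane → ℝ}
    (hw : ∀ e, 0 < e → Continuous (w e)) {C : ℝ} (hC : 0 ≤ C)
    (hwb : ∀ e ∈ Ioc (0 : ℝ) 1, ∀ x, |w e x| ≤ C * (1 + ‖x‖)) {w0 : Plane → ℝ}
    (hw0 : ∀ z ∈ frontier D, ∀ v, Tendsto (fun e => w e (z + e • v)) (𝓝[>] 0) (𝓝 (w0 z)))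
    {ψ : Plane → ℝ} (hψ : IsBoundedDensity D ψ) :
    Tendsto (fun e => ∫ x, w e x * smoothDel e D ψ x) (𝓝[>] 0)
      (𝓝 (∫ z, w0 z * ψ z ∂(arcLength D))) := by
  have h := tendsto_integral_mul_smoothDel hD MeasurableSet.univ (H := fun _ => univ) (c := 1)
    (fun _ _ => MeasurableSet.univ) (by simp) (by simp [integral_del_one]) hw hC
    (fun e he x _ => hwb e he x) hw0 hψ
  simpa using h

/-- The hyperplanes are Lebesgue null. -/
theorem ae_inner_ne_zero {n : Plane} (hn : n ≠ 0) : ∀ᵐ v : Plane, inner ℝ n v ≠ 0 := by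
  have h := Measure.addHaar_submodule (volume : Measure Plane)
    (LinearMap.ker (innerSL ℝ n : Plane →ₗ[ℝ] ℝ)) ?_
  · rw [ae_iff]
    convert h using 2
    ext v
    simp
  · intro ht
    have : n ∈ LinearMap.ker (innerSL ℝ n : Plane →ₗ[ℝ] ℝ) := by rw [ht]; trivial
    rw [LinearMap.mem_ker] at this
    exact hn (inner_self_eq_zero (𝕜 := ℝ).1 (by simpa using this))

/-- This is the source of the 1/2. Rescaled at a boundary point, D becomes the half plane ⟨ν, v⟩ < 0
up to the line ⟨ν, v⟩ = 0, where nothing is known but which is null. The half plane carries half of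
the mass of `del 1`. -/
theorem tendsto_integral_domain_mul_smoothDel {D : Set Plane} (hD : IsBoundedC2Domain D)
    {w : ℝ → Plane → ℝ}
    (hw : ∀ e, 0 < e → Continuous (w e)) {C : ℝ} (hC : 0 ≤ C)
    (hwb : ∀ e ∈ Ioc (0 : ℝ) 1, ∀ x ∈ D, |w e x| ≤ C * (1 + ‖x‖)) {w0 : Plane → ℝ}
    (hw0 : ∀ z ∈ frontier D, ∀ v, Tendsto (fun e => w e (z + e • v)) (𝓝[>] 0) (𝓝 (w0 z)))
    {ψ : Plane → ℝ} (hψ : IsBoundedDensity D ψ) :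
    Tendsto (fun e => ∫ x in D, w e x * smoothDel e D ψ x) (𝓝[>] 0)
      (𝓝 (1 / 2 * ∫ z, w0 z * ψ z ∂(arcLength D))) := by
  have hne : ∀ z ∈ frontier D, normal D z ≠ 0 := fun z hz h => by
    have := hD.norm_normal hz
    simp [h] at this
  refine tendsto_integral_mul_smoothDel hD hD.isOpen.measurableSet
    (H := fun z => {v | inner ℝ (normal D z) v < 0}) (fun z _ => ?_) (fun z hz => ?_)
    (fun z hz => setIntegral_del_one_halfPlane (hne z hz)) hw hC hwb hw0 hψ
  · exact (isOpen_lt (by fun_prop) continuous_const).measurableSet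
  · obtain ⟨U, ρ, h⟩ := hD.boundary z hz
    have hg := norm_pos_iff.2 h.gradient_ne_zero
    filter_upwards [ae_inner_ne_zero (hne z hz)] with v hv
    have hin : inner ℝ (normal D z) v = ‖gradient ρ z‖⁻¹ * inner ℝ (gradient ρ z) v := by
      rw [h.normal_eq, real_inner_smul_left]
    rcases lt_or_gt_of_ne hv with hlt | hgt
    · have h1 : inner ℝ (gradient ρ z) v < 0 := by
        rw [hin] at hlt
        exact (pos_iff_neg_of_mul_neg hlt).1 (inv_pos.2 hg)
      filter_upwards [(h.eventually_mem v).1 h1] with e he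
      simp [he, hlt]
    · have h1 : 0 < inner ℝ (gradient ρ z) v := by
        rw [hin] at hgt
        exact (pos_iff_pos_of_mul_pos hgt).1 (inv_pos.2 hg)
      filter_upwards [(h.eventually_mem v).2 h1] with e he
      simp [he, hgt.le]

section NeumannPoincare
variable {D : Set Plane}

/-- Quadratic tangency of chords cancels the denominator ‖x − y‖², and equally the larger
denominator ‖x − y‖² + e². -/
theorem IsBoundedC2Domain.exists_abs_npKernel_le (hD : IsBoundedC2Domain D) :
    ∃ C : ℝ, 0 ≤ C ∧ ∀ x ∈ frontier D, ∀ y ∈ frontier D,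
      |npKernel D y x| ≤ C ∧ ∀ e, 0 < e → |inner ℝ (normal D x) (ker e (x - y))| ≤ C := by
  obtain ⟨C, hC0, hC⟩ := hD.exists_abs_inner_normal_le
  refine ⟨(2 * π)⁻¹ * C, by positivity, fun x hx y hy => ?_⟩
  have h := hC y hy x hx
  refine ⟨?_, fun e he => ?_⟩
  · rw [npKernel, abs_mul, one_div, abs_of_pos (by positivity : (0 : ℝ) < (2 * π)⁻¹), abs_div,
      norm_sub_rev y x, abs_of_nonneg (by positivity : 0 ≤ ‖x - y‖ ^ 2)]
    gcongr
    exact div_le_of_le_mul₀ (by positivity) hC0 h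
  · rw [ker, inner_smul_right, mul_assoc, abs_mul,
      abs_of_pos (by positivity : (0 : ℝ) < (2 * π)⁻¹), abs_mul,
      abs_of_pos (by positivity : 0 < (‖x - y‖ ^ 2 + e ^ 2)⁻¹), real_inner_comm]
    gcongr
    rw [inv_mul_eq_div]
    refine div_le_of_le_mul₀ (by positivity) hC0 (h.trans ?_)
    gcongr
    nlinarith [sq_nonneg e]

theorem tendsto_inner_normal_ker (x y : Plane) (hxy : x ≠ y) :
    Tendsto (fun e : ℝ => inner ℝ (normal D x) (ker e (x - y))) (𝓝[>] 0)
      (𝓝 (npKernel D y x)) := by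
  have h0 : ‖x - y‖ ≠ 0 := by simpa [sub_eq_zero] using hxy
  have hc : ContinuousAt (fun e : ℝ => (2 * π)⁻¹ * (‖x - y‖ ^ 2 + e ^ 2)⁻¹) 0 := by
    refine continuousAt_const.mul (ContinuousAt.inv₀ (by fun_prop) ?_)
    simpa using h0
  have h1 : Tendsto (fun e : ℝ => ((2 * π)⁻¹ * (‖x - y‖ ^ 2 + e ^ 2)⁻¹) *
      inner ℝ (normal D x) (x - y)) (𝓝[>] 0)
      (𝓝 (((2 * π)⁻¹ * (‖x - y‖ ^ 2 + 0 ^ 2)⁻¹) * inner ℝ (normal D x) (x - y))) :=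
    (hc.tendsto.mono_left nhdsWithin_le_nhds).mul_const _
  refine (h1.congr fun e => ?_).trans_eq ?_
  · rw [ker, inner_smul_right]
  · congr 1
    rw [npKernel, norm_sub_rev y x, real_inner_comm, one_div, div_eq_inv_mul]
    ring

/-- At a point of the boundary itself no jump appears: the kernels are bounded uniformly in e, and
the limit is K* alone. The 1/2 comes only from the Laplacian over D. -/
theorem tendsto_inner_normal_smoothX (hD : IsBoundedC2Domain D) {φ : Plane → ℝ}
    (hφ : IsBoundedDensity D φ) {x : Plane} (hx : x ∈ frontier D) :
    Tendsto (fun e : ℝ => inner ℝ (normal D x) (smoothX e D φ x)) (𝓝[>] 0)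
      (𝓝 (npAdjoint D φ x)) := by
  have := hD.isFiniteMeasure_arcLength
  obtain ⟨C, hC0, hC⟩ := hD.exists_abs_npKernel_le
  obtain ⟨M, hM0, hM⟩ := hφ.exists_bound
  have h1 : Tendsto (fun e : ℝ => ∫ y, inner ℝ (normal D x) (ker e (x - y)) * φ y ∂(arcLength D))
      (𝓝[>] 0) (𝓝 (npAdjoint D φ x)) := by
    refine tendsto_integral_filter_of_dominated_convergence (fun _ => C * M) ?_ ?_
      (integrable_const _) ?_
    · filter_upwards [self_mem_nhdsWithin] with e he
      have := continuous_ker he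
      exact (by fun_prop : Continuous fun y : Plane =>
        inner ℝ (normal D x) (ker e (x - y))).aestronglyMeasurable.mul hφ.aestronglyMeasurable
    · filter_upwards [self_mem_nhdsWithin] with e he
      filter_upwards [hM, ae_mem_frontier D] with y h1 h2
      rw [norm_mul]
      exact mul_le_mul ((hC x hx y h2).2 e he) h1 (norm_nonneg _) hC0
    · filter_upwards [ae_ne_arcLength D x] with y hy
      exact (tendsto_inner_normal_ker x y hy).mul_const _
  refine h1.congr' ?_
  filter_upwards [self_mem_nhdsWithin] with e he
  rw [smoothX, ← integral_inner (hφ.integrable_ker hD he x)]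
  refine integral_congr_ae (Filter.Eventually.of_forall fun y => ?_)
  simp only
  rw [inner_smul_right, mul_comm]

theorem exists_abs_inner_normal_smoothX_le (hD : IsBoundedC2Domain D) {φ : Plane → ℝ}
    (hφ : IsBoundedDensity D φ) : ∃ C : ℝ, 0 ≤ C ∧ ∀ x ∈ frontier D, ∀ e, 0 < e →
      |inner ℝ (normal D x) (smoothX e D φ x)| ≤ C := by
  have := hD.isFiniteMeasure_arcLength
  obtain ⟨C, hC0, hC⟩ := hD.exists_abs_npKernel_le
  obtain ⟨M, hM0, hM⟩ := hφ.exists_bound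
  refine ⟨M * ∫ y, C ∂(arcLength D), mul_nonneg hM0 (integral_nonneg fun _ => hC0),
    fun x hx e he => ?_⟩
  rw [smoothX, ← integral_inner (hφ.integrable_ker hD he x)]
  simp_rw [inner_smul_right]
  refine IsBoundedDensity.norm_integral_smul_le (E := ℝ)
    (g := fun y => inner ℝ (normal D x) (ker e (x - y))) hM (integrable_const C) ?_
  filter_upwards [ae_mem_frontier D] with y hy using (hC x hx y hy).2 e he

theorem aestronglyMeasurable_npKernel (hD : IsBoundedC2Domain D) :
    AEStronglyMeasurable (fun p : Plane × Plane => npKernel D p.2 p.1)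
      ((arcLength D).prod (arcLength D)) := by
  have := hD.isFiniteMeasure_arcLength
  have h1 : AEStronglyMeasurable (fun p : Plane × Plane => inner ℝ (p.1 - p.2) (normal D p.1))
      ((arcLength D).prod (arcLength D)) :=
    (by fun_prop : Continuous fun p : Plane × Plane => p.1 - p.2).aestronglyMeasurable.inner
      hD.aestronglyMeasurable_normal.comp_fst
  have h2 : Measurable fun p : Plane × Plane => (‖p.2 - p.1‖ ^ 2)⁻¹ :=
    (by fun_prop : Measurable fun p : Plane × Plane => ‖p.2 - p.1‖ ^ 2).inv
  have h3 := (h1.mul h2.aestronglyMeasurable).const_mul (1 / (2 * π))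
  simp only [div_eq_mul_inv] at h3
  simp only [npKernel, div_eq_mul_inv]
  exact h3

theorem aestronglyMeasurable_npKernel_right (D : Set Plane) (x : Plane) :
    AEStronglyMeasurable (fun y => npKernel D y x) (arcLength D) := by
  have h2 : Measurable fun y : Plane => 1 / (2 * π) * (inner ℝ (x - y) (normal D x) *
      (‖y - x‖ ^ 2)⁻¹) := by fun_prop
  simpa only [npKernel, div_eq_mul_inv] using h2.aestronglyMeasurable

theorem integrable_npKernel_mul (hD : IsBoundedC2Domain D) {φ : Plane → ℝ}
    (hφ : Integrable φ (arcLength D)) {x : Plane} (hx : x ∈ frontier D) :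
    Integrable (fun y => npKernel D y x * φ y) (arcLength D) := by
  obtain ⟨C, hC0, hC⟩ := hD.exists_abs_npKernel_le
  refine hφ.bdd_mul (c := C) (aestronglyMeasurable_npKernel_right D x) ?_
  filter_upwards [ae_mem_frontier D] with y hy using (hC x hx y hy).1

/-- A bounded kernel maps L¹ to bounded functions. -/
theorem isBoundedDensity_npAdjoint (hD : IsBoundedC2Domain D) {φ : Plane → ℝ}
    (hφ : Integrable φ (arcLength D)) : IsBoundedDensity D (npAdjoint D φ) := by
  have := hD.isFiniteMeasure_arcLength
  obtain ⟨C, hC0, hC⟩ := hD.exists_abs_npKernel_le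
  constructor
  · exact ((aestronglyMeasurable_npKernel hD).mul
      hφ.aestronglyMeasurable.comp_snd).integral_prod_right'
  · refine ⟨∫ y, C * ‖φ y‖ ∂(arcLength D), integral_nonneg fun _ => by positivity, ?_⟩
    filter_upwards [ae_mem_frontier D] with x hx
    rw [← Real.norm_eq_abs, npAdjoint]
    refine norm_integral_le_of_norm_le (hφ.norm.const_mul C) ?_
    filter_upwards [ae_mem_frontier D] with y hy
    rw [norm_mul]
    gcongr
    exact (hC x hx y hy).1

end NeumannPoincare
end CGPT
end

/-! ### The Dirichlet form of single layer potentials plus harmonic functions. -/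

noncomputable section
namespace CGPT
open MeasureTheory Set Filter Topology Metric
open scoped ENNReal NNReal ContDiff Real

namespace IsBoundedDensity
variable {D : Set Plane} {φ ψ : Plane → ℝ}

theorem add (hφ : IsBoundedDensity D φ) (hψ : IsBoundedDensity D ψ) :
    IsBoundedDensity D fun x => φ x + ψ x := by
  obtain ⟨M, hM0, hM⟩ := hφ.exists_bound
  obtain ⟨N, hN0, hN⟩ := hψ.exists_bound
  refine ⟨hφ.1.add hψ.1, M + N, by positivity, ?_⟩
  filter_upwards [hM, hN] with y h1 h2
  exact (abs_add_le _ _).trans (add_le_add h1 h2)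

theorem mul (hφ : IsBoundedDensity D φ) (hψ : IsBoundedDensity D ψ) :
    IsBoundedDensity D fun x => φ x * ψ x := by
  obtain ⟨M, hM0, hM⟩ := hφ.exists_bound
  obtain ⟨N, hN0, hN⟩ := hψ.exists_bound
  refine ⟨hφ.1.mul hψ.1, M * N, by positivity, ?_⟩
  filter_upwards [hM, hN] with y h1 h2
  rw [abs_mul]
  gcongr

theorem const (D : Set Plane) (c : ℝ) : IsBoundedDensity D fun _ => c :=
  ⟨aestronglyMeasurable_const, |c|, abs_nonneg c, Filter.Eventually.of_forall fun _ => le_rfl⟩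

theorem const_mul (hφ : IsBoundedDensity D φ) (c : ℝ) : IsBoundedDensity D fun x => c * φ x :=
  (const D c).mul hφ

theorem congr (hφ : IsBoundedDensity D φ) (h : φ =ᵐ[arcLength D] ψ) : IsBoundedDensity D ψ := by
  obtain ⟨M, hM0, hM⟩ := hφ.exists_bound
  refine ⟨hφ.1.congr h, M, hM0, ?_⟩
  filter_upwards [hM, h] with y h1 h2
  rwa [← h2]

theorem of_continuous (hD : IsBoundedC2Domain D) {f : Plane → ℝ} (hf : Continuous f) :
    IsBoundedDensity D f := by
  obtain ⟨M, hM⟩ := hD.isCompact_frontier.exists_bound_of_continuousOn hf.continuousOn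
  refine ⟨hf.aestronglyMeasurable, max M 0, le_max_right _ _, ?_⟩
  filter_upwards [ae_mem_frontier D] with y hy
  exact (hM y hy).trans (le_max_left _ _)

end IsBoundedDensity

/-- A globally defined `C²` harmonic function on the plane. -/
structure IsHarmonic (f : Plane → ℝ) : Prop where
  contDiff : ContDiff ℝ 2 f
  div_gradient : ∀ x, div (gradient f) x = 0

theorem contDiff_gradient {f : Plane → ℝ} (hf : ContDiff ℝ 2 f) : ContDiff ℝ 1 (gradient f) :=
  (InnerProductSpace.toDual ℝ Plane).symm.contDiff.comp (hf.fderiv_right (by norm_num))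

theorem continuous_gradient {f : Plane → ℝ} (hf : ContDiff ℝ 1 f) : Continuous (gradient f) :=
  (InnerProductSpace.toDual ℝ Plane).symm.continuous.comp (hf.continuous_fderiv one_ne_zero)

theorem isBoundedDensity_normalDeriv {D : Set Plane} (hD : IsBoundedC2Domain D) {f : Plane → ℝ}
    (hf : ContDiff ℝ 1 f) : IsBoundedDensity D (normalDeriv D f) := by
  have hc := continuous_gradient hf
  obtain ⟨M, hM0, hM⟩ := (IsBoundedDensity.of_continuous hD hc.norm).exists_bound
  refine ⟨hD.aestronglyMeasurable_normal.inner hc.aestronglyMeasurable, M, hM0, ?_⟩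
  filter_upwards [hM, ae_mem_frontier D] with y h1 h2
  rw [abs_norm] at h1
  refine (abs_real_inner_le_norm _ _).trans ?_
  rw [hD.norm_normal h2, one_mul]
  exact h1

theorem div_add {F G : Plane → Plane} {x : Plane} (hF : DifferentiableAt ℝ F x)
    (hG : DifferentiableAt ℝ G x) : div (fun y => F y + G y) x = div F x + div G x := by
  simp only [div]
  rw [fderiv_fun_add hF hG]
  simp [Finset.sum_add_distrib]

/-- The bilinear form `∫_∂D (S φ + f) ((K^* - 1/2) ψ + ∂g/∂ν)`, which is the Dirichlet form on `D`
of the functions `S φ + f` and `S ψ + g`. -/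
def energy (D : Set Plane) (φ f ψ g : Plane → ℝ) : ℝ :=
  ∫ z, (singleLayer D φ z + f z) * (npAdjoint D ψ z - 1 / 2 * ψ z + normalDeriv D g z) ∂(arcLength D)

section
variable {D : Set Plane} {φ f ψ g : Plane → ℝ}

/-- Green's identity for the smoothed potential of φ plus f and the smoothed gradient field of ψ
plus ∇g. All are `C¹` across the boundary, and harmonicity of g leaves only the smoothed Laplacian
of ψ's potential. -/
theorem integral_inner_smooth (hD : IsBoundedC2Domain D) (hφ : IsBoundedDensity D φ)
    (hψ : IsBoundedDensity D ψ) (hf : ContDiff ℝ 1 f) (hg : IsHarmonic g) {e : ℝ} (he : 0 < e) :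
    ∫ x in D, inner ℝ (smoothX e D φ x + gradient f x) (smoothX e D ψ x + gradient g x) =
      ∫ z, (smoothU e D φ z + f z) * (inner ℝ (normal D z) (smoothX e D ψ z) + normalDeriv D g z)
        ∂(arcLength D) - ∫ x in D, (smoothU e D φ x + f x) * smoothDel e D ψ x := by
  have hU := hφ.contDiff_smoothU hD he
  have hX := hφ.contDiff_smoothX hD he
  have hY := hψ.contDiff_smoothX hD he
  have hG := contDiff_gradient hg.contDiff
  have hgf := continuous_gradient hf
  have h := hD.green (hU.add hf) (hY.add hG)
  have hXc := hX.continuous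
  have hYc := hY.continuous
  have hGc := hG.continuous
  have hdiv : ∀ x, div (fun y => smoothX e D ψ y + gradient g y) x = smoothDel e D ψ x := by
    intro x
    rw [div_add (hY.differentiable one_ne_zero x) (hG.differentiable one_ne_zero x),
      hg.div_gradient, add_zero, hψ.div_smoothX hD he]
  have hfd : ∀ x v, fderiv ℝ (fun y => smoothU e D φ y + f y) x v =
      inner ℝ (smoothX e D φ x + gradient f x) v := by
    intro x v
    rw [fderiv_fun_add (hU.differentiable one_ne_zero x) (hf.differentiable one_ne_zero x),
      add_apply, hφ.fderiv_smoothU hD he, inner_add_left, inner_gradient]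
  have hdc : Continuous (smoothDel e D ψ) := by
    have := hY.continuous_fderiv one_ne_zero
    have h2 : smoothDel e D ψ = div (smoothX e D ψ) := by
      ext x; rw [hψ.div_smoothX hD he]
    rw [h2]
    unfold div
    fun_prop
  have hUc := hU.continuous
  have hfc := hf.continuous
  have hi : ∀ F : Plane → ℝ, Continuous F → IntegrableOn F D := fun F hF =>
    (hF.continuousOn.integrableOn_compact hD.isCompact_closure).mono_set subset_closure
  simp_rw [hfd, hdiv] at h
  rw [integral_add (hi _ (by fun_prop)) (hi _ (by fun_prop))] at h
  simp_rw [inner_add_right (𝕜 := ℝ) (normal D _)] at h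
  unfold normalDeriv
  linarith

/-- The Dirichlet form of smoothed potentials converges to `energy`. -/
theorem tendsto_energy (hD : IsBoundedC2Domain D) (hφ : IsBoundedDensity D φ)
    (hψ : IsBoundedDensity D ψ) (hf : ContDiff ℝ 1 f) (hg : IsHarmonic g) :
    Tendsto (fun e => ∫ x in D,
      inner ℝ (smoothX e D φ x + gradient f x) (smoothX e D ψ x + gradient g x)) (𝓝[>] 0)
      (𝓝 (energy D φ f ψ g)) := by
  have := hD.isFiniteMeasure_arcLength
  obtain ⟨C, hC0, hC⟩ := hφ.exists_abs_smoothU_le hD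
  obtain ⟨C', hC'0, hC'⟩ := exists_abs_inner_normal_smoothX_le hD hψ
  obtain ⟨R, hR0, hR⟩ := hD.exists_norm_le
  have hfc := hf.continuous
  obtain ⟨B, hB⟩ := hD.isCompact_closure.exists_bound_of_continuousOn hfc.continuousOn
  obtain ⟨N, hN0, hN⟩ := (isBoundedDensity_normalDeriv hD
    (hg.contDiff.of_le (by norm_num) : ContDiff ℝ 1 g)).exists_bound
  set B' := max B 0
  have hB' : ∀ x ∈ closure D, |f x| ≤ B' := fun x hx => (hB x hx).trans (le_max_left _ _)
  have hB'0 : 0 ≤ B' := le_max_right _ _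
  have hlim1 : ∀ z v, Tendsto (fun e => smoothU e D φ (z + e • v) + f (z + e • v)) (𝓝[>] 0)
      (𝓝 (singleLayer D φ z + f z)) := by
    intro z v
    refine (hφ.tendsto_smoothU hD z v).add ?_
    have h1 : Continuous fun e : ℝ => f (z + e • v) := by fun_prop
    have h2 := h1.tendsto 0
    simp only [zero_smul, add_zero] at h2
    exact h2.mono_left nhdsWithin_le_nhds
  have hbd : ∀ e ∈ Ioc (0 : ℝ) 1, ∀ x ∈ closure D,
      |smoothU e D φ x + f x| ≤ (C + B') * (1 + ‖x‖) := by
    intro e he x hx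
    refine (abs_add_le _ _).trans ?_
    have h1 := hC e he x
    have h2 := hB' x hx
    nlinarith [mul_nonneg hB'0 (norm_nonneg x)]
  -- The Laplacian term yields the −ψ/2 of `energy`; the boundary term `h2` yields K*ψ and ∂g/∂ν.
  have h1 := tendsto_integral_domain_mul_smoothDel hD (w := fun e x => smoothU e D φ x + f x)
    (fun e he => (hφ.contDiff_smoothU hD he).continuous.add hfc) (add_nonneg hC0 hB'0)
    (fun e he x hx => hbd e he x (subset_closure hx)) (fun z _ v => hlim1 z v) hψ
  have h2 : Tendsto (fun e => ∫ z, (smoothU e D φ z + f z) *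
      (inner ℝ (normal D z) (smoothX e D ψ z) + normalDeriv D g z) ∂(arcLength D)) (𝓝[>] 0)
      (𝓝 (∫ z, (singleLayer D φ z + f z) * (npAdjoint D ψ z + normalDeriv D g z)
        ∂(arcLength D))) := by
    refine tendsto_integral_filter_of_dominated_convergence
      (fun _ => ((C + B') * (1 + R)) * (C' + N)) ?_ ?_ (integrable_const _) ?_
    · filter_upwards [self_mem_nhdsWithin] with e he
      refine ((hφ.contDiff_smoothU hD he).continuous.add hfc).aestronglyMeasurable.mul ?_
      exact (hD.aestronglyMeasurable_normal.inner
        (hψ.contDiff_smoothX hD he).continuous.aestronglyMeasurable).add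
        (isBoundedDensity_normalDeriv hD (hg.contDiff.of_le (by norm_num))).aestronglyMeasurable
    · filter_upwards [Ioc_mem_nhdsGT one_pos] with e he
      filter_upwards [ae_mem_frontier D, hN] with z hz hzN
      rw [norm_mul]
      refine mul_le_mul ?_ ?_ (norm_nonneg _) (by positivity)
      · refine (hbd e he z (frontier_subset_closure hz)).trans ?_
        have := hR z hz
        gcongr
      · exact (abs_add_le _ _).trans (add_le_add (hC' z hz e he.1) hzN)
    · filter_upwards [ae_mem_frontier D] with z hz
      refine Tendsto.mul ?_ ?_
      · simpa using hlim1 z 0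
      · exact (tendsto_inner_normal_smoothX hD hψ hz).add_const _
  have h3 : energy D φ f ψ g = ∫ z, (singleLayer D φ z + f z) *
      (npAdjoint D ψ z + normalDeriv D g z) ∂(arcLength D) -
      1 / 2 * ∫ z, (singleLayer D φ z + f z) * ψ z ∂(arcLength D) := by
    have hS := (hφ.isBoundedDensity_singleLayer hD).add (IsBoundedDensity.of_continuous hD hfc)
    rw [← integral_const_mul, ← integral_sub, energy]
    · congr 1
      ext z
      ring
    · exact (hS.mul ((isBoundedDensity_npAdjoint hD (hψ.integrable hD)).add
        (isBoundedDensity_normalDeriv hD (hg.contDiff.of_le (by norm_num))))).integrable hD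
    · exact ((hS.mul hψ).const_mul _).integrable hD
  rw [h3]
  refine (h2.sub h1).congr' ?_
  filter_upwards [self_mem_nhdsWithin] with e he
  rw [integral_inner_smooth hD hφ hψ hf hg he]

/-- The boundary expression is not visibly symmetric, but its approximations are: they are L²
products of gradients over D. -/
theorem energy_symm (hD : IsBoundedC2Domain D) (hφ : IsBoundedDensity D φ)
    (hψ : IsBoundedDensity D ψ) (hf : IsHarmonic f) (hg : IsHarmonic g) :
    energy D φ f ψ g = energy D ψ g φ f := by
  refine tendsto_nhds_unique
    (tendsto_energy hD hφ hψ (hf.contDiff.of_le (by norm_num)) hg) ?_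
  refine (tendsto_energy hD hψ hφ (hg.contDiff.of_le (by norm_num)) hf).congr fun e => ?_
  exact integral_congr_ae (Filter.Eventually.of_forall fun x => real_inner_comm _ _)

theorem energy_self_nonneg (hD : IsBoundedC2Domain D) (hφ : IsBoundedDensity D φ)
    (hf : IsHarmonic f) : 0 ≤ energy D φ f φ f :=
  ge_of_tendsto' (tendsto_energy hD hφ hφ (hf.contDiff.of_le (by norm_num)) hf) fun _ =>
    integral_nonneg fun _ => real_inner_self_nonneg

theorem isHarmonic_const (c : ℝ) : IsHarmonic fun _ => c := by
  refine ⟨contDiff_const, fun x => ?_⟩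
  have : gradient (fun _ : Plane => c) = fun _ => 0 := by
    ext1 x
    simp [gradient]
  rw [this]
  simp [div]

theorem normalDeriv_const (D : Set Plane) (c : ℝ) (x : Plane) :
    normalDeriv D (fun _ => c) x = 0 := by
  simp [normalDeriv, gradient]

end
end CGPT
end

/-! ### Energy of the single layer on the whole plane. -/

noncomputable section
namespace CGPT
open MeasureTheory Set Filter Topology Metric
open scoped ENNReal NNReal ContDiff Real

namespace IsBoundedDensity
variable {D : Set Plane} {φ : Plane → ℝ}

/-- Decay at infinity of smoothed potentials of densities of mean zero. -/
theorem exists_decay (hφ : IsBoundedDensity D φ) (hD : IsBoundedC2Domain D)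
    (h0 : ∫ y, φ y ∂(arcLength D) = 0) {e : ℝ} (he : 0 < e) : ∃ C : ℝ, 0 ≤ C ∧ ∀ x,
      ‖smoothU e D φ x‖ ≤ C * (1 + ‖x‖)⁻¹ ∧ ‖smoothX e D φ x‖ ≤ C * ((1 + ‖x‖) ^ 2)⁻¹ ∧
      ‖fderiv ℝ (smoothX e D φ) x‖ ≤ C * ((1 + ‖x‖) ^ 2)⁻¹ := by
  have := hD.isFiniteMeasure_arcLength
  obtain ⟨M, hM0, hM⟩ := hφ.exists_bound
  obtain ⟨R, hR0, hR⟩ := hD.exists_norm_le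
  have hgc := (contDiff_gam he).continuous
  have hkc := continuous_ker he
  have hk1 : ContDiff ℝ 1 (ker e) := (contDiff_ker he).of_le (by norm_num)
  have hk2 := hk1.continuous_fderiv one_ne_zero
  set K := ((1 + R) / e + 1) ^ 2 with hK
  have hK0 : 0 ≤ K := by positivity
  have hinv : ∀ x, ∀ y ∈ frontier D, (‖x - y‖ ^ 2 + e ^ 2)⁻¹ ≤ K * ((1 + ‖x‖) ^ 2)⁻¹ :=
    fun x y hy => inv_norm_sub_sq_le he hR0 (hR y hy)
  have hinv0 : ∀ x : Plane, (‖x‖ ^ 2 + e ^ 2)⁻¹ ≤ K * ((1 + ‖x‖) ^ 2)⁻¹ := fun x => by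
    simpa using inv_norm_sub_sq_le he hR0 (x := x) (y := 0) (by simpa using hR0)
  set s := (arcLength D).real univ
  have hs : 0 ≤ s := measureReal_nonneg
  have key : ∀ {E : Type} [NormedAddCommGroup E] [NormedSpace ℝ E] (g : Plane → E) (b : ℝ),
      (∀ y ∈ frontier D, ‖g y‖ ≤ b) → ‖∫ y, φ y • g y ∂(arcLength D)‖ ≤ M * (s * b) := by
    intro E _ _ g b hb
    have h := norm_integral_smul_le (g := g) hM (integrable_const b) (by
      filter_upwards [ae_mem_frontier D] with y hy using hb y hy)
    rwa [integral_const, smul_eq_mul] at h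
  -- As φ has mean zero, the kernel with pole at the origin can be subtracted for free, which gains
  -- one power of decay.
  have hsub : ∀ {E : Type} [NormedAddCommGroup E] [NormedSpace ℝ E] [CompleteSpace E]
      (g : Plane → E), Continuous g → ∀ x,
      ∫ y, φ y • g (x - y) ∂(arcLength D) = ∫ y, φ y • (g (x - y) - g x) ∂(arcLength D) := by
    intro E _ _ _ g hg x
    simp_rw [smul_sub]
    rw [integral_sub (hφ.integrable_smul (hD.integrable_of_continuous (by fun_prop)))
      (hφ.integrable_smul (hD.integrable_of_continuous (by fun_prop))), integral_smul_const, h0,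
      zero_smul, sub_zero]
  have hb : ∀ x, ∀ y ∈ frontier D, (‖x - y‖ ^ 2 + e ^ 2)⁻¹ + (‖x‖ ^ 2 + e ^ 2)⁻¹ ≤
      2 * K * ((1 + ‖x‖) ^ 2)⁻¹ := fun x y hy => by
    linarith [hinv x y hy, hinv0 x]
  have hny : ∀ x : Plane, ∀ y ∈ frontier D, ‖(x - y) - x‖ ≤ R := fun x y hy => by
    simpa using hR y hy
  -- One constant for three bounds: the summand K serves the derivative of the gradient field, 2KR
  -- the field, and 2KR(R + 2) the potential.
  refine ⟨M * (s * (K + R * (2 * K) + R * (R + 2) * (2 * K))), by positivity, fun x => ?_⟩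
  have hx0 : 0 < 1 + ‖x‖ := by positivity
  refine ⟨?_, ?_, ?_⟩
  · rw [smoothU, hsub _ hgc]
    refine (key _ (R * (R + 2) * (2 * K) * (1 + ‖x‖)⁻¹) fun y hy => ?_).trans ?_
    · refine (abs_gam_sub_gam_le he (x - y) x).trans ?_
      have h1 : ‖x - y‖ + ‖x‖ ≤ (R + 2) * (1 + ‖x‖) := by
        have := norm_sub_le x y
        have := hR y hy
        nlinarith [mul_nonneg hR0 (norm_nonneg x)]
      calc _ ≤ R * ((R + 2) * (1 + ‖x‖)) * (2 * K * ((1 + ‖x‖) ^ 2)⁻¹) := by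
            gcongr
            · exact hny x y hy
            · exact hb x y hy
        _ = _ := by field_simp
    · rw [mul_assoc M, mul_assoc s]
      gcongr
      nlinarith [mul_nonneg hR0 hK0]
  · rw [smoothX, hsub _ hkc]
    refine (key _ (R * (2 * K) * ((1 + ‖x‖) ^ 2)⁻¹) fun y hy => ?_).trans ?_
    · refine (norm_ker_sub_ker_le he (x - y) x).trans ?_
      rw [mul_assoc R]
      gcongr
      · exact hny x y hy
      · exact hb x y hy
    · rw [mul_assoc M, mul_assoc s]
      gcongr
      have : 0 ≤ R * (R + 2) * (2 * K) := by positivity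
      linarith
  · have h1 : fderiv ℝ (smoothX e D φ) x = _ :=
      (hφ.hasFDerivAt_potential hD hk1 (norm_fderiv_ker_le' he) x).fderiv
    rw [h1]
    refine (key _ (K * ((1 + ‖x‖) ^ 2)⁻¹) fun y hy => ?_).trans ?_
    · exact (norm_fderiv_ker_le he _).trans (hinv x y hy)
    · rw [mul_assoc M, mul_assoc s]
      gcongr
      have : 0 ≤ R * (R + 2) * (2 * K) := by positivity
      have : 0 ≤ R * (2 * K) := by positivity
      linarith

theorem norm_fderiv_smoothU_le (hφ : IsBoundedDensity D φ) (hD : IsBoundedC2Domain D) {e : ℝ}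
    (he : 0 < e) (x : Plane) : ‖fderiv ℝ (smoothU e D φ) x‖ ≤ ‖smoothX e D φ x‖ := by
  refine ContinuousLinearMap.opNorm_le_bound _ (norm_nonneg _) fun v => ?_
  rw [hφ.fderiv_smoothU hD he]
  exact norm_inner_le_norm _ _

theorem integrable_norm_sq_smoothX (hφ : IsBoundedDensity D φ) (hD : IsBoundedC2Domain D)
    (h0 : ∫ y, φ y ∂(arcLength D) = 0) {e : ℝ} (he : 0 < e) :
    Integrable fun x => ‖smoothX e D φ x‖ ^ 2 := by
  obtain ⟨C, hC0, hC⟩ := hφ.exists_decay hD h0 he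
  have hX := (hφ.contDiff_smoothX hD he).continuous
  refine (integrable_inv_one_add_norm_pow.const_mul (C ^ 2)).mono'
    (by fun_prop : Continuous fun x => ‖smoothX e D φ x‖ ^ 2).aestronglyMeasurable
    (Filter.Eventually.of_forall fun x => ?_)
  rw [Real.norm_of_nonneg (by positivity)]
  have h1 : 1 ≤ 1 + ‖x‖ := by linarith [norm_nonneg x]
  calc ‖smoothX e D φ x‖ ^ 2 ≤ (C * ((1 + ‖x‖) ^ 2)⁻¹) ^ 2 := by gcongr; exact (hC x).2.1
    _ = C ^ 2 * ((1 + ‖x‖) ^ 4)⁻¹ := by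
      rw [mul_pow, inv_pow, ← pow_mul]
    _ ≤ _ := by gcongr; norm_num

/-- Integration by parts over the plane is legitimate because the potential times its gradient, or
times the second derivatives, is O((1 + ‖x‖)⁻³). -/
theorem integral_norm_sq_smoothX (hφ : IsBoundedDensity D φ) (hD : IsBoundedC2Domain D)
    (h0 : ∫ y, φ y ∂(arcLength D) = 0) {e : ℝ} (he : 0 < e) :
    ∫ x, ‖smoothX e D φ x‖ ^ 2 = -∫ x, smoothU e D φ x * smoothDel e D φ x := by
  obtain ⟨C, hC0, hC⟩ := hφ.exists_decay hD h0 he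
  have hU := hφ.contDiff_smoothU hD he
  have hX := hφ.contDiff_smoothX hD he
  have hUc := hU.continuous
  have hXc := hX.continuous
  have hU' := hU.continuous_fderiv one_ne_zero
  have hX' := hX.continuous_fderiv one_ne_zero
  have hint := (integrable_inv_one_add_norm_pow.const_mul (C * C))
  have hmul : ∀ x : Plane, C * (1 + ‖x‖)⁻¹ * (C * ((1 + ‖x‖) ^ 2)⁻¹) =
      C * C * ((1 + ‖x‖) ^ 3)⁻¹ := fun x => by
    have : 1 + ‖x‖ ≠ 0 := by positivity
    field_simp
  have h := integral_plane_green hU hX ?_ ?_ ?_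
  · simp_rw [hφ.fderiv_smoothU hD he, real_inner_self_eq_norm_sq, hφ.div_smoothX hD he] at h
    exact h
  · refine hint.mono' (by fun_prop : Continuous _).aestronglyMeasurable
      (Filter.Eventually.of_forall fun x => ?_)
    rw [norm_mul, norm_norm, norm_norm, ← hmul]
    exact mul_le_mul (hC x).1 (hC x).2.1 (norm_nonneg _) (by positivity)
  · refine (hφ.integrable_norm_sq_smoothX hD h0 he).mono'
      (by fun_prop : Continuous _).aestronglyMeasurable (Filter.Eventually.of_forall fun x => ?_)
    rw [norm_mul, norm_norm, norm_norm, sq]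
    gcongr
    exact hφ.norm_fderiv_smoothU_le hD he x
  · refine hint.mono' (by fun_prop : Continuous _).aestronglyMeasurable
      (Filter.Eventually.of_forall fun x => ?_)
    rw [norm_mul, norm_norm, norm_norm, ← hmul]
    exact mul_le_mul (hC x).1 (hC x).2.2 (norm_nonneg _) (by positivity)

/-- Over the whole plane each boundary point receives the full mass of the approximate identity, so
no factor 1/2 occurs. -/
theorem tendsto_integral_norm_sq_smoothX (hφ : IsBoundedDensity D φ) (hD : IsBoundedC2Domain D)
    (h0 : ∫ y, φ y ∂(arcLength D) = 0) :
    Tendsto (fun e => ∫ x, ‖smoothX e D φ x‖ ^ 2) (𝓝[>] 0)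
      (𝓝 (-∫ z, singleLayer D φ z * φ z ∂(arcLength D))) := by
  obtain ⟨C, hC0, hC⟩ := hφ.exists_abs_smoothU_le hD
  refine (tendsto_integral_plane_mul_smoothDel hD
    (fun e he => (hφ.contDiff_smoothU hD he).continuous) hC0 hC
    (fun z _ v => hφ.tendsto_smoothU hD z v) hφ).neg.congr' ?_
  filter_upwards [self_mem_nhdsWithin] with e he
  rw [hφ.integral_norm_sq_smoothX hD h0 he]

theorem integral_singleLayer_mul_self_nonpos (hφ : IsBoundedDensity D φ)
    (hD : IsBoundedC2Domain D) (h0 : ∫ y, φ y ∂(arcLength D) = 0) :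
    ∫ z, singleLayer D φ z * φ z ∂(arcLength D) ≤ 0 := by
  have h := ge_of_tendsto' (hφ.tendsto_integral_norm_sq_smoothX hD h0) (b := 0) fun _ =>
    integral_nonneg fun _ => by positivity
  linarith

/-- The interior Dirichlet energy is at most the full one. -/
theorem energy_le (hφ : IsBoundedDensity D φ) (hD : IsBoundedC2Domain D)
    (h0 : ∫ y, φ y ∂(arcLength D) = 0) : energy D φ (fun _ => 0) φ (fun _ => 0) ≤
      -∫ z, singleLayer D φ z * φ z ∂(arcLength D) := by
  have hg : ∀ x, gradient (fun _ : Plane => (0 : ℝ)) x = 0 := fun x => by simp [gradient]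
  refine le_of_tendsto_of_tendsto (tendsto_energy hD hφ hφ contDiff_const (isHarmonic_const 0))
    (hφ.tendsto_integral_norm_sq_smoothX hD h0) ?_
  filter_upwards [self_mem_nhdsWithin] with e he
  simp_rw [hg, add_zero, real_inner_self_eq_norm_sq]
  exact setIntegral_le_integral (hφ.integrable_norm_sq_smoothX hD h0 he)
    (Filter.Eventually.of_forall fun x => by positivity)

/-- Pairing the gradient of a test function with the smoothed gradient field. -/
theorem tendsto_integral_inner_gradient (hφ : IsBoundedDensity D φ) (hD : IsBoundedC2Domain D)
    {η : Plane → ℝ} (hη : ContDiff ℝ 1 η) (hc : HasCompactSupport η) :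
    Tendsto (fun e => ∫ x, inner ℝ (gradient η x) (smoothX e D φ x)) (𝓝[>] 0)
      (𝓝 (-∫ z, η z * φ z ∂(arcLength D))) := by
  obtain ⟨C, hC⟩ := hc.exists_bound_of_continuous hη.continuous
  have hηc := hη.continuous
  have hη' := hη.continuous_fderiv one_ne_zero
  have hC0 : 0 ≤ C := (norm_nonneg _).trans (hC 0)
  refine (tendsto_integral_plane_mul_smoothDel hD (w := fun _ => η) (w0 := η) (ψ := φ)
    (fun e _ => hηc) hC0 (fun e _ x => (hC x).trans ?_) (fun z _ v => ?_) hφ).neg.congr' ?_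
  · nlinarith [mul_nonneg hC0 (norm_nonneg x)]
  · have h1 : Continuous fun e : ℝ => η (z + e • v) := by fun_prop
    have h2 := h1.tendsto 0
    simp only [zero_smul, add_zero] at h2
    exact h2.mono_left nhdsWithin_le_nhds
  · filter_upwards [self_mem_nhdsWithin] with e he
    have hX := hφ.contDiff_smoothX hD he
    have hXc := hX.continuous
    have hX' := hX.continuous_fderiv one_ne_zero
    have h := integral_plane_green hη hX
      ((by fun_prop : Continuous _).integrable_of_hasCompactSupport hc.norm.mul_right)
      ((by fun_prop : Continuous _).integrable_of_hasCompactSupport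
        (hc.fderiv (𝕜 := ℝ)).norm.mul_right)
      ((by fun_prop : Continuous _).integrable_of_hasCompactSupport hc.norm.mul_right)
    simp_rw [inner_gradient, h, hφ.div_smoothX hD he]

/-- A density of mean zero and vanishing single layer energy is zero. -/
theorem ae_eq_zero (hφ : IsBoundedDensity D φ) (hD : IsBoundedC2Domain D)
    (h0 : ∫ y, φ y ∂(arcLength D) = 0)
    (hS : ∫ z, singleLayer D φ z * φ z ∂(arcLength D) = 0) : ∀ᵐ z ∂(arcLength D), φ z = 0 := by
  refine ae_eq_zero_of_integral_contDiff_smul_eq_zero (hφ.integrable hD).locallyIntegrable ?_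
  intro η hη hc
  have hη1 : ContDiff ℝ 1 η := hη.of_le (by exact_mod_cast le_top)
  have hgc := continuous_gradient hη1
  have hgs : HasCompactSupport (gradient η) :=
    (hc.fderiv (𝕜 := ℝ)).comp_left (g := (InnerProductSpace.toDual ℝ Plane).symm) (by simp)
  have hgi : Integrable fun x => ‖gradient η x‖ ^ 2 :=
    (by fun_prop : Continuous fun x => ‖gradient η x‖ ^ 2).integrable_of_hasCompactSupport
      (hgs.comp_left (g := fun v : Plane => ‖v‖ ^ 2) (by simp))
  set a := ∫ z, η z • φ z ∂(arcLength D) with ha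
  set B := ∫ x, ‖gradient η x‖ ^ 2
  have hlim1 := hφ.tendsto_integral_norm_sq_smoothX hD h0
  have hlim2 := hφ.tendsto_integral_inner_gradient hD hη1 hc
  rw [hS, neg_zero] at hlim1
  -- The limit of ∫‖X_e + t∇η‖², with X_e the smoothed gradient field, is a nonnegative quadratic in
  -- t. Its constant term is the vanishing energy, so its discriminant forces a = 0.
  have hquad : ∀ t : ℝ, 0 ≤ B * (t * t) + (-2 * a) * t + 0 := by
    intro t
    have h2 := (hlim1.add (hlim2.const_mul (2 * t))).add_const (B * (t * t))
    have h3 := ge_of_tendsto (b := 0) h2 ?_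
    · have h4 : ∫ z, η z * φ z ∂(arcLength D) = a := rfl
      rw [h4] at h3
      linarith
    · filter_upwards [self_mem_nhdsWithin] with e he
      have hX := (hφ.contDiff_smoothX hD he).continuous
      have hi1 := hφ.integrable_norm_sq_smoothX hD h0 he
      have hi2 : Integrable fun x => inner ℝ (gradient η x) (smoothX e D φ x) := by
        refine (by fun_prop : Continuous fun x =>
          inner ℝ (gradient η x) (smoothX e D φ x)).integrable_of_hasCompactSupport ?_
        refine hgs.mono fun x hx => ?_
        contrapose! hx
        simp only [Function.mem_support, not_not] at hx ⊢
        simp [hx]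
      have h5 : 0 ≤ ∫ x, ‖smoothX e D φ x + t • gradient η x‖ ^ 2 :=
        integral_nonneg fun _ => by positivity
      have h6 : ∀ x, ‖smoothX e D φ x + t • gradient η x‖ ^ 2 = ‖smoothX e D φ x‖ ^ 2 +
          2 * t * inner ℝ (gradient η x) (smoothX e D φ x) + ‖gradient η x‖ ^ 2 * (t * t) := by
        intro x
        rw [norm_add_sq_real, inner_smul_right, norm_smul, mul_pow, Real.norm_eq_abs, sq_abs,
          real_inner_comm]
        ring
      simp_rw [h6] at h5
      have hi3 : Integrable fun x => ‖smoothX e D φ x‖ ^ 2 +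
          2 * t * inner ℝ (gradient η x) (smoothX e D φ x) := hi1.add (hi2.const_mul _)
      rw [integral_add hi3 (hgi.mul_const _),
        integral_add hi1 (hi2.const_mul _), integral_const_mul, integral_mul_const] at h5
      exact h5
  have hd := discrim_le_zero hquad
  rw [discrim] at hd
  nlinarith [sq_nonneg a]

end IsBoundedDensity

/-! ### Consequences for solutions of the integral equation. -/

/-- Solutions of `(lam - K^*) φ = ∂f/∂ν`: the Dirichlet form with `S φ + f`. -/
theorem energy_eq_of_solves {D : Set Plane} {lam : ℝ} {φ f ψ g : Plane → ℝ}
    (h : ∀ᵐ x ∂(arcLength D), lam * ψ x - npAdjoint D ψ x = normalDeriv D g x) :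
    energy D φ f ψ g = (lam - 1 / 2) * ∫ z, (singleLayer D φ z + f z) * ψ z ∂(arcLength D) := by
  rw [energy, ← integral_const_mul]
  refine integral_congr_ae ?_
  filter_upwards [h] with x hx
  rw [← hx]
  ring

section
variable {D : Set Plane} {lam : ℝ} {φ f ψ g : Plane → ℝ}

theorem singleLayer_zero (D : Set Plane) (z : Plane) : singleLayer D (fun _ => 0) z = 0 := by
  simp [singleLayer]

theorem npAdjoint_zero (D : Set Plane) (z : Plane) : npAdjoint D (fun _ => 0) z = 0 := by
  simp [npAdjoint]

/-- Solutions with Neumann data of a harmonic function have mean zero. -/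
theorem integral_eq_zero_of_solves (hD : IsBoundedC2Domain D) (hlam : 1 / 2 < |lam|)
    (hψ : IsBoundedDensity D ψ) (hg : IsHarmonic g)
    (h : ∀ᵐ x ∂(arcLength D), lam * ψ x - npAdjoint D ψ x = normalDeriv D g x) :
    ∫ y, ψ y ∂(arcLength D) = 0 := by
  -- Testing against the constant 1: in the other order the form is 0, since a constant has zero
  -- Neumann data.
  have h1 := energy_symm hD (IsBoundedDensity.const D 0) hψ (isHarmonic_const 1) hg
  rw [energy_eq_of_solves h] at h1
  have h2 : energy D ψ g (fun _ => 0) (fun _ => 1) = 0 := by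
    simp [energy, npAdjoint_zero, normalDeriv_const]
  rw [h2] at h1
  simp only [singleLayer_zero, zero_add, one_mul] at h1
  refine (mul_eq_zero.1 h1).resolve_left fun h3 => ?_
  have : lam = 1 / 2 := by linarith
  rw [this, abs_of_pos (by norm_num)] at hlam
  exact lt_irrefl _ hlam

/-- With s = ∫Sφ·φ ≤ 0, the interior energy is (λ − 1/2)s and satisfies 0 ≤ (λ − 1/2)s ≤ −s. The
left inequality gives s = 0 when λ > 1/2, the right one when λ < −1/2. -/
theorem npAdjoint_eigen_eq_zero (hD : IsBoundedC2Domain D) (hlam : 1 / 2 < |lam|)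
    (hφ : IsBoundedDensity D φ)
    (h : ∀ᵐ x ∂(arcLength D), lam * φ x - npAdjoint D φ x = 0) :
    ∀ᵐ x ∂(arcLength D), φ x = 0 := by
  have hh : ∀ᵐ x ∂(arcLength D), lam * φ x - npAdjoint D φ x =
      normalDeriv D (fun _ => (0 : ℝ)) x := by
    simpa only [normalDeriv_const] using h
  have h0 := integral_eq_zero_of_solves hD hlam hφ (isHarmonic_const 0) hh
  refine hφ.ae_eq_zero hD h0 ?_
  have h1 := energy_self_nonneg hD hφ (isHarmonic_const 0)
  have h2 := hφ.energy_le hD h0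
  have h3 := hφ.integral_singleLayer_mul_self_nonpos hD h0
  rw [energy_eq_of_solves hh] at h1 h2
  simp only [add_zero] at h1 h2
  rcases lt_abs.1 hlam with hl | hl <;> nlinarith

/-- The kernel is even in x − y. Fubini is applied to the smoothed, continuous kernel, and the
symmetry passes to the limit. -/
theorem integral_singleLayer_mul_symm (hD : IsBoundedC2Domain D) (hφ : IsBoundedDensity D φ)
    (hψ : IsBoundedDensity D ψ) : ∫ z, singleLayer D φ z * ψ z ∂(arcLength D) =
      ∫ z, singleLayer D ψ z * φ z ∂(arcLength D) := by
  have := hD.isFiniteMeasure_arcLength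
  have hlim : ∀ {φ ψ : Plane → ℝ}, IsBoundedDensity D φ → IsBoundedDensity D ψ →
      Tendsto (fun e => ∫ z, smoothU e D φ z * ψ z ∂(arcLength D)) (𝓝[>] 0)
        (𝓝 (∫ z, singleLayer D φ z * ψ z ∂(arcLength D))) := by
    intro φ ψ hφ hψ
    obtain ⟨C, hC0, hC⟩ := hφ.exists_abs_smoothU_le hD
    obtain ⟨R, hR0, hR⟩ := hD.exists_norm_le
    obtain ⟨M, hM0, hM⟩ := hψ.exists_bound
    refine tendsto_integral_filter_of_dominated_convergence (fun _ => C * (1 + R) * M) ?_ ?_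
      (integrable_const _) ?_
    · filter_upwards [self_mem_nhdsWithin] with e he
      exact (hφ.contDiff_smoothU hD he).continuous.aestronglyMeasurable.mul hψ.1
    · filter_upwards [Ioc_mem_nhdsGT one_pos] with e he
      filter_upwards [hM, ae_mem_frontier D] with z h1 h2
      rw [norm_mul]
      refine mul_le_mul ((hC e he z).trans ?_) h1 (norm_nonneg _) (by positivity)
      have := hR z h2
      gcongr
    · exact Filter.Eventually.of_forall fun z => (hφ.tendsto_smoothU' hD z).mul_const _
  refine tendsto_nhds_unique (hlim hφ hψ) ((hlim hψ hφ).congr' ?_)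
  filter_upwards [self_mem_nhdsWithin] with e he
  have hgc := (contDiff_gam he).continuous
  obtain ⟨M, hM0, hM⟩ := hφ.exists_bound
  obtain ⟨N, hN0, hN⟩ := hψ.exists_bound
  obtain ⟨R, hR0, hR⟩ := hD.exists_norm_le
  obtain ⟨B, hB⟩ := (isCompact_closedBall (0 : Plane) (R + R)).exists_bound_of_continuousOn
    hgc.continuousOn
  simp only [smoothU, ← integral_mul_const]
  rw [integral_integral_swap]
  · refine integral_congr_ae (Filter.Eventually.of_forall fun x => ?_)
    refine integral_congr_ae (Filter.Eventually.of_forall fun y => ?_)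
    have : gam e (x - y) = gam e (y - x) := by simp only [gam, norm_sub_rev]
    simp only [smul_eq_mul, this]
    ring
  · refine (integrable_const (N * B * M)).mono' ?_ ?_
    · exact ((hψ.1.comp_snd).smul (by fun_prop : Continuous fun p : Plane × Plane =>
        gam e (p.1 - p.2)).aestronglyMeasurable).mul hφ.1.comp_fst
    · filter_upwards [Measure.quasiMeasurePreserving_fst.ae (hM.and (ae_mem_frontier D)),
        Measure.quasiMeasurePreserving_snd.ae (hN.and (ae_mem_frontier D))] with p ⟨h1, h2⟩ ⟨h3, h4⟩
      simp only [Function.uncurry]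
      rw [norm_mul, norm_smul]
      have h5 : ‖gam e (p.1 - p.2)‖ ≤ B := by
        refine hB _ ?_
        rw [mem_closedBall_zero_iff]
        exact (norm_sub_le _ _).trans (add_le_add (hR _ h2) (hR _ h4))
      have hB0 := (norm_nonneg _).trans h5
      gcongr
      · exact h3
      · exact h1

theorem sub_half_ne_zero (hlam : 1 / 2 < |lam|) : lam - 1 / 2 ≠ 0 := fun h => by
  have : lam = 1 / 2 := by linarith
  rw [this, abs_of_pos (by norm_num)] at hlam
  exact lt_irrefl _ hlam

theorem integral_singleLayer_add_mul (hD : IsBoundedC2Domain D) (hφ : IsBoundedDensity D φ)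
    (hψ : IsBoundedDensity D ψ) (hf : IsHarmonic f) :
    ∫ z, (singleLayer D φ z + f z) * ψ z ∂(arcLength D) =
      ∫ z, singleLayer D φ z * ψ z ∂(arcLength D) + ∫ z, f z * ψ z ∂(arcLength D) := by
  simp_rw [add_mul]
  exact integral_add (((hφ.isBoundedDensity_singleLayer hD).mul hψ).integrable hD)
    (((IsBoundedDensity.of_continuous hD hf.contDiff.continuous).mul hψ).integrable hD)

/-- Symmetry of the polarization form. -/
theorem integral_mul_symm (hD : IsBoundedC2Domain D) (hlam : 1 / 2 < |lam|)
    (hφ : IsBoundedDensity D φ) (hψ : IsBoundedDensity D ψ) (hf : IsHarmonic f)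
    (hg : IsHarmonic g)
    (h : ∀ᵐ x ∂(arcLength D), lam * φ x - npAdjoint D φ x = normalDeriv D f x)
    (h' : ∀ᵐ x ∂(arcLength D), lam * ψ x - npAdjoint D ψ x = normalDeriv D g x) :
    ∫ z, f z * ψ z ∂(arcLength D) = ∫ z, g z * φ z ∂(arcLength D) := by
  have h1 := energy_symm hD hφ hψ hf hg
  rw [energy_eq_of_solves h, energy_eq_of_solves h'] at h1
  -- Both sides of the symmetry carry the factor λ − 1/2. Once it is cancelled, the symmetric
  -- contributions of S drop out.
  have h2 := mul_left_cancel₀ (sub_half_ne_zero hlam) h1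
  rw [integral_singleLayer_add_mul hD hφ hψ hf, integral_singleLayer_add_mul hD hψ hφ hg,
    integral_singleLayer_mul_symm hD hφ hψ] at h2
  linarith

theorem integral_mul_normalDeriv_nonneg (hD : IsBoundedC2Domain D) (hf : IsHarmonic f) :
    0 ≤ ∫ z, f z * normalDeriv D f z ∂(arcLength D) := by
  have h := energy_self_nonneg hD (IsBoundedDensity.const D 0) hf
  simpa [energy, singleLayer_zero, npAdjoint_zero] using h

/-- Positivity of the polarization form for `lam > 1/2`. -/
theorem integral_mul_nonneg_of_solves (hD : IsBoundedC2Domain D) (hlam : 1 / 2 < lam)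
    (hφ : IsBoundedDensity D φ) (hf : IsHarmonic f)
    (h : ∀ᵐ x ∂(arcLength D), lam * φ x - npAdjoint D φ x = normalDeriv D f x) :
    0 ≤ ∫ z, f z * φ z ∂(arcLength D) ∧
      (0 < ∫ z, f z * normalDeriv D f z ∂(arcLength D) →
        0 < ∫ z, f z * φ z ∂(arcLength D)) := by
  have hlam' : 1 / 2 < |lam| := hlam.trans_le (le_abs_self _)
  have h0 := integral_eq_zero_of_solves hD hlam' hφ hf h
  have h1 := energy_self_nonneg hD hφ hf
  have h2 := hφ.integral_singleLayer_mul_self_nonpos hD h0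
  rw [energy_eq_of_solves h, integral_singleLayer_add_mul hD hφ hφ hf] at h1
  -- Thus ∫fφ ≥ −∫Sφ·φ ≥ 0. If ∫fφ were 0, the single layer energy would vanish, hence φ and then
  -- ∂f/∂ν.
  have h3 := nonneg_of_mul_nonneg_right h1 (sub_pos.2 hlam)
  refine ⟨by linarith, fun hE => ?_⟩
  by_contra hn
  have h4 := hφ.ae_eq_zero hD h0 (by linarith)
  refine hE.ne' ?_
  rw [← integral_zero Plane ℝ (μ := arcLength D)]
  refine integral_congr_ae ?_
  have h5 : ∀ x, npAdjoint D φ x = 0 := by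
    intro x
    rw [npAdjoint, ← integral_zero Plane ℝ (μ := arcLength D)]
    refine integral_congr_ae ?_
    filter_upwards [h4] with y hy
    rw [hy, mul_zero]
  filter_upwards [h, h4] with x hx hx'
  rw [← hx, hx', h5]
  ring

/-- Negativity of the polarization form for `lam < -1/2`. -/
theorem integral_mul_nonpos_of_solves (hD : IsBoundedC2Domain D) (hlam : lam < -(1 / 2))
    (hφ : IsBoundedDensity D φ) (hf : IsHarmonic f)
    (h : ∀ᵐ x ∂(arcLength D), lam * φ x - npAdjoint D φ x = normalDeriv D f x) :
    ∫ z, f z * φ z ∂(arcLength D) ≤ 0 ∧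
      (0 < ∫ z, f z * normalDeriv D f z ∂(arcLength D) →
        ∫ z, f z * φ z ∂(arcLength D) < 0) := by
  have hlam' : 1 / 2 < |lam| := by rw [lt_abs]; right; linarith
  have h0 := integral_eq_zero_of_solves hD hlam' hφ hf h
  have hz := IsBoundedDensity.const D 0
  have hE0 := integral_mul_normalDeriv_nonneg hD hf
  -- The cross energy of Sφ and f is computed in both orders. With s = ∫Sφ·φ, k = ∫Sφ·K*φ, M = ∫fφ
  -- and E = ∫f ∂f/∂ν, this reads λs − k = (λ − 1/2)M − E. Comparing interior and total energy gives
  -- k − s/2 ≤ −s, hence (λ − 1/2)M ≥ E + (λ + 1/2)s ≥ E.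
  have h1 := energy_symm hD hφ hz (isHarmonic_const 0) hf
  have h2 := hφ.integral_singleLayer_mul_self_nonpos hD h0
  have h3 := hφ.energy_le hD h0
  have hS := hφ.isBoundedDensity_singleLayer hD
  have hK := isBoundedDensity_npAdjoint hD (hφ.integrable hD)
  have hfb := IsBoundedDensity.of_continuous hD hf.contDiff.continuous
  have hnb := isBoundedDensity_normalDeriv hD
    (hf.contDiff.of_le (by norm_num) : ContDiff ℝ 1 f)
  have e1 : energy D φ (fun _ => 0) (fun _ => 0) f =
      lam * ∫ z, singleLayer D φ z * φ z ∂(arcLength D) -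
        ∫ z, singleLayer D φ z * npAdjoint D φ z ∂(arcLength D) := by
    rw [energy, ← integral_const_mul, ← integral_sub (((hS.mul hφ).const_mul _).integrable hD)
      ((hS.mul hK).integrable hD)]
    refine integral_congr_ae ?_
    filter_upwards [h] with x hx
    simp only [npAdjoint_zero]
    rw [← hx]
    ring
  have e2 : energy D (fun _ => 0) f φ (fun _ => 0) =
      (lam - 1 / 2) * ∫ z, f z * φ z ∂(arcLength D) -
        ∫ z, f z * normalDeriv D f z ∂(arcLength D) := by
    rw [energy, ← integral_const_mul, ← integral_sub (((hfb.mul hφ).const_mul _).integrable hD)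
      ((hfb.mul hnb).integrable hD)]
    refine integral_congr_ae ?_
    filter_upwards [h] with x hx
    simp only [singleLayer_zero, normalDeriv_const]
    rw [← hx]
    ring
  have e3 : energy D φ (fun _ => 0) φ (fun _ => 0) =
      ∫ z, singleLayer D φ z * npAdjoint D φ z ∂(arcLength D) -
        1 / 2 * ∫ z, singleLayer D φ z * φ z ∂(arcLength D) := by
    rw [energy, ← integral_const_mul, ← integral_sub ((hS.mul hK).integrable hD)
      (((hS.mul hφ).const_mul _).integrable hD)]
    refine integral_congr_ae (Filter.Eventually.of_forall fun x => ?_)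
    simp only [normalDeriv_const]
    ring
  rw [e1, e2] at h1
  rw [e3] at h3
  set s := ∫ z, singleLayer D φ z * φ z ∂(arcLength D)
  set M := ∫ z, f z * φ z ∂(arcLength D)
  have h4 : 0 ≤ (lam + 1 / 2) * s := mul_nonneg_of_nonpos_of_nonpos (by linarith) h2
  constructor
  · by_contra hn
    nlinarith
  · intro hE
    by_contra hn
    nlinarith

end
end CGPT
end

/-! ### Compactness of K* and existence of the resolvent. -/

noncomputable section
namespace CGPT
open MeasureTheory Set Filter Topology Metric
open scoped ENNReal NNReal ContDiff Real

section
variable {D : Set Plane} {lam : ℝ} {φ ψ g : Plane → ℝ}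

theorem IsBoundedDensity.memLp (hφ : IsBoundedDensity D φ) (hD : IsBoundedC2Domain D) :
    MemLp φ 2 (arcLength D) := by
  have := hD.isFiniteMeasure_arcLength
  obtain ⟨M, -, hM⟩ := hφ.exists_bound
  exact MemLp.of_bound hφ.1 M hM

theorem integrable_of_memLp (hD : IsBoundedC2Domain D) (hφ : MemLp φ 2 (arcLength D)) :
    Integrable φ (arcLength D) := by
  have := hD.isFiniteMeasure_arcLength
  exact hφ.integrable (by norm_num)

theorem npAdjoint_congr (h : φ =ᵐ[arcLength D] ψ) (x : Plane) :
    npAdjoint D φ x = npAdjoint D ψ x := by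
  refine integral_congr_ae ?_
  filter_upwards [h] with y hy
  rw [hy]

theorem npAdjoint_add (hD : IsBoundedC2Domain D) (hφ : Integrable φ (arcLength D))
    (hψ : Integrable ψ (arcLength D)) {x : Plane} (hx : x ∈ frontier D) :
    npAdjoint D (fun y => φ y + ψ y) x = npAdjoint D φ x + npAdjoint D ψ x := by
  simp only [npAdjoint, mul_add]
  exact integral_add (integrable_npKernel_mul hD hφ hx) (integrable_npKernel_mul hD hψ hx)

theorem npAdjoint_const_mul (c : ℝ) (x : Plane) :
    npAdjoint D (fun y => c * φ y) x = c * npAdjoint D φ x := by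
  simp only [npAdjoint, mul_left_comm _ c]
  exact integral_const_mul _ _

/-- Regularity by bootstrap: φ = λ⁻¹(g + K*φ), and K* maps L² to bounded functions. The energy
arguments, made for bounded densities, thereby reach every L² solution. -/
theorem IsBoundedDensity.of_solves (hD : IsBoundedC2Domain D) (hlam : lam ≠ 0)
    (hφ : MemLp φ 2 (arcLength D)) (hg : IsBoundedDensity D g)
    (h : ∀ᵐ x ∂(arcLength D), lam * φ x - npAdjoint D φ x = g x) : IsBoundedDensity D φ := by
  refine ((hg.add (isBoundedDensity_npAdjoint hD (integrable_of_memLp hD hφ))).const_mul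
    lam⁻¹).congr ?_
  filter_upwards [h] with x hx
  rw [← hx]
  field_simp
  ring

/-- The adjoint Neumann–Poincaré operator on `L²`. -/
def npOperator (hD : IsBoundedC2Domain D) :
    Lp ℝ 2 (arcLength D) →ₗ[ℝ] Lp ℝ 2 (arcLength D) where
  toFun φ := ((isBoundedDensity_npAdjoint hD
    (integrable_of_memLp hD (Lp.memLp φ))).memLp hD).toLp (npAdjoint D φ)
  map_add' φ ψ := by
    rw [← MemLp.toLp_add]
    refine MemLp.toLp_congr _ _ ?_
    filter_upwards [ae_mem_frontier D] with x hx
    rw [npAdjoint_congr (Lp.coeFn_add φ ψ)]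
    exact npAdjoint_add hD (integrable_of_memLp hD (Lp.memLp φ))
      (integrable_of_memLp hD (Lp.memLp ψ)) hx
  map_smul' c φ := by
    rw [RingHom.id_apply, ← MemLp.toLp_const_smul]
    refine MemLp.toLp_congr _ _ (Filter.Eventually.of_forall fun x => ?_)
    rw [npAdjoint_congr (Lp.coeFn_smul c φ)]
    exact npAdjoint_const_mul c x

theorem coeFn_npOperator (hD : IsBoundedC2Domain D) (φ : Lp ℝ 2 (arcLength D)) :
    npOperator hD φ =ᵐ[arcLength D] npAdjoint D φ :=
  MemLp.coeFn_toLp ((isBoundedDensity_npAdjoint hD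
    (integrable_of_memLp hD (Lp.memLp φ))).memLp hD)

theorem norm_sq_eq_integral (φ : Lp ℝ 2 (arcLength D)) :
    ‖φ‖ ^ 2 = ∫ x, φ x ^ 2 ∂(arcLength D) := by
  rw [← real_inner_self_eq_norm_sq, L2.inner_def]
  congr 1
  ext x
  rw [real_inner_self_eq_norm_sq, Real.norm_eq_abs, sq_abs]

/-- The operator is given by pairing with a square integrable kernel. -/
theorem npAdjoint_eq_inner (hD : IsBoundedC2Domain D) {x : Plane} (hx : x ∈ frontier D) :
    ∃ k : Lp ℝ 2 (arcLength D), ∀ φ : Lp ℝ 2 (arcLength D), npAdjoint D φ x = inner ℝ φ k := by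
  have := hD.isFiniteMeasure_arcLength
  obtain ⟨C, hC0, hC⟩ := hD.exists_abs_npKernel_le
  have hk : MemLp (fun y => npKernel D y x) 2 (arcLength D) := by
    refine MemLp.of_bound (aestronglyMeasurable_npKernel_right D x) C ?_
    filter_upwards [ae_mem_frontier D] with y hy using (hC x hx y hy).1
  refine ⟨hk.toLp, fun φ => ?_⟩
  rw [L2.inner_def, npAdjoint]
  refine integral_congr_ae ?_
  filter_upwards [hk.coeFn_toLp] with y hy
  rw [hy]
  simp

theorem exists_abs_npAdjoint_le (hD : IsBoundedC2Domain D) : ∃ C : ℝ, 0 ≤ C ∧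
    ∀ φ : Lp ℝ 2 (arcLength D), ‖φ‖ ≤ 1 → ∀ x ∈ frontier D, |npAdjoint D φ x| ≤ C := by
  have := hD.isFiniteMeasure_arcLength
  obtain ⟨C, hC0, hC⟩ := hD.exists_abs_npKernel_le
  refine ⟨C * ((arcLength D).real univ + 1), by positivity, fun φ hφ x hx => ?_⟩
  have hi := integrable_of_memLp hD (Lp.memLp φ)
  have hsq : Integrable (fun y => φ y ^ 2) (arcLength D) := (Lp.memLp φ).integrable_sq
  -- The elementary bound |φ| ≤ 1 + φ² stands in for Cauchy–Schwarz.
  have h1 : |npAdjoint D φ x| ≤ ∫ y, C * (1 + φ y ^ 2) ∂(arcLength D) := by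
    rw [← Real.norm_eq_abs, npAdjoint]
    refine norm_integral_le_of_norm_le (((integrable_const 1).add hsq).const_mul C) ?_
    filter_upwards [ae_mem_frontier D] with y hy
    rw [norm_mul]
    refine mul_le_mul (hC x hx y hy).1 ?_ (norm_nonneg _) hC0
    rw [Real.norm_eq_abs, ← sq_abs]
    nlinarith [sq_nonneg (|φ y| - 1), abs_nonneg (φ y)]
  refine h1.trans ?_
  rw [integral_const_mul, integral_add (integrable_const _) hsq, ← norm_sq_eq_integral,
    integral_const, smul_eq_mul, mul_one]
  gcongr
  nlinarith [norm_nonneg φ]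

/-- A sequence in the unit ball has a weakly convergent subsequence. Since K*φ(x) is a pairing of φ
with a fixed L² function, the images converge pointwise on the boundary, and the uniform bound turns
this into L² convergence. -/
theorem isCompactOperator_npOperator (hD : IsBoundedC2Domain D) :
    IsCompactOperator (npOperator hD) := by
  have := hD.isFiniteMeasure_arcLength
  -- A finite exponent makes L² separable, as sequential weak-* compactness requires.
  have : Fact ((2 : ℝ≥0∞) ≠ ⊤) := ⟨by norm_num⟩
  rw [isCompactOperator_iff_image_closedBall_subset_compact _ one_pos]
  -- The image of the closed ball is itself compact, because the weak limit stays in the ball.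
  refine ⟨_, IsSeqCompact.isCompact ?_, Subset.rfl⟩
  intro u hu
  choose φ hφ hφu using hu
  have hφ1 : ∀ n, ‖φ n‖ ≤ 1 := fun n => mem_closedBall_zero_iff.1 (hφ n)
  obtain ⟨ξ, hξ, s, hs, hlim⟩ := WeakDual.isSeqCompact_closedBall ℝ
    (Lp ℝ 2 (arcLength D)) 0 1
    (x := fun n => StrongDual.toWeakDual (InnerProductSpace.toDual ℝ _ (φ n))) (fun n => by
      rw [mem_preimage, mem_closedBall_zero_iff]
      simpa using hφ1 n)
  set χ := (InnerProductSpace.toDual ℝ _).symm (WeakDual.toStrongDual ξ) with hχ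
  have hχ1 : ‖χ‖ ≤ 1 := by
    rw [hχ, LinearIsometryEquiv.norm_map]
    simpa using hξ
  have hin : ∀ k : Lp ℝ 2 (arcLength D),
      Tendsto (fun n => inner ℝ (φ (s n)) k) atTop (𝓝 (inner ℝ χ k)) := by
    intro k
    have h1 := (WeakDual.eval_continuous k).continuousAt.tendsto.comp hlim
    have h2 : WeakDual.toStrongDual ξ k = inner ℝ χ k := by
      rw [hχ, InnerProductSpace.toDual_symm_apply]
    rw [← h2]
    exact h1
  obtain ⟨C, hC0, hC⟩ := exists_abs_npAdjoint_le hD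
  refine ⟨npOperator hD χ, ⟨χ, by simpa using hχ1, rfl⟩, s, hs, ?_⟩
  have hu' : u ∘ s = fun n => npOperator hD (φ (s n)) := by
    ext1 n
    exact (hφu (s n)).symm
  rw [hu', tendsto_iff_norm_sub_tendsto_zero]
  have h2 : Tendsto (fun n => ‖npOperator hD (φ (s n)) - npOperator hD χ‖ ^ 2) atTop (𝓝 0) := by
    have h3 : ∀ n, ‖npOperator hD (φ (s n)) - npOperator hD χ‖ ^ 2 =
        ∫ x, (npAdjoint D (φ (s n)) x - npAdjoint D χ x) ^ 2 ∂(arcLength D) := by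
      intro n
      rw [norm_sq_eq_integral]
      refine integral_congr_ae ?_
      filter_upwards [Lp.coeFn_sub (npOperator hD (φ (s n))) (npOperator hD χ),
        coeFn_npOperator hD (φ (s n)), coeFn_npOperator hD χ] with x h1 h2 h3
      rw [h1, Pi.sub_apply, h2, h3]
    simp_rw [h3]
    rw [← integral_zero Plane ℝ (μ := arcLength D)]
    refine tendsto_integral_of_dominated_convergence (fun _ => (C + C) ^ 2) ?_
      (integrable_const _) ?_ ?_
    · intro n
      exact ((isBoundedDensity_npAdjoint hD (integrable_of_memLp hD (Lp.memLp _))).1.sub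
        (isBoundedDensity_npAdjoint hD (integrable_of_memLp hD (Lp.memLp _))).1).pow 2
    · intro n
      filter_upwards [ae_mem_frontier D] with x hx
      rw [norm_pow]
      gcongr
      exact (norm_sub_le _ _).trans (add_le_add (hC _ (hφ1 _) x hx) (hC _ hχ1 x hx))
    · filter_upwards [ae_mem_frontier D] with x hx
      obtain ⟨k, hk⟩ := npAdjoint_eq_inner hD hx
      simp_rw [hk]
      simpa using ((hin k).sub_const (inner ℝ χ k)).pow 2
  have h4 := (Real.continuous_sqrt.tendsto 0).comp h2
  simpa [Function.comp_def, Real.sqrt_sq (norm_nonneg _)] using h4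

/-- Fredholm alternative: for compact K*, a number λ ≠ 0 is an eigenvalue or lies in the resolvent
set, and `npAdjoint_eigen_eq_zero` excludes the former. -/
theorem resolventExists (hD : IsBoundedC2Domain D) (hlam : 1 / 2 < |lam|) :
    ResolventExists D lam := by
  have hlam0 : lam ≠ 0 := by
    rintro rfl
    rw [abs_zero] at hlam
    norm_num at hlam
  have hinj : ∀ φ : Plane → ℝ, MemLp φ 2 (arcLength D) →
      (∀ᵐ x ∂(arcLength D), lam * φ x - npAdjoint D φ x = 0) → ∀ᵐ x ∂(arcLength D), φ x = 0 :=
    fun φ hφ h => npAdjoint_eigen_eq_zero hD hlam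
      (IsBoundedDensity.of_solves hD hlam0 hφ (IsBoundedDensity.const D 0) h) h
  have hcomp := isCompactOperator_npOperator hD
  set T := ContinuousLinearMap.mkOfIsCompactOperator hcomp with hT
  have hTφ : ∀ φ, T φ = npOperator hD φ := fun _ => rfl
  have hcT : IsCompactOperator T := hcomp
  have hres := (hcT.hasEigenvalue_or_mem_resolventSet hlam0).resolve_left fun he => by
    obtain ⟨φ, hφ⟩ := he.exists_hasEigenvector
    refine hφ.2 ?_
    have h1 : npOperator hD φ = lam • φ := hφ.apply_eq_smul
    rw [Lp.eq_zero_iff_ae_eq_zero]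
    refine hinj φ (Lp.memLp φ) ?_
    have h2 := coeFn_npOperator hD φ
    rw [h1] at h2
    filter_upwards [h2, Lp.coeFn_smul lam φ] with x h3 h4
    rw [← h3, h4]
    simp
  intro g hg
  rw [spectrum.mem_resolventSet_iff, ContinuousLinearMap.isUnit_iff_bijective] at hres
  obtain ⟨φ, hφ⟩ := hres.2 hg.toLp
  have hsol : SolvesNP D lam g φ := by
    refine ⟨Lp.memLp φ, ?_⟩
    have h1 : lam • φ - npOperator hD φ = hg.toLp := by
      rw [← hφ]
      simp [Algebra.algebraMap_eq_smul_one, hTφ]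
    filter_upwards [Lp.coeFn_sub (lam • φ) (npOperator hD φ), Lp.coeFn_smul lam φ,
      coeFn_npOperator hD φ, hg.coeFn_toLp] with x h2 h3 h4 h5
    rw [h1, Pi.sub_apply, h3, h4, h5] at h2
    rw [h2]
    simp
  refine ⟨φ, hsol, fun ψ hψ => ?_⟩
  have h0 := hinj (fun x => ψ x + (-1) * φ x) (hψ.1.add (hsol.1.const_mul (-1))) ?_
  · filter_upwards [h0] with x hx
    linarith
  · filter_upwards [hψ.2, hsol.2, ae_mem_frontier D] with x h1 h2 hx
    rw [npAdjoint_add hD (integrable_of_memLp hD hψ.1)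
      ((integrable_of_memLp hD hsol.1).const_mul _) hx, npAdjoint_const_mul]
    linarith

end
end CGPT
end

/-! ### Harmonic polynomials and the contracted tensors. -/

noncomputable section
namespace CGPT
open MeasureTheory Set Filter Topology Metric
open scoped ENNReal NNReal ContDiff Real

/-- The identification of the plane with `ℂ`. -/
def toComplex : Plane →L[ℝ] ℂ :=
  Complex.ofRealCLM ∘L EuclideanSpace.proj 0 +
    Complex.I • (Complex.ofRealCLM ∘L EuclideanSpace.proj 1)

theorem toComplex_apply (y : Plane) : toComplex y = (y 0 : ℂ) + Complex.I * (y 1 : ℂ) := rfl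

/-- The harmonic polynomial `Re (c z^m)`. -/
def harmonicPoly (c : ℂ) (m : ℕ) (y : Plane) : ℝ := (c * toComplex y ^ m).re

theorem contDiff_harmonicPoly (c : ℂ) (m : ℕ) {k : WithTop ℕ∞} :
    ContDiff ℝ k (harmonicPoly c m) :=
  Complex.reCLM.contDiff.comp (contDiff_const.mul (toComplex.contDiff.pow m))

/-- For m = 0 the factor m vanishes, so the truncated exponent m − 1 is harmless. -/
theorem fderiv_harmonicPoly (c : ℂ) (m : ℕ) (y v : Plane) :
    fderiv ℝ (harmonicPoly c m) y v =
      harmonicPoly (c * m * toComplex v) (m - 1) y := by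
  have h1 : HasFDerivAt (fun y => toComplex y) toComplex y := toComplex.hasFDerivAt
  have h2 := Complex.reCLM.hasFDerivAt.comp y ((h1.pow m).const_mul c)
  have h3 : fderiv ℝ (harmonicPoly c m) y = _ := h2.fderiv
  rw [h3, harmonicPoly]
  simp only [ContinuousLinearMap.comp_apply, smul_apply, Complex.reCLM_apply, smul_eq_mul,
    nsmul_eq_mul]
  congr 1
  ring

theorem toComplex_single_zero : toComplex (EuclideanSpace.single 0 1) = 1 := by
  simp [toComplex_apply]

theorem toComplex_single_one : toComplex (EuclideanSpace.single 1 1) = Complex.I := by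
  simp [toComplex_apply]

theorem gradient_apply (f : Plane → ℝ) (y : Plane) (i : Fin 2) :
    gradient f y i = fderiv ℝ f y (EuclideanSpace.single i 1) := by
  rw [← inner_gradient, EuclideanSpace.inner_single_right]
  simp

/-- The second derivatives along 1 and along i differ by the factor i² = −1. -/
theorem isHarmonic_harmonicPoly (c : ℂ) (m : ℕ) : IsHarmonic (harmonicPoly c m) := by
  refine ⟨contDiff_harmonicPoly c m, fun x => ?_⟩
  have hd : DifferentiableAt ℝ (gradient (harmonicPoly c m)) x :=
    (contDiff_gradient (contDiff_harmonicPoly c m)).differentiable one_ne_zero x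
  have h : ∀ i, (fderiv ℝ (gradient (harmonicPoly c m)) x (EuclideanSpace.single i 1)) i =
      fderiv ℝ (harmonicPoly (c * m * toComplex (EuclideanSpace.single i 1)) (m - 1)) x
        (EuclideanSpace.single i 1) := by
    intro i
    have h1 : (fun y => gradient (harmonicPoly c m) y i) =
        harmonicPoly (c * m * toComplex (EuclideanSpace.single i 1)) (m - 1) := by
      ext y
      rw [gradient_apply, fderiv_harmonicPoly]
    have h2 := ((EuclideanSpace.proj i : Plane →L[ℝ] ℝ).hasFDerivAt.comp x hd.hasFDerivAt).fderiv
    have h3 : ((EuclideanSpace.proj i : Plane →L[ℝ] ℝ) ∘ gradient (harmonicPoly c m)) =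
        fun y => gradient (harmonicPoly c m) y i := rfl
    rw [h3, h1] at h2
    rw [h2]
    rfl
  rw [div, Fin.sum_univ_two, h, h, fderiv_harmonicPoly, fderiv_harmonicPoly,
    toComplex_single_zero, toComplex_single_one]
  simp only [harmonicPoly]
  rw [← Complex.add_re]
  have : c * m * 1 * ((m - 1 : ℕ) : ℂ) * 1 * toComplex x ^ (m - 1 - 1) +
      c * m * Complex.I * ((m - 1 : ℕ) : ℂ) * Complex.I * toComplex x ^ (m - 1 - 1) = 0 := by
    linear_combination (c * m * ((m - 1 : ℕ) : ℂ) * toComplex x ^ (m - 1 - 1)) * Complex.I_mul_I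
  rw [this, Complex.zero_re]

/-- With w = c m z^(m−1), the partial derivatives are Re w and Re(iw) = −Im w. -/
theorem norm_sq_gradient_harmonicPoly (c : ℂ) (m : ℕ) (y : Plane) :
    fderiv ℝ (harmonicPoly c m) y (gradient (harmonicPoly c m) y) =
      Complex.normSq (c * m * toComplex y ^ (m - 1)) := by
  rw [← inner_gradient, real_inner_self_eq_norm_sq, EuclideanSpace.real_norm_sq_eq,
    Fin.sum_univ_two, gradient_apply, gradient_apply, fderiv_harmonicPoly, fderiv_harmonicPoly,
    toComplex_single_zero, toComplex_single_one, Complex.normSq_apply]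
  simp only [harmonicPoly, mul_one]
  rw [mul_right_comm _ Complex.I, Complex.mul_I_re]
  ring

/-- A nonconstant harmonic polynomial has positive Dirichlet energy. -/
theorem integral_harmonicPoly_mul_normalDeriv_pos {D : Set Plane} (hD : IsBoundedC2Domain D)
    {c : ℂ} (hc : c ≠ 0) {m : ℕ} (hm : 0 < m) :
    0 < ∫ y, harmonicPoly c m y * normalDeriv D (harmonicPoly c m) y ∂(arcLength D) := by
  have hf : ContDiff ℝ 2 (harmonicPoly c m) := contDiff_harmonicPoly c m
  have h := hD.green (hf.of_le (by norm_num)) (contDiff_gradient hf)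
  simp_rw [(isHarmonic_harmonicPoly c m).div_gradient, norm_sq_gradient_harmonicPoly, mul_zero,
    add_zero] at h
  unfold normalDeriv
  rw [← h]
  have hcont : Continuous fun y => Complex.normSq (c * m * toComplex y ^ (m - 1)) :=
    Complex.continuous_normSq.comp (continuous_const.mul (toComplex.continuous.pow _))
  have hint : IntegrableOn (fun y => Complex.normSq (c * m * toComplex y ^ (m - 1))) D :=
    (hcont.continuousOn.integrableOn_compact hD.isCompact_closure).mono_set subset_closure
  rw [setIntegral_pos_iff_support_of_nonneg_ae
    (Filter.Eventually.of_forall fun y => Complex.normSq_nonneg _) hint]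
  -- The integrand can vanish only at the origin, a null set, while D is open and nonempty.
  refine lt_of_lt_of_le ?_ (measure_mono (s := D \ {0}) fun y hy => ⟨?_, hy.1⟩)
  · rw [measure_sdiff_null (measure_singleton 0)]
    exact hD.isOpen.measure_pos _ hD.isConnected.nonempty
  · rw [Function.mem_support, Ne, Complex.normSq_eq_zero]
    refine mul_ne_zero (mul_ne_zero hc (by exact_mod_cast hm.ne')) (pow_ne_zero _ fun h0 => hy.2 ?_)
    rw [toComplex_apply] at h0
    have hr := congrArg Complex.re h0
    have hi := congrArg Complex.im h0
    simp at hr hi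
    ext i
    fin_cases i
    · simpa using hr
    · simpa using hi

/-- The homogeneous polynomial with coefficients `p`. -/
def homPoly (m : ℕ) (p : ℕ × ℕ → ℝ) (y : Plane) : ℝ :=
  ∑ α ∈ Finset.HasAntidiagonal.antidiagonal m, p α * monomial α y

theorem homPoly_coeffRe (m : ℕ) : homPoly m (coeffRe m) = harmonicPoly 1 m := by
  ext y
  have h := congrArg Complex.re (pow_eq_coeff m y)
  rw [harmonicPoly, toComplex_apply, one_mul, h, homPoly]
  simp

theorem homPoly_coeffIm (m : ℕ) : homPoly m (coeffIm m) = harmonicPoly (-Complex.I) m := by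
  ext y
  have h := congrArg Complex.im (pow_eq_coeff m y)
  rw [harmonicPoly, toComplex_apply, neg_mul, Complex.neg_re, Complex.I_mul_re, neg_neg, h,
    homPoly]
  simp

theorem contDiff_monomial (α : ℕ × ℕ) {k : WithTop ℕ∞} : ContDiff ℝ k (monomial α) := by
  have h : ∀ i : Fin 2, ContDiff ℝ k fun y : Plane => y i := fun i =>
    (EuclideanSpace.proj i : Plane →L[ℝ] ℝ).contDiff
  exact ((h 0).pow _).mul ((h 1).pow _)

theorem normalDeriv_homPoly (D : Set Plane) (m : ℕ) (p : ℕ × ℕ → ℝ) (y : Plane) :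
    normalDeriv D (homPoly m p) y =
      ∑ α ∈ Finset.HasAntidiagonal.antidiagonal m, p α * normalDeriv D (monomial α) y := by
  have hn : ∀ f : Plane → ℝ, normalDeriv D f y = fderiv ℝ f y (normal D y) := fun f => by
    rw [normalDeriv, real_inner_comm, inner_gradient]
  simp only [hn]
  have hd : ∀ α, DifferentiableAt ℝ (monomial α) y := fun α =>
    (contDiff_monomial α (k := 1)).differentiable one_ne_zero y
  have h : fderiv ℝ (homPoly m p) y = ∑ α ∈ Finset.HasAntidiagonal.antidiagonal m,
      p α • fderiv ℝ (monomial α) y := by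
    have h1 := HasFDerivAt.fun_sum (u := Finset.HasAntidiagonal.antidiagonal m)
      (A := fun α y => p α * monomial α y) (A' := fun α => p α • fderiv ℝ (monomial α) y) (x := y)
      fun α _ => (hd α).hasFDerivAt.const_mul (p α)
    exact h1.fderiv
  rw [h]
  simp

section
variable {D : Set Plane} {lam : ℝ}

theorem solves_resolvent (hD : IsBoundedC2Domain D) (hlam : 1 / 2 < |lam|) (α : ℕ × ℕ) :
    SolvesNP D lam (normalDeriv D (monomial α)) (resolvent D lam (normalDeriv D (monomial α))) := by
  have h : ∃ φ, SolvesNP D lam (normalDeriv D (monomial α)) φ :=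
    (resolventExists hD hlam _
      ((isBoundedDensity_normalDeriv hD (contDiff_monomial α)).memLp hD)).imp fun _ h => h.1
  rw [resolvent, dif_pos h]
  exact h.choose_spec

/-- The density `∑ p_α (lam - K^*)⁻¹ [∂ y^α / ∂ν]`. -/
def density (D : Set Plane) (lam : ℝ) (m : ℕ) (p : ℕ × ℕ → ℝ) (y : Plane) : ℝ :=
  ∑ α ∈ Finset.HasAntidiagonal.antidiagonal m, p α * resolvent D lam (normalDeriv D (monomial α)) y

theorem ne_zero_of_half_lt_abs (hlam : 1 / 2 < |lam|) : lam ≠ 0 := by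
  rintro rfl
  rw [abs_zero] at hlam
  norm_num at hlam

theorem isBoundedDensity_resolvent (hD : IsBoundedC2Domain D) (hlam : 1 / 2 < |lam|)
    (α : ℕ × ℕ) : IsBoundedDensity D (resolvent D lam (normalDeriv D (monomial α))) :=
  IsBoundedDensity.of_solves hD (ne_zero_of_half_lt_abs hlam) (solves_resolvent hD hlam α).1
    (isBoundedDensity_normalDeriv hD (contDiff_monomial α)) (solves_resolvent hD hlam α).2

theorem IsBoundedDensity.sum {ι : Type*} (s : Finset ι) {φ : ι → Plane → ℝ}
    (h : ∀ i, IsBoundedDensity D (φ i)) : IsBoundedDensity D fun y => ∑ i ∈ s, φ i y := by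
  classical
  induction s using Finset.induction_on with
  | empty => simpa using IsBoundedDensity.const D 0
  | insert a s ha ih =>
    simp_rw [Finset.sum_insert ha]
    exact (h a).add ih

theorem isBoundedDensity_density (hD : IsBoundedC2Domain D) (hlam : 1 / 2 < |lam|) (m : ℕ)
    (p : ℕ × ℕ → ℝ) : IsBoundedDensity D (density D lam m p) :=
  IsBoundedDensity.sum _ fun α => (isBoundedDensity_resolvent hD hlam α).const_mul (p α)

theorem density_solves (hD : IsBoundedC2Domain D) (hlam : 1 / 2 < |lam|) (m : ℕ)
    (p : ℕ × ℕ → ℝ) : ∀ᵐ x ∂(arcLength D), lam * density D lam m p x -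
      npAdjoint D (density D lam m p) x = normalDeriv D (homPoly m p) x := by
  have h1 : ∀ᵐ x ∂(arcLength D), ∀ α : ℕ × ℕ,
      lam * resolvent D lam (normalDeriv D (monomial α)) x -
        npAdjoint D (resolvent D lam (normalDeriv D (monomial α))) x =
          normalDeriv D (monomial α) x :=
    ae_all_iff.2 fun α => (solves_resolvent hD hlam α).2
  filter_upwards [h1, ae_mem_frontier D] with x hx hxD
  have h2 : npAdjoint D (density D lam m p) x = ∑ α ∈ Finset.HasAntidiagonal.antidiagonal m,
      p α * npAdjoint D (resolvent D lam (normalDeriv D (monomial α))) x := by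
    simp only [npAdjoint, density, Finset.mul_sum]
    rw [integral_finsetSum]
    · refine Finset.sum_congr rfl fun α _ => ?_
      rw [← integral_const_mul]
      congr 1
      ext y
      ring
    · intro α _
      exact integrable_npKernel_mul hD
        (((isBoundedDensity_resolvent hD hlam α).const_mul (p α)).integrable hD) hxD
  rw [h2, normalDeriv_homPoly, density, Finset.mul_sum, ← Finset.sum_sub_distrib]
  refine Finset.sum_congr rfl fun α _ => ?_
  rw [← hx α]
  ring

/-- Bilinearity turns the double sum into one pairing of a polynomial with the solution whose
Neumann data come from the other, the form to which the energy identities apply. -/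
theorem contraction_eq_integral (hD : IsBoundedC2Domain D) (hlam : 1 / 2 < |lam|) (m n : ℕ)
    (p q : ℕ × ℕ → ℝ) : contraction lam D m n p q =
      ∫ y, homPoly n q y * density D lam m p y ∂(arcLength D) := by
  have hi : ∀ α β, IsBoundedDensity D fun y => (q β * monomial β y) *
      (p α * resolvent D lam (normalDeriv D (monomial α)) y) := fun α β =>
    ((IsBoundedDensity.of_continuous hD (contDiff_monomial β (k := 0)).continuous).const_mul _).mul
      ((isBoundedDensity_resolvent hD hlam α).const_mul _)
  simp_rw [homPoly, density, Finset.sum_mul_sum]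
  rw [integral_finsetSum _ fun β _ => (IsBoundedDensity.sum _ fun α => hi α β).integrable hD,
    contraction, Finset.sum_comm]
  refine Finset.sum_congr rfl fun β _ => ?_
  rw [integral_finsetSum _ fun α _ => (hi α β).integrable hD]
  refine Finset.sum_congr rfl fun α _ => ?_
  rw [gpt, ← integral_const_mul]
  congr 1
  ext y
  ring

/-- Harmonicity is asked of the contracted polynomials only, since monomials in general are not
harmonic. -/
theorem contraction_symm (hD : IsBoundedC2Domain D) (hlam : 1 / 2 < |lam|) {m n : ℕ}
    {p q : ℕ × ℕ → ℝ} (hp : IsHarmonic (homPoly m p)) (hq : IsHarmonic (homPoly n q)) :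
    contraction lam D m n p q = contraction lam D n m q p := by
  rw [contraction_eq_integral hD hlam, contraction_eq_integral hD hlam]
  exact integral_mul_symm hD hlam (isBoundedDensity_density hD hlam n q)
    (isBoundedDensity_density hD hlam m p) hq hp (density_solves hD hlam n q)
    (density_solves hD hlam m p)

theorem isHarmonic_coeffRe (m : ℕ) : IsHarmonic (homPoly m (coeffRe m)) := by
  rw [homPoly_coeffRe]
  exact isHarmonic_harmonicPoly _ _

theorem isHarmonic_coeffIm (m : ℕ) : IsHarmonic (homPoly m (coeffIm m)) := by
  rw [homPoly_coeffIm]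
  exact isHarmonic_harmonicPoly _ _

theorem Mcc_symm (hD : IsBoundedC2Domain D) (hlam : 1 / 2 < |lam|) (m n : ℕ) :
    Mcc lam D m n = Mcc lam D n m :=
  contraction_symm hD hlam (isHarmonic_coeffRe m) (isHarmonic_coeffRe n)

theorem Mss_symm (hD : IsBoundedC2Domain D) (hlam : 1 / 2 < |lam|) (m n : ℕ) :
    Mss lam D m n = Mss lam D n m :=
  contraction_symm hD hlam (isHarmonic_coeffIm m) (isHarmonic_coeffIm n)

theorem Mcs_eq_Msc (hD : IsBoundedC2Domain D) (hlam : 1 / 2 < |lam|) (m n : ℕ) :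
    Mcs lam D m n = Msc lam D n m :=
  contraction_symm hD hlam (isHarmonic_coeffRe m) (isHarmonic_coeffIm n)

theorem N2_diag (hD : IsBoundedC2Domain D) (hlam : 1 / 2 < |lam|) (m : ℕ+) :
    N2 lam D m m = ((Mcc lam D m m + Mss lam D m m : ℝ) : ℂ) := by
  rw [N2, Mcs_eq_Msc hD hlam]
  simp

/-- One strict summand suffices: Re z^m has positive Dirichlet energy for m ≥ 1, and the summand of
Im z^m is nonnegative anyway. -/
theorem Mcc_add_Mss_pos (hD : IsBoundedC2Domain D) (hlam : 1 / 2 < lam) {m : ℕ} (hm : 0 < m) :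
    0 < Mcc lam D m m + Mss lam D m m := by
  have hlam' : 1 / 2 < |lam| := hlam.trans_le (le_abs_self _)
  have hE := integral_harmonicPoly_mul_normalDeriv_pos hD one_ne_zero hm
  rw [← homPoly_coeffRe] at hE
  have h1 := (integral_mul_nonneg_of_solves hD hlam (isBoundedDensity_density hD hlam' m _)
    (isHarmonic_coeffRe m) (density_solves hD hlam' m _)).2 hE
  have h2 := (integral_mul_nonneg_of_solves hD hlam (isBoundedDensity_density hD hlam' m _)
    (isHarmonic_coeffIm m) (density_solves hD hlam' m _)).1
  rw [Mcc, Mss, contraction_eq_integral hD hlam', contraction_eq_integral hD hlam']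
  linarith

theorem Mcc_add_Mss_neg (hD : IsBoundedC2Domain D) (hlam : lam < -(1 / 2)) {m : ℕ} (hm : 0 < m) :
    Mcc lam D m m + Mss lam D m m < 0 := by
  have hlam' : 1 / 2 < |lam| := by rw [lt_abs]; right; linarith
  have hE := integral_harmonicPoly_mul_normalDeriv_pos hD one_ne_zero hm
  rw [← homPoly_coeffRe] at hE
  have h1 := (integral_mul_nonpos_of_solves hD hlam (isBoundedDensity_density hD hlam' m _)
    (isHarmonic_coeffRe m) (density_solves hD hlam' m _)).2 hE
  have h2 := (integral_mul_nonpos_of_solves hD hlam (isBoundedDensity_density hD hlam' m _)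
    (isHarmonic_coeffIm m) (density_solves hD hlam' m _)).1
  rw [Mcc, Mss, contraction_eq_integral hD hlam', contraction_eq_integral hD hlam']
  linarith

end
end CGPT
end

/-! ### Assembly of the theorem. -/

theorem mainTheorem4 (D : Set CGPT.Plane) (hD : CGPT.IsBoundedC2Domain D)
    (lam : ℝ) (hlam : 1 / 2 < |lam|) :
    CGPT.ResolventExists D lam ∧
    (CGPT.N1 lam D).transpose = CGPT.N1 lam D ∧
    (CGPT.N2 lam D).conjTranspose = CGPT.N2 lam D ∧
    (0 < lam → ∀ m : ℕ+, 0 < CGPT.N2 lam D m m) ∧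
    (lam < 0 → ∀ m : ℕ+, CGPT.N2 lam D m m < 0) := by
  refine ⟨CGPT.resolventExists hD hlam, ?_, ?_, fun hpos m => ?_, fun hneg m => ?_⟩
  · ext m n
    rw [Matrix.transpose_apply, CGPT.N1, CGPT.N1, CGPT.Mcc_symm hD hlam n m,
      CGPT.Mss_symm hD hlam n m, CGPT.Mcs_eq_Msc hD hlam n m, CGPT.Mcs_eq_Msc hD hlam m n,
      add_comm (CGPT.Msc lam D m n)]
  · ext m n
    rw [Matrix.conjTranspose_apply, CGPT.N2, CGPT.N2, CGPT.Mcc_symm hD hlam n m,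
      CGPT.Mss_symm hD hlam n m, CGPT.Mcs_eq_Msc hD hlam n m, CGPT.Mcs_eq_Msc hD hlam m n]
    simp only [star_add, star_mul', RCLike.star_def, Complex.conj_ofReal, Complex.conj_I]
    push_cast
    ring
  -- A strict inequality in the order on ℂ includes equality of imaginary parts, so the entry is
  -- first written as a real number.
  · rw [CGPT.N2_diag hD hlam]
    rw [abs_of_pos hpos] at hlam
    exact_mod_cast CGPT.Mcc_add_Mss_pos hD hlam m.pos
  · rw [CGPT.N2_diag hD hlam]
    rw [abs_of_neg hneg] at hlam
    exact_mod_cast CGPT.Mcc_add_Mss_neg hD (by linarith) m.pos
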